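/- Manifolds are smooth, Hausdorff, second countable and finite-dimensional. Definitions. An almost para-complex structure on a manifold $X$ is a smooth section $J$ of $\mathrm{End}\,TX$ with $J\neq \mathrm{Id}$, $J^2=\mathrm{Id}$, whose eigendistributions $T^{\pm}X=\ker(\mathrm{Id}\mp J)$ have the same rank; it is a para-complex structure if $T^+X$ and $T^-X$ are both integrable, i.e. around every point each of them is given by a constant linear subspace in suitable local coordinates. A complex structure is a smooth section $J$ of $\mathrm{End}\,TX$ with $J^2=-\mathrm{Id}$ that is integrable, i.e. $X$ has local holomorphic coordinates for $J$ around every point. A para-Kähler manifold $(M,J,g)$ is a manifold with a para-complex structure $J$ and a pseudo-Riemannian metric $g$ for which $J$ is skew-symmetric, such that the fundamental two-form $\omega=g(J\cdot,\cdot)$ is closed. A special para-Kähler manifold $(M,J,g,\nabla)$ is a para-Kähler manifold with a flat torsion-free connection $\nabla$ such that $\nabla\omega=0$ and $(\nabla_XJ)Y=(\nabla_YJ)X$ for all vector fields $X,Y$. A para-hyper-Kähler manifold is a manifold with a pseudo-Riemannian metric and three pairwise anticommuting fields of endomorphisms $J_1,J_2,J_3=J_1J_2$, two of which are para-complex structures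 and one of which is a complex structure, all skew-symmetric for the metric, and whose three fundamental two-forms are closed. Theorem. Let $(M,J,g,\nabla)$ be a special para-Kähler manifold with para-Kähler form $\omega=g(J\cdot,\cdot)$, and let $\pi:N=T^*M\to M$ be its cotangent bundle. For $\xi\in N$, $p=\pi(\xi)$, the connection gives the decomposition of $T_\xi N$ into the $\nabla$-horizontal space (identified with $T_pM$ by $d\pi_\xi$) and the vertical space $\ker d\pi_\xi$ (identified with $T^*_pM$), hence $T_\xi N\cong T_pM\oplus T_p^*M$. With respect to it put, for $v,v'\in T_pM$ and $\alpha,\alpha'\in T_p^*M$, $$J_1(v,\alpha)=(Jv,\ \alpha\circ J),\qquad J_2(v,\alpha)=(\omega^{-1}\alpha,\ \omega v),\qquad J_3=J_1J_2,$$ $$g_N\big((v,\alpha),(v',\alpha')\big)=g(v,v')+g^{-1}(\alpha,\alpha'),$$ where $\omega$ is regarded as the isomorphism $v\mapsto\omega(v,\cdot)$ and $g^{-1}$ is the metric on $T^*M$ dual to $g$. Then $(N,J_1,J_2,J_3,g_N)$ is a para-hyper-Kähler manifold: $J_1$ and $J_2$ are (integrable) para-complex structures, $J_3$ is a complex structure,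 the three are pairwise anticommuting and skew-symmetric with respect to the pseudo-Riemannian metric $g_N$, and the two-forms $g_N(J_\alpha\cdot,\cdot)$, $\alpha=1,2,3$, are closed. -/

import Mathlib

open Bundle
open scoped Manifold ContDiff Topology

noncomputable section

section Structures

variable {E : Type*} [NormedAddCommGroup E] [NormedSpace ℝ E]
  {H : Type*} [TopologicalSpace H] (I : ModelWithCorners ℝ E H)
  (X : Type*) [TopologicalSpace X] [ChartedSpace H X]

/-- Fields of endomorphisms of the tangent spaces (smoothness is a separate condition). -/
abbrev EndField : Type _ := Π x : X, TangentSpace I x →L[ℝ] TangentSpace I x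

/-- Fields of bilinear forms on the tangent spaces (smoothness is a separate condition). -/
abbrev BilinField : Type _ := Π x : X, TangentSpace I x →L[ℝ] TangentSpace I x →L[ℝ] ℝ

/-- Distributions: fields of linear subspaces of the tangent spaces. -/
abbrev SubspaceField : Type _ := Π x : X, Submodule ℝ (TangentSpace I x)

variable {X}

/-- The eigendistribution `ker (Id - J)`. -/
def eigenPlus (J : EndField I X) : SubspaceField I X := fun x ↦
  LinearMap.ker (ContinuousLinearMap.id ℝ (TangentSpace I x) - J x).toLinearMap

/-- The eigendistribution `ker (Id + J)`. -/
def eigenMinus (J : EndField I X) : SubspaceField I X := fun x ↦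
  LinearMap.ker (ContinuousLinearMap.id ℝ (TangentSpace I x) + J x).toLinearMap

/-- The fundamental form `g (J ·, ·)`. -/
def fundForm (J : EndField I X) (g : BilinField I X) : BilinField I X := fun x ↦ g x ∘L J x

variable [IsManifold I ∞ X]

/-- `V` is a smooth vector field. -/
def IsSmoothVectorField (V : Π x : X, TangentSpace I x) : Prop :=
  ContMDiff I I.tangent ∞ (fun x ↦ (⟨x, V x⟩ : TangentBundle I X))

/-- `A` is a smooth section of the bundle `End TX`. -/
def IsSmoothEndField (A : EndField I X) : Prop :=
  ContMDiff I (I.prod 𝓘(ℝ, E →L[ℝ] E)) ∞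
    (fun x ↦ TotalSpace.mk' (E →L[ℝ] E)
      (E := fun x : X ↦ TangentSpace I x →L[ℝ] TangentSpace I x) x (A x))

/-- `b` is a smooth section of the bundle of bilinear forms on `TX`. -/
def IsSmoothBilinField (b : BilinField I X) : Prop :=
  ContMDiff I (I.prod 𝓘(ℝ, E →L[ℝ] E →L[ℝ] ℝ)) ∞
    (fun x ↦ TotalSpace.mk' (E →L[ℝ] E →L[ℝ] ℝ)
      (E := fun x : X ↦ TangentSpace I x →L[ℝ] TangentSpace I x →L[ℝ] ℝ) x (b x))

/-- A distribution is integrable if around every point there is a smooth coordinate system in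
which it is given by a fixed linear subspace of the model space (a foliated chart); the level sets
of the transverse coordinates are then its local leaves. -/
def IsIntegrableDistribution (D : SubspaceField I X) : Prop :=
  ∀ x₀ : X, ∃ φ ∈ IsManifold.maximalAtlas I ∞ X, x₀ ∈ φ.source ∧ ∃ W : Submodule ℝ E,
    ∀ x ∈ φ.source, ∀ v : TangentSpace I x,
      v ∈ D x ↔ mfderiv I 𝓘(ℝ, E) (φ.extend I) x v ∈ W

/-- Almost para-complex structures: smooth fields of involutions, different from the identity,
whose two eigendistributions have the same rank. -/
structure IsAlmostParaComplex (J : EndField I X) : Prop where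
  smooth : IsSmoothEndField I J
  ne_id : J ≠ fun x ↦ ContinuousLinearMap.id ℝ (TangentSpace I x)
  involution : ∀ (x : X) (v : TangentSpace I x), J x (J x v) = v
  rank_eq : ∀ x : X, Module.finrank ℝ (eigenPlus I J x) = Module.finrank ℝ (eigenMinus I J x)

/-- Para-complex structures: both eigendistributions are integrable. -/
structure IsParaComplex (J : EndField I X) : Prop extends IsAlmostParaComplex I J where
  integrable_plus : IsIntegrableDistribution I (eigenPlus I J)
  integrable_minus : IsIntegrableDistribution I (eigenMinus I J)

/-- Almost complex structures. -/
structure IsAlmostComplex (J : EndField I X) : Prop where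
  smooth : IsSmoothEndField I J
  sq_eq_neg : ∀ (x : X) (v : TangentSpace I x), J x (J x v) = -v

/-- Complex structures: almost complex structures that are integrable, i.e. around every point
there are holomorphic coordinates, a smooth coordinate system whose differential intertwines `J`
with a constant linear complex structure `J₀` of the model space. -/
structure IsComplexStructure (J : EndField I X) : Prop extends IsAlmostComplex I J where
  integrable : ∀ x₀ : X, ∃ φ ∈ IsManifold.maximalAtlas I ∞ X, x₀ ∈ φ.source ∧
    ∃ J₀ : E →L[ℝ] E, (∀ u : E, J₀ (J₀ u) = -u) ∧
      ∀ x ∈ φ.source, ∀ v : TangentSpace I x,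
        mfderiv I 𝓘(ℝ, E) (φ.extend I) x (J x v) = J₀ (mfderiv I 𝓘(ℝ, E) (φ.extend I) x v)

/-- Pseudo-Riemannian metrics, of arbitrary signature. -/
structure IsPseudoRiemannian (g : BilinField I X) : Prop where
  smooth : IsSmoothBilinField I g
  symm : ∀ (x : X) (v w : TangentSpace I x), g x v w = g x w v
  nondegenerate : ∀ (x : X) (v : TangentSpace I x), (∀ w : TangentSpace I x, g x v w = 0) → v = 0

/-- The endomorphism field `J` is skew-symmetric with respect to `g`. -/
def IsSkewFor (J : EndField I X) (g : BilinField I X) : Prop :=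
  ∀ (x : X) (v w : TangentSpace I x), g x (J x v) w = -g x v (J x w)

/-- The two-form `σ` is closed: `dσ (U, V, W) = 0` for all smooth vector fields, with `dσ` given
by the invariant formula for the exterior derivative. -/
def IsClosedTwoForm (σ : BilinField I X) : Prop :=
  ∀ U V W : Π x : X, TangentSpace I x,
    IsSmoothVectorField I U → IsSmoothVectorField I V → IsSmoothVectorField I W → ∀ x : X,
      mvfderiv I (fun y ↦ σ y (V y) (W y)) x (U x)
        - mvfderiv I (fun y ↦ σ y (U y) (W y)) x (V x)
        + mvfderiv I (fun y ↦ σ y (U y) (V y)) x (W x)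
        - σ x (VectorField.mlieBracket I U V x) (W x)
        + σ x (VectorField.mlieBracket I U W x) (V x)
        - σ x (VectorField.mlieBracket I V W x) (U x) = 0

/-- Para-Kähler structures `(J, g)`. -/
structure IsParaKahler (J : EndField I X) (g : BilinField I X) : Prop where
  paraComplex : IsParaComplex I J
  metric : IsPseudoRiemannian I g
  skew : IsSkewFor I J g
  closed : IsClosedTwoForm I (fundForm I J g)

/-- Para-hypercomplex structures `(J₁, J₂, J₃)`: three pairwise anticommuting endomorphism fields
with `J₃ = J₁ J₂`, two of which are para-complex structures and one a complex structure. -/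
structure IsParaHypercomplex (J₁ J₂ J₃ : EndField I X) : Prop where
  eq_comp : ∀ (x : X) (v : TangentSpace I x), J₃ x v = J₁ x (J₂ x v)
  anticomm₁₂ : ∀ (x : X) (v : TangentSpace I x), J₁ x (J₂ x v) = -J₂ x (J₁ x v)
  anticomm₁₃ : ∀ (x : X) (v : TangentSpace I x), J₁ x (J₃ x v) = -J₃ x (J₁ x v)
  anticomm₂₃ : ∀ (x : X) (v : TangentSpace I x), J₂ x (J₃ x v) = -J₃ x (J₂ x v)
  types : (IsParaComplex I J₁ ∧ IsParaComplex I J₂ ∧ IsComplexStructure I J₃) ∨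
    (IsParaComplex I J₁ ∧ IsComplexStructure I J₂ ∧ IsParaComplex I J₃) ∨
    (IsComplexStructure I J₁ ∧ IsParaComplex I J₂ ∧ IsParaComplex I J₃)

/-- Para-hyper-Hermitian structures. -/
structure IsParaHyperHermitian (J₁ J₂ J₃ : EndField I X) (g : BilinField I X) : Prop where
  hypercomplex : IsParaHypercomplex I J₁ J₂ J₃
  metric : IsPseudoRiemannian I g
  skew₁ : IsSkewFor I J₁ g
  skew₂ : IsSkewFor I J₂ g
  skew₃ : IsSkewFor I J₃ g

/-- Para-hyper-Kähler structures: the three fundamental two-forms are closed. -/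
structure IsParaHyperKahler (J₁ J₂ J₃ : EndField I X) (g : BilinField I X) : Prop
    extends IsParaHyperHermitian I J₁ J₂ J₃ g where
  closed₁ : IsClosedTwoForm I (fundForm I J₁ g)
  closed₂ : IsClosedTwoForm I (fundForm I J₂ g)
  closed₃ : IsClosedTwoForm I (fundForm I J₃ g)

variable {I}

/-- A linear connection is flat: `∇_U ∇_V W - ∇_V ∇_U W - ∇_{[U, V]} W = 0` for all smooth vector
fields. (`cov W x (U x)` is `(∇_U W) x`.) -/
def IsFlatConnection (cov : CovariantDerivative I E (TangentSpace I : X → Type _)) : Prop :=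
  ∀ U V W : Π x : X, TangentSpace I x,
    IsSmoothVectorField I U → IsSmoothVectorField I V → IsSmoothVectorField I W → ∀ x : X,
      cov (fun y ↦ cov W y (V y)) x (U x) - cov (fun y ↦ cov W y (U y)) x (V x)
        - cov W x (VectorField.mlieBracket I U V x) = 0

/-- The field of bilinear forms `σ` is parallel: `∇σ = 0`. -/
def IsParallelForm (cov : CovariantDerivative I E (TangentSpace I : X → Type _))
    (σ : BilinField I X) : Prop :=
  ∀ U V W : Π x : X, TangentSpace I x,
    IsSmoothVectorField I U → IsSmoothVectorField I V → IsSmoothVectorField I W → ∀ x : X,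
      mvfderiv I (fun y ↦ σ y (V y) (W y)) x (U x)
        - σ x (cov V x (U x)) (W x) - σ x (V x) (cov W x (U x)) = 0

/-- The tensor field `∇J` is symmetric: `(∇_U J) V = (∇_V J) U`, where
`(∇_U J) V = ∇_U (J V) - J (∇_U V)`. -/
def HasSymmetricDeriv (cov : CovariantDerivative I E (TangentSpace I : X → Type _))
    (J : EndField I X) : Prop :=
  ∀ U V : Π x : X, TangentSpace I x, IsSmoothVectorField I U → IsSmoothVectorField I V →
    ∀ x : X,
      cov (fun y ↦ J y (V y)) x (U x) - J x (cov V x (U x)) =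
        cov (fun y ↦ J y (U y)) x (V x) - J x (cov U x (V x))

/-- (Affine) special para-Kähler structures `(J, g, ∇)`. -/
structure IsSpecialParaKahler [FiniteDimensional ℝ E] (J : EndField I X) (g : BilinField I X)
    (cov : CovariantDerivative I E (TangentSpace I : X → Type _)) : Prop where
  paraKahler : IsParaKahler I J g
  smooth_cov : CovariantDerivative.ContMDiffCovariantDerivative cov ∞
  torsionFree : cov.torsion = 0
  flat : IsFlatConnection cov
  symplectic : IsParallelForm cov (fundForm I J g)
  symmetric : HasSymmetricDeriv cov J

end Structures

section Cotangent

variable {E : Type*} [NormedAddCommGroup E] [NormedSpace ℝ E]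
  {H : Type*} [TopologicalSpace H] (I : ModelWithCorners ℝ E H)
  (M : Type*) [TopologicalSpace M] [ChartedSpace H M]

/-- The total space of the cotangent bundle, with the topology and charts of a vector bundle. -/
abbrev CotangentBundle : Type _ :=
  TotalSpace (E →L[ℝ] ℝ) (fun p : M ↦ TangentSpace I p →L[ℝ] ℝ)

/-- The model with corners of the cotangent bundle as a manifold. -/
abbrev cotModel : ModelWithCorners ℝ (E × (E →L[ℝ] ℝ)) (ModelProd H (E →L[ℝ] ℝ)) :=
  I.prod 𝓘(ℝ, E →L[ℝ] ℝ)

variable {I M}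

instance instFiniteDimensionalTangentSpace [FiniteDimensional ℝ E] (p : M) :
    FiniteDimensional ℝ (TangentSpace I p) :=
  inferInstanceAs (FiniteDimensional ℝ E)

instance instT2SpaceTangentSpace (p : M) : T2Space (TangentSpace I p) :=
  inferInstanceAs (T2Space E)

variable [IsManifold I ∞ M]

/-- The fibrewise linear function `ξ ↦ ξ (Y (π ξ))` on the cotangent bundle given by a vector
field `Y` on the base. -/
def cotEval (Y : Π p : M, TangentSpace I p) (ξ : CotangentBundle I M) : ℝ :=
  ξ.snd (Y ξ.proj)

/-- The differential `dπ` of the projection of the cotangent bundle. -/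
def cotProjDeriv (ξ : CotangentBundle I M) :
    TangentSpace (cotModel I) ξ →L[ℝ] TangentSpace I ξ.proj :=
  mfderiv (cotModel I) I (TotalSpace.proj : CotangentBundle I M → M) ξ

theorem mdiff_cotEval {Y : Π p : M, TangentSpace I p} {ξ : CotangentBundle I M}
    (hY : MDifferentiableAt I I.tangent (fun p ↦ (⟨p, Y p⟩ : TangentBundle I M)) ξ.proj) :
    MDifferentiableAt (cotModel I) 𝓘(ℝ, ℝ) (cotEval Y) ξ := by
  have h1 : MDifferentiableAt (cotModel I) (I.prod 𝓘(ℝ, E →L[ℝ] ℝ))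
      (fun η : CotangentBundle I M ↦ TotalSpace.mk' (E →L[ℝ] ℝ)
        (E := fun p : M ↦ TangentSpace I p →L[ℝ] Bundle.Trivial M ℝ p) η.proj η.snd) ξ :=
    mdifferentiableAt_id
  have hp : MDifferentiableAt (cotModel I) I (TotalSpace.proj : CotangentBundle I M → M) ξ :=
    mdifferentiableAt_proj _
  have h2 : MDifferentiableAt (cotModel I) (I.prod 𝓘(ℝ, E))
      (fun η : CotangentBundle I M ↦ TotalSpace.mk' E
        (E := fun p : M ↦ TangentSpace I p) η.proj (Y η.proj)) ξ :=
    MDifferentiableAt.comp ξ hY hp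
  have h3 := MDifferentiableAt.clm_bundle_apply (F₁ := E) (F₂ := ℝ)
    (E₁ := fun p : M ↦ TangentSpace I p) (E₂ := Bundle.Trivial M ℝ)
    (b := fun η : CotangentBundle I M ↦ η.proj) (ϕ := fun η ↦ η.snd)
    (v := fun η ↦ Y η.proj) h1 h2
  rw [mdifferentiableAt_totalSpace] at h3
  exact h3.2

/-- The expression `d(cotEval Y)_ξ w - ξ (∇_{dπ w} Y)`; it depends on `Y` only through its value at
the base point of `ξ`. -/
def connectorAux (cov : CovariantDerivative I E (TangentSpace I : M → Type _))
    (ξ : CotangentBundle I M) (w : TangentSpace (cotModel I) ξ) (Y : Π p : M, TangentSpace I p) :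
    ℝ :=
  mvfderiv (cotModel I) (cotEval Y) ξ w - ξ.snd (cov Y ξ.proj (cotProjDeriv ξ w))

theorem tensorialAt_connectorAux (cov : CovariantDerivative I E (TangentSpace I : M → Type _))
    (ξ : CotangentBundle I M) (w : TangentSpace (cotModel I) ξ) :
    TensorialAt I E (connectorAux cov ξ w) ξ.proj where
  smul {f Y} hf hY := by
    have hp : MDifferentiableAt (cotModel I) I (TotalSpace.proj : CotangentBundle I M → M) ξ :=
      mdifferentiableAt_proj _
    have e : cotEval (f • Y) = (f ∘ TotalSpace.proj) * cotEval Y := by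
      funext η
      simp [cotEval]
    have hfp := MDifferentiableAt.comp ξ hf hp
    have hc : mfderiv (cotModel I) 𝓘(ℝ, ℝ) (f ∘ (TotalSpace.proj : CotangentBundle I M → M)) ξ
        = _ := mfderiv_comp ξ hf hp
    simp only [connectorAux, e, mvfderiv_mul hfp (mdiff_cotEval hY),
      cov.isCovariantDerivativeOn.leibniz hY hf]
    simp [mvfderiv, hc, cotEval, cotProjDeriv]
    ring
  add {Y Y'} hY hY' := by
    have e : cotEval (Y + Y') = cotEval Y + cotEval Y' := by
      funext η
      simp [cotEval]
    simp only [connectorAux, e, mvfderiv_add (mdiff_cotEval hY) (mdiff_cotEval hY'),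
      cov.isCovariantDerivativeOn.add hY hY']
    simp
    ring

theorem connectorAux_add (cov : CovariantDerivative I E (TangentSpace I : M → Type _))
    (ξ : CotangentBundle I M) (w w' : TangentSpace (cotModel I) ξ)
    (Y : Π p : M, TangentSpace I p) :
    connectorAux cov ξ (w + w') Y = connectorAux cov ξ w Y + connectorAux cov ξ w' Y := by
  have h1 := (mvfderiv (cotModel I) (cotEval Y) ξ).map_add w w'
  have h2 := (cotProjDeriv ξ).map_add w w'
  have h3 := (cov Y ξ.proj).map_add (cotProjDeriv ξ w) (cotProjDeriv ξ w')
  have h4 := ξ.snd.map_add (cov Y ξ.proj (cotProjDeriv ξ w)) (cov Y ξ.proj (cotProjDeriv ξ w'))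
  rw [connectorAux, connectorAux, connectorAux, h1, h2, h3, h4]
  ring

theorem connectorAux_smul (cov : CovariantDerivative I E (TangentSpace I : M → Type _))
    (ξ : CotangentBundle I M) (c : ℝ) (w : TangentSpace (cotModel I) ξ)
    (Y : Π p : M, TangentSpace I p) :
    connectorAux cov ξ (c • w) Y = c * connectorAux cov ξ w Y := by
  have h1 := (mvfderiv (cotModel I) (cotEval Y) ξ).map_smul c w
  have h2 := (cotProjDeriv ξ).map_smul c w
  have h3 := (cov Y ξ.proj).map_smul c (cotProjDeriv ξ w)
  have h4 := ξ.snd.map_smul c (cov Y ξ.proj (cotProjDeriv ξ w))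
  rw [connectorAux, connectorAux, h1, h2, h3, h4, smul_eq_mul, smul_eq_mul]
  ring

variable [FiniteDimensional ℝ E]

/-- The vertical projection `T_ξ T*M → T*_pM` of the linear connection: it sends `w` to the covector
`Y ↦ d(cotEval Y)_ξ w - ξ (∇_{dπ w} Y)`. Its kernel is the horizontal space; on a vector
`w = dα (v)` tangent to a one-form `α` with `α p = ξ` it is `∇_v α`, and on vertical vectors it is
the canonical identification of `ker dπ` with `T*_pM`. -/
def connector (cov : CovariantDerivative I E (TangentSpace I : M → Type _))
    (ξ : CotangentBundle I M) :
    TangentSpace (cotModel I) ξ →ₗ[ℝ] (TangentSpace I ξ.proj →L[ℝ] ℝ) where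
  toFun w := TensorialAt.mkHom (connectorAux cov ξ w) ξ.proj (tensorialAt_connectorAux cov ξ w)
  map_add' w w' := by
    ext v
    exact connectorAux_add cov ξ w w' _
  map_smul' c w := by
    ext v
    exact connectorAux_smul cov ξ c w _

theorem connector_apply (cov : CovariantDerivative I E (TangentSpace I : M → Type _))
    {ξ : CotangentBundle I M} {Y : Π p : M, TangentSpace I p}
    (hY : MDifferentiableAt I I.tangent (fun p ↦ (⟨p, Y p⟩ : TangentBundle I M)) ξ.proj)
    (w : TangentSpace (cotModel I) ξ) :
    connector cov ξ w (Y ξ.proj) =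
      mvfderiv (cotModel I) (cotEval Y) ξ w - ξ.snd (cov Y ξ.proj (cotProjDeriv ξ w)) :=
  TensorialAt.mkHom_apply (tensorialAt_connectorAux cov ξ w) hY

theorem eq_zero_of_connector (cov : CovariantDerivative I E (TangentSpace I : M → Type _))
    {ξ : CotangentBundle I M} {w : TangentSpace (cotModel I) ξ}
    (hπ : cotProjDeriv ξ w = 0) (hK : connector cov ξ w = 0) : w = 0 := by
  have hev (y : TangentSpace I ξ.proj) :
      mfderiv (cotModel I) 𝓘(ℝ, ℝ) (cotEval (FiberBundle.extend E y)) ξ w = 0 := by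
    have := connector_apply cov (ξ := ξ) (Y := FiberBundle.extend E y)
      (FiberBundle.mdifferentiableAt_extend ..) w
    rw [hK, hπ] at this
    simpa [mvfderiv] using this.symm
  have hp : MDifferentiableAt (cotModel I) I (TotalSpace.proj : CotangentBundle I M → M) ξ :=
    mdifferentiableAt_proj _
  have hφ : MDifferentiableAt (cotModel I) 𝓘(ℝ, E × (E →L[ℝ] ℝ)) (extChartAt (cotModel I) ξ) ξ :=
    mdifferentiableAt_extChartAt (mem_chart_source _ ξ)
  have hinv : (mfderiv (cotModel I) 𝓘(ℝ, E × (E →L[ℝ] ℝ))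
      (extChartAt (cotModel I) ξ) ξ).IsInvertible :=
    isInvertible_mfderiv_extChartAt (mem_extChartAt_source ξ)
  apply hinv.injective
  rw [ContinuousLinearMap.map_zero]
  have hnear : ∀ᶠ η in 𝓝 ξ,
      η.proj ∈ (trivializationAt E (TangentSpace I : M → Type _) ξ.proj).baseSet :=
    hp.continuousAt.eventually
      ((trivializationAt E (TangentSpace I : M → Type _) ξ.proj).open_baseSet.mem_nhds
        (FiberBundle.mem_baseSet_trivializationAt' _))
  have hchart (η : CotangentBundle I M) : extChartAt (cotModel I) ξ η =
      (extChartAt I ξ.proj η.proj, ContinuousLinearMap.inCoordinates E (TangentSpace I : M → Type _)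
        ℝ (Bundle.Trivial M ℝ) ξ.proj η.proj ξ.proj η.proj η.snd) := by
    have := hom_chart (HB := H) (E₁ := (TangentSpace I : M → Type _)) (E₂ := Bundle.Trivial M ℝ)
      (F₁ := E) (F₂ := ℝ) (𝕜 := ℝ) ξ η
    change (cotModel I) (chartAt (ModelProd H (E →L[ℝ] ℝ)) ξ η) = _
    erw [this]
    rfl
  refine Prod.ext ?_ ?_
  · have h1 := mfderiv_comp (I'' := 𝓘(ℝ, E)) ξ
      (ContinuousLinearMap.mdifferentiableAt (ContinuousLinearMap.fst ℝ E (E →L[ℝ] ℝ))) hφ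
    have h2 := mfderiv_comp (I'' := 𝓘(ℝ, E)) ξ
      (mdifferentiableAt_extChartAt (I := I) (mem_chart_source _ ξ.proj)) hp
    have h3 : (ContinuousLinearMap.fst ℝ E (E →L[ℝ] ℝ)) ∘ (extChartAt (cotModel I) ξ) =
        (extChartAt I ξ.proj) ∘ (TotalSpace.proj : CotangentBundle I M → M) := by
      funext η
      exact congr($(hchart η).1)
    rw [h3, h2, ContinuousLinearMap.mfderiv_eq] at h1
    have h4 := congr($h1 w)
    refine h4.symm.trans ?_
    change (mfderiv I 𝓘(ℝ, E) (extChartAt I ξ.proj) ξ.proj) (cotProjDeriv ξ w) = 0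
    rw [hπ, ContinuousLinearMap.map_zero]
  · refine ContinuousLinearMap.ext fun y ↦ ?_
    let L : (E × (E →L[ℝ] ℝ)) →L[ℝ] ℝ :=
      (ContinuousLinearMap.apply ℝ ℝ y) ∘L (ContinuousLinearMap.snd ℝ E (E →L[ℝ] ℝ))
    let t := trivializationAt E (TangentSpace I : M → Type _) ξ.proj
    have hy : L ∘ (extChartAt (cotModel I) ξ) =ᶠ[𝓝 ξ]
        cotEval (FiberBundle.extend E (x := ξ.proj) (t.symm ξ.proj y)) := by
      filter_upwards [hnear] with η hη
      have h5 : L (extChartAt (cotModel I) ξ η) = (extChartAt (cotModel I) ξ η).2 y := rfl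
      have h6 : FiberBundle.extend E (x := ξ.proj) (t.symm ξ.proj y) η.proj =
          t.symm η.proj (t ⟨ξ.proj, t.symm ξ.proj y⟩).2 := rfl
      rw [Function.comp_apply, h5, hchart η, cotEval, h6,
        t.apply_mk_symm (FiberBundle.mem_baseSet_trivializationAt' _)]
      have h7 : Trivialization.continuousLinearMapAt ℝ
          (trivializationAt ℝ (Bundle.Trivial M ℝ) ξ.proj) η.proj = ContinuousLinearMap.id ℝ ℝ :=
        Trivial.continuousLinearMapAt_trivialization ℝ M ℝ η.proj
      rw [ContinuousLinearMap.inCoordinates, h7]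
      change η.snd (Trivialization.symmL ℝ t η.proj y) = η.snd (t.symm η.proj y)
      rw [Trivialization.symmL_apply t hη y]
    have h1 := mfderiv_comp (I'' := 𝓘(ℝ, ℝ)) ξ (ContinuousLinearMap.mdifferentiableAt L) hφ
    rw [hy.mfderiv_eq, ContinuousLinearMap.mfderiv_eq] at h1
    exact (congr($h1 w)).symm.trans (hev _)

/-- The identification `T_ξ T*M = H_ξ ⊕ ker dπ ≅ T_pM ⊕ T*_pM` given by a linear connection. -/
def splitting (cov : CovariantDerivative I E (TangentSpace I : M → Type _))
    (ξ : CotangentBundle I M) :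
    TangentSpace (cotModel I) ξ ≃ₗ[ℝ]
      TangentSpace I ξ.proj × (TangentSpace I ξ.proj →L[ℝ] ℝ) :=
  LinearEquiv.ofInjectiveOfFinrankEq
    ((cotProjDeriv ξ).toLinearMap.prod (connector cov ξ))
    (by
      rw [injective_iff_map_eq_zero]
      intro w hw
      exact eq_zero_of_connector cov (congrArg Prod.fst hw) (congrArg Prod.snd hw))
    rfl

/-- The endomorphism field on `T*M` given by endomorphisms `A ξ` of `T_pM ⊕ T*_pM`, `p = π ξ`. -/
def endOfSplitting (cov : CovariantDerivative I E (TangentSpace I : M → Type _))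
    (A : Π ξ : CotangentBundle I M,
      (TangentSpace I ξ.proj × (TangentSpace I ξ.proj →L[ℝ] ℝ)) →ₗ[ℝ]
        (TangentSpace I ξ.proj × (TangentSpace I ξ.proj →L[ℝ] ℝ))) :
    EndField (cotModel I) (CotangentBundle I M) := fun ξ ↦
  LinearMap.toContinuousLinearMap
    ((splitting cov ξ).symm.toLinearMap ∘ₗ A ξ ∘ₗ (splitting cov ξ).toLinearMap)

/-- `J^∇ (v, α) = (J v, α ∘ J)`. -/
def cotJNabla (cov : CovariantDerivative I E (TangentSpace I : M → Type _)) (J : EndField I M) :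
    EndField (cotModel I) (CotangentBundle I M) :=
  endOfSplitting cov fun ξ ↦
    { toFun := fun q ↦ (J ξ.proj q.1, q.2 ∘L J ξ.proj)
      map_add' := fun q r ↦ by ext <;> simp
      map_smul' := fun c q ↦ by ext <;> simp }

/-- `J^σ (v, α) = (σ⁻¹ α, σ v)`, for `σ` considered as the map `v ↦ σ (v, ·)`. -/
def cotJOmega (cov : CovariantDerivative I E (TangentSpace I : M → Type _)) (σ : BilinField I M) :
    EndField (cotModel I) (CotangentBundle I M) :=
  endOfSplitting cov fun ξ ↦
    { toFun := fun q ↦ ((σ ξ.proj).inverse q.2, σ ξ.proj q.1)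
      map_add' := fun q r ↦ by ext <;> simp
      map_smul' := fun c q ↦ by ext <;> simp }

/-- `g_N ((v, α), (v', α')) = g (v, v') + g⁻¹ (α, α')`, where `g⁻¹ (α, α') = α' (g⁻¹ α)` for `g`
considered as the map `v ↦ g (v, ·)`. -/
def cotMetric (cov : CovariantDerivative I E (TangentSpace I : M → Type _)) (g : BilinField I M) :
    BilinField (cotModel I) (CotangentBundle I M) := fun ξ ↦
  LinearMap.toContinuousLinearMap
    { toFun := fun w ↦ LinearMap.toContinuousLinearMap
        { toFun := fun w' ↦
            g ξ.proj (splitting cov ξ w).1 (splitting cov ξ w').1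
              + (splitting cov ξ w').2 ((g ξ.proj).inverse (splitting cov ξ w).2)
          map_add' := fun w' w'' ↦ by simp; ring
          map_smul' := fun c w' ↦ by simp; ring }
      map_add' := fun w w' ↦ by ext; simp; ring
      map_smul' := fun c w ↦ by ext; simp; ring }

end Cotangent

end

noncomputable section

section Frobenius

open Set Metric

variable {E : Type*} [NormedAddCommGroup E] [NormedSpace ℝ E]
  {𝔸 : Type*} [NormedRing 𝔸] [NormedAlgebra ℝ 𝔸]

/-- Second order Taylor estimate for a map with Lipschitz derivative. -/
theorem norm_sub_sub_le_of_lipschitz_fderiv {F : Type*} [NormedAddCommGroup F] [NormedSpace ℝ F]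
    {A : E → F} {A' : E → E →L[ℝ] F} {s : Set E} (hs : Convex ℝ s) {K : ℝ} (hK : 0 ≤ K)
    (hA : ∀ x ∈ s, HasFDerivAt A (A' x) x)
    (hL : ∀ x ∈ s, ∀ y ∈ s, ‖A' x - A' y‖ ≤ K * ‖x - y‖) {x y : E} (hx : x ∈ s) (hy : y ∈ s) :
    ‖A y - A x - A' x (y - x)‖ ≤ K * ‖y - x‖ ^ 2 := by
  have hseg := hs.segment_subset hx hy
  have := (convex_segment x y).norm_image_sub_le_of_norm_hasFDerivWithin_le'
    (f := A) (f' := A') (φ := A' x) (C := K * ‖y - x‖)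
    (fun z hz ↦ (hA z (hseg hz)).hasFDerivWithinAt)
    (fun z hz ↦ (hL z (hseg hz) x hx).trans (by
      gcongr
      exact norm_sub_le_of_mem_segment hz))
    (left_mem_segment ℝ x y) (right_mem_segment ℝ x y)
  refine this.trans (le_of_eq (by ring))

/-- A differentiable solution of `DG = G * A` with smooth `A` is smooth. -/
theorem contDiffOn_of_hasFDerivAt_mul {A : E → E →L[ℝ] 𝔸} {G : E → 𝔸} {s : Set E} (hs : IsOpen s)
    (hA : ContDiffOn ℝ ∞ A s)
    (hG : ∀ x ∈ s, HasFDerivAt G ((ContinuousLinearMap.mul ℝ 𝔸 (G x)) ∘L A x) x) :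
    ContDiffOn ℝ ∞ G s := by
  have hn (n : ℕ) : ContDiffOn ℝ n G s := by
    induction n with
    | zero =>
      exact contDiffOn_zero.2 fun x hx ↦ (hG x hx).continuousAt.continuousWithinAt
    | succ n ih =>
      rw [Nat.cast_add, Nat.cast_one, contDiffOn_succ_iff_fderiv_of_isOpen hs]
      refine ⟨fun x hx ↦ (hG x hx).differentiableAt.differentiableWithinAt, by simp, ?_⟩
      have h1 : ContDiffOn ℝ n (fun x ↦ (ContinuousLinearMap.mul ℝ 𝔸 (G x)) ∘L A x) s :=
        ((ContinuousLinearMap.mul ℝ 𝔸).contDiff.comp_contDiffOn ih).clm_comp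
          (hA.of_le (mod_cast le_top))
      exact h1.congr fun x hx ↦ (hG x hx).fderiv
  exact contDiffOn_infty.2 hn

variable [CompleteSpace 𝔸]

/-- The linear equation `γ' = γ * a` on `[0, 1]` with a small coefficient has a bounded solution
starting at `1`. -/
theorem exists_solution_mul_right {a : ℝ → 𝔸} (ha : ContinuousOn a (Icc 0 1))
    {k : ℝ} (hk : ∀ t ∈ Icc (0 : ℝ) 1, ‖a t‖ ≤ k) (hk1 : (‖(1 : 𝔸)‖ + 1) * k ≤ 1) :
    ∃ γ : ℝ → 𝔸, γ 0 = 1 ∧ (∀ t ∈ Icc (0 : ℝ) 1, HasDerivWithinAt γ (γ t * a t) (Icc 0 1) t) ∧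
      ∀ t ∈ Icc (0 : ℝ) 1, ‖γ t‖ ≤ ‖(1 : 𝔸)‖ * Real.exp k := by
  have hk0 : 0 ≤ k := (norm_nonneg _).trans (hk 0 (by simp))
  have hb : ∀ x ∈ closedBall (1 : 𝔸) 1, ‖x‖ ≤ ‖(1 : 𝔸)‖ + 1 := by
    intro x hx
    have := norm_le_norm_add_norm_sub' x 1
    rw [mem_closedBall, dist_eq_norm] at hx
    linarith
  have hpl : IsPicardLindelof (fun t x ↦ x * a t) (tmin := 0) (tmax := 1) ⟨0, by simp⟩ (1 : 𝔸)
      1 0 1 ⟨k, hk0⟩ := by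
    refine ⟨fun t ht ↦ ?_, fun x hx ↦ continuousOn_const.mul ha, fun t ht x hx ↦ ?_, by simp⟩
    · refine LipschitzWith.lipschitzOnWith (LipschitzWith.of_dist_le_mul fun x y ↦ ?_)
      rw [dist_eq_norm, dist_eq_norm, ← sub_mul, mul_comm]
      exact (norm_mul_le _ _).trans (mul_le_mul_of_nonneg_left (hk t ht) (norm_nonneg _))
    · have := hb x (by simpa using hx)
      calc ‖x * a t‖ ≤ ‖x‖ * ‖a t‖ := norm_mul_le _ _
        _ ≤ (‖(1 : 𝔸)‖ + 1) * k := by gcongr; exact hk t ht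
        _ ≤ _ := by simpa using hk1
  obtain ⟨γ, h0, h1⟩ := hpl.exists_eq_forall_mem_Icc_hasDerivWithinAt₀
  refine ⟨γ, h0, h1, fun t ht ↦ ?_⟩
  have h2 := norm_le_gronwallBound_of_norm_deriv_right_le (f := γ) (f' := fun t ↦ γ t * a t)
    (δ := ‖(1 : 𝔸)‖) (K := k) (ε := 0) (a := 0) (b := 1)
    (fun t ht ↦ (h1 t ht).continuousWithinAt)
    (fun t ht ↦ (h1 t (Ico_subset_Icc_self ht)).mono_of_mem_nhdsWithin
      (Icc_mem_nhdsGE_of_mem ht)) (by rw [h0])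
    (fun t ht ↦ by
      rw [add_zero, mul_comm k]
      exact (norm_mul_le _ _).trans
        (mul_le_mul_of_nonneg_left (hk t (Ico_subset_Icc_self ht)) (norm_nonneg _))) t ht
  rw [gronwallBound_ε0, sub_zero] at h2
  refine h2.trans ?_
  gcongr
  nlinarith [ht.2, ht.1]

/-- Linear Frobenius theorem at the origin: a flat connection form `A` with Lipschitz derivative
has a parallel section. -/
theorem exists_parallel_of_flat_of_lipschitz {A : E → E →L[ℝ] 𝔸} {A' : E → E →L[ℝ] E →L[ℝ] 𝔸}
    {r K : ℝ} (hr : 0 < r) (hK : 0 < K)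
    (hA : ∀ x ∈ ball (0 : E) r, HasFDerivAt A (A' x) x)
    (hbA : ∀ x ∈ ball (0 : E) r, ‖A x‖ ≤ K) (hbA' : ∀ x ∈ ball (0 : E) r, ‖A' x‖ ≤ K)
    (hL : ∀ x ∈ ball (0 : E) r, ∀ y ∈ ball (0 : E) r, ‖A' x - A' y‖ ≤ K * ‖x - y‖)
    (hflat : ∀ x ∈ ball (0 : E) r, ∀ u v,
      A' x u v + A x u * A x v = A' x v u + A x v * A x u) :
    ∃ ρ > 0, ∃ G : E → 𝔸, G 0 = 1 ∧ ∀ x ∈ ball (0 : E) ρ,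
      HasFDerivAt G ((ContinuousLinearMap.mul ℝ 𝔸 (G x)) ∘L A x) x := by
  obtain ⟨ρ, hρ, hρr, hρ1⟩ : ∃ ρ > 0, ρ ≤ r ∧ (‖(1 : 𝔸)‖ + 1) * (K * ρ) ≤ 1 := by
    refine ⟨min r (1 / ((‖(1 : 𝔸)‖ + 1) * K)), by positivity, min_le_left _ _, ?_⟩
    calc (‖(1 : 𝔸)‖ + 1) * (K * min r (1 / ((‖(1 : 𝔸)‖ + 1) * K)))
        ≤ (‖(1 : 𝔸)‖ + 1) * (K * (1 / ((‖(1 : 𝔸)‖ + 1) * K))) := by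
          gcongr; exact min_le_right _ _
      _ = 1 := by field_simp
  have hball (x : E) (hx : x ∈ ball (0 : E) ρ) (t : ℝ) (ht : t ∈ Icc (0 : ℝ) 1) :
      t • x ∈ ball (0 : E) r := by
    rw [mem_ball_zero_iff, norm_smul, Real.norm_of_nonneg ht.1]
    rw [mem_ball_zero_iff] at hx
    nlinarith [norm_nonneg x, ht.2]
  have hcoef (x : E) (hx : x ∈ ball (0 : E) ρ) (t : ℝ) (ht : t ∈ Icc (0 : ℝ) 1) :
      ‖A (t • x) x‖ ≤ K * ρ := by
    refine (ContinuousLinearMap.le_opNorm _ _).trans ?_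
    rw [mem_ball_zero_iff] at hx
    gcongr
    exact hbA _ (hball x (by simpa using hx) t ht)
  have hder (x : E) (hx : x ∈ ball (0 : E) ρ) (t : ℝ) (ht : t ∈ Icc (0 : ℝ) 1) :
      HasDerivAt (fun s : ℝ ↦ A (s • x)) (A' (t • x) x) t := by
    have h1 : HasDerivAt (fun s : ℝ ↦ s • x) x t := by
      simpa using (hasDerivAt_id t).smul_const x
    exact (hA _ (hball x hx t ht)).comp_hasDerivAt t h1
  have hsol (x : E) (hx : x ∈ ball (0 : E) ρ) := exists_solution_mul_right
    (a := fun t ↦ A (t • x) x)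
    (fun t ht ↦ ((hder x hx t ht).continuousAt.clm_apply continuousAt_const).continuousWithinAt)
    (hcoef x hx) hρ1
  choose! γ hγ0 hγ hγb using hsol
  have hG0 : γ 0 1 = 1 := by
    have h0 : (0 : E) ∈ ball (0 : E) ρ := by simpa using hρ
    have := constant_of_derivWithin_zero (f := γ 0) (a := 0) (b := 1)
      (fun t ht ↦ (hγ 0 h0 t ht).differentiableWithinAt) (fun t ht ↦ by
        have := (hγ 0 h0 t (Ico_subset_Icc_self ht)).derivWithin
          (uniqueDiffOn_Icc_zero_one t (Ico_subset_Icc_self ht))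
        simpa using this)
    rw [this 1 (by simp), hγ0 0 h0]
  refine ⟨ρ, hρ, fun x ↦ γ x 1, hG0, fun x hx ↦ ?_⟩
  set m := ‖(1 : 𝔸)‖ * Real.exp (K * ρ)
  set C₁ : ℝ := m * (K ^ 2 + K ^ 2 * ρ + (‖(1 : 𝔸)‖ + 2 * (K * ρ)) * (K * ρ + K))
  have hm : 0 ≤ m := by positivity
  have key : ∀ y ∈ ball (0 : E) ρ,
      ‖γ y 1 - γ x 1 - (γ x 1) * (A x (y - x))‖ ≤
        C₁ / (K * ρ) * (Real.exp (K * ρ) - 1) * ‖y - x‖ ^ 2 := by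
    intro y hy
    set h := y - x with hh
    have hyx : y = x + h := by rw [hh]; abel
    have hhρ : ‖h‖ ≤ 2 * ρ := by
      rw [mem_ball_zero_iff] at hx hy
      exact (norm_sub_le _ _).trans (by linarith)
    let S : ℝ → 𝔸 := fun t ↦ γ x t * (1 + t • A (t • x) h)
    let S' : ℝ → 𝔸 := fun t ↦ γ x t * A (t • x) x * (1 + t • A (t • x) h)
      + γ x t * (t • A' (t • x) x h + A (t • x) h)
    have hS (t : ℝ) (ht : t ∈ Icc (0 : ℝ) 1) : HasDerivWithinAt S (S' t) (Icc 0 1) t := by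
      have h1 : HasDerivAt (fun s : ℝ ↦ A (s • x) h) (A' (t • x) x h) t :=
        (ContinuousLinearMap.apply ℝ 𝔸 h).hasFDerivAt.comp_hasDerivAt t (hder x hx t ht)
      have h2 := (((hasDerivAt_id t).smul h1).const_add 1).hasDerivWithinAt (s := Icc 0 1)
      have h3 := (hγ x hx t ht).mul h2
      refine h3.congr_deriv ?_
      simp [S']
    have hbound (t : ℝ) (ht : t ∈ Icc (0 : ℝ) 1) :
        ‖S t * A (t • y) y - S' t‖ ≤ C₁ * ‖h‖ ^ 2 := by
      set a := A (t • x)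
      set a' := A' (t • x)
      set R : 𝔸 := (A (t • y) - a - a' (t • y - t • x)) y + t • a' h h with hR
      have hty : t • y - t • x = t • h := by rw [hh, smul_sub]
      have hB : A (t • y) y = a x + a h + t • a' h x + R := by
        rw [hR, hty]
        simp only [hyx, map_add, map_smul, sub_apply,
          smul_apply, smul_add]
        abel
      have hfl := hflat (t • x) (hball x hx t ht) h x
      have hid : S t * A (t • y) y - S' t =
          γ x t * (t • (a h * a h) + t • t • (a h * a' h x) + (1 + t • a h) * R) := by
        have e : S t * A (t • y) y - S' t =
            γ x t * (t • ((a' h x + a h * a x) - (a' x h + a x * a h))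
              + (t • (a h * a h) + t • t • (a h * a' h x) + (1 + t • a h) * R)) := by
          rw [hB]
          simp only [S, S', mul_add, add_mul, mul_one, one_mul, smul_mul_assoc, mul_smul_comm,
            smul_add, smul_sub, mul_sub, mul_assoc]
          abel
        rw [e, hfl, sub_self, smul_zero, zero_add]
      have ht0 := ht.1
      have ht1 := ht.2
      have hta : ‖t‖ ≤ 1 := by rw [Real.norm_of_nonneg ht0]; exact ht1
      have hah : ‖a h‖ ≤ K * ‖h‖ :=
        (ContinuousLinearMap.le_opNorm _ _).trans (by
          gcongr; exact hbA _ (hball x hx t ht))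
      have ha'h : ‖a' h‖ ≤ K * ‖h‖ :=
        (ContinuousLinearMap.le_opNorm _ _).trans (by
          gcongr; exact hbA' _ (hball x hx t ht))
      have hxρ : ‖x‖ ≤ ρ := (mem_ball_zero_iff.1 hx).le
      have hyρ : ‖y‖ ≤ ρ := (mem_ball_zero_iff.1 hy).le
      have ha'x : ‖a' h x‖ ≤ K * ‖h‖ * ρ :=
        (ContinuousLinearMap.le_opNorm _ _).trans (by gcongr)
      have ha'hh : ‖a' h h‖ ≤ K * ‖h‖ * ‖h‖ :=
        (ContinuousLinearMap.le_opNorm _ _).trans (by gcongr)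
      have hth : ‖t • h‖ ≤ ‖h‖ := by
        rw [norm_smul]; exact mul_le_of_le_one_left (norm_nonneg _) hta
      have hR0 : ‖A (t • y) - a - a' (t • y - t • x)‖ ≤ K * ‖h‖ ^ 2 := by
        refine (norm_sub_sub_le_of_lipschitz_fderiv (convex_ball 0 r) hK.le hA hL
          (hball x hx t ht) (hball y hy t ht)).trans ?_
        rw [hty]
        gcongr
      have hRb : ‖R‖ ≤ (K * ρ + K) * ‖h‖ ^ 2 := by
        calc ‖R‖ ≤ ‖A (t • y) - a - a' (t • y - t • x)‖ * ‖y‖ + ‖t‖ * ‖a' h h‖ := by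
              refine (norm_add_le _ _).trans (add_le_add (ContinuousLinearMap.le_opNorm _ _) ?_)
              rw [norm_smul]
          _ ≤ K * ‖h‖ ^ 2 * ρ + 1 * (K * ‖h‖ * ‖h‖) := by gcongr
          _ = _ := by ring
      have h1t : ‖1 + t • a h‖ ≤ ‖(1 : 𝔸)‖ + 2 * (K * ρ) := by
        refine (norm_add_le _ _).trans ?_
        rw [norm_smul]
        have : ‖t‖ * ‖a h‖ ≤ 1 * (K * (2 * ρ)) := by gcongr; exact hah.trans (by gcongr)
        linarith
      rw [hid]
      calc ‖γ x t * (t • (a h * a h) + t • t • (a h * a' h x) + (1 + t • a h) * R)‖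
          ≤ ‖γ x t‖ * (‖t‖ * (‖a h‖ * ‖a h‖) + ‖t‖ * (‖t‖ * (‖a h‖ * ‖a' h x‖))
              + ‖1 + t • a h‖ * ‖R‖) := by
            refine (norm_mul_le _ _).trans ?_
            gcongr
            refine (norm_add_le _ _).trans (add_le_add ((norm_add_le _ _).trans (add_le_add ?_ ?_))
              (norm_mul_le _ _))
            · rw [norm_smul]; gcongr; exact norm_mul_le _ _
            · rw [norm_smul, norm_smul]; gcongr; exact norm_mul_le _ _
        _ ≤ m * (1 * (K * ‖h‖ * (K * ‖h‖)) + 1 * (1 * (K * ‖h‖ * (K * ‖h‖ * ρ)))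
              + (‖(1 : 𝔸)‖ + 2 * (K * ρ)) * ((K * ρ + K) * ‖h‖ ^ 2)) := by
            gcongr
            exact hγb x hx t ht
        _ = C₁ * ‖h‖ ^ 2 := by simp only [C₁]; ring
    have hgr := norm_le_gronwallBound_of_norm_deriv_right_le (f := fun t ↦ γ y t - S t)
      (f' := fun t ↦ γ y t * A (t • y) y - S' t)
      (δ := 0) (K := K * ρ) (ε := C₁ * ‖h‖ ^ 2) (a := 0) (b := 1)
      (fun t ht ↦ ((hγ y hy t ht).sub (hS t ht)).continuousWithinAt)
      (fun t ht ↦ ((hγ y hy t (Ico_subset_Icc_self ht)).sub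
        (hS t (Ico_subset_Icc_self ht))).mono_of_mem_nhdsWithin (Icc_mem_nhdsGE_of_mem ht))
      (by simp [S, hγ0 x hx, hγ0 y hy])
      (fun t ht ↦ by
        have e : γ y t * A (t • y) y - S' t =
            (γ y t - S t) * A (t • y) y + (S t * A (t • y) y - S' t) := by
          rw [sub_mul]; abel
        rw [e]
        refine (norm_add_le _ _).trans
          (add_le_add ?_ (hbound t (Ico_subset_Icc_self ht)))
        rw [mul_comm (K * ρ)]
        exact (norm_mul_le _ _).trans
          (mul_le_mul_of_nonneg_left (hcoef y hy t (Ico_subset_Icc_self ht)) (norm_nonneg _)))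
      1 (by simp)
    rw [gronwallBound_of_K_ne_0 (by positivity)] at hgr
    refine le_trans (le_of_eq ?_) (hgr.trans (le_of_eq ?_))
    · congr 1
      simp only [S, one_smul, mul_add, mul_one]
      abel
    · simp; ring
  set C₂ := C₁ / (K * ρ) * (Real.exp (K * ρ) - 1)
  rw [hasFDerivAt_iff_isLittleO]
  refine Asymptotics.IsBigO.trans_isLittleO (g := fun y ↦ ‖y - x‖ ^ 2) ?_ ?_
  · refine Asymptotics.IsBigO.of_bound C₂ ?_
    filter_upwards [isOpen_ball.mem_nhds hx] with y hy
    simpa using key y hy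
  · have h1 : (fun y ↦ ‖y - x‖ ^ 2) =o[𝓝 x] fun y ↦ ‖y - x‖ := by
      have h2 : Filter.Tendsto (fun y ↦ ‖y - x‖) (𝓝 x) (𝓝 0) := by
        have : Continuous fun y ↦ ‖y - x‖ := by fun_prop
        simpa using this.tendsto x
      simpa [Function.comp_def] using
        (Asymptotics.isLittleO_pow_id (𝕜 := ℝ) one_lt_two).comp_tendsto h2
    exact h1.of_norm_right

/-- Linear Frobenius theorem: a smooth flat connection form has a smooth local parallel
section through the identity. -/
theorem exists_parallel_of_flat {A : E → E →L[ℝ] 𝔸} {U : Set E} (hU : IsOpen U) {z₀ : E}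
    (hz₀ : z₀ ∈ U) (hA : ContDiffOn ℝ ∞ A U)
    (hflat : ∀ x ∈ U, ∀ u v,
      fderiv ℝ A x u v + A x u * A x v = fderiv ℝ A x v u + A x v * A x u) :
    ∃ ρ > 0, ball z₀ ρ ⊆ U ∧ ∃ G : E → 𝔸, G z₀ = 1 ∧ ContDiffOn ℝ ∞ G (ball z₀ ρ) ∧
      ∀ x ∈ ball z₀ ρ, HasFDerivAt G ((ContinuousLinearMap.mul ℝ 𝔸 (G x)) ∘L A x) x := by
  have hA0 : ContDiffAt ℝ ∞ A z₀ := hA.contDiffAt (hU.mem_nhds hz₀)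
  have hA1 : ContDiffAt ℝ 1 (fderiv ℝ A) z₀ := hA0.fderiv_right (by norm_cast)
  obtain ⟨K₀, s, hs, hlip⟩ := hA1.exists_lipschitzOnWith
  have hb0 : ∀ᶠ x in 𝓝 z₀, ‖A x‖ < ‖A z₀‖ + 1 :=
    hA0.continuousAt.norm.eventually_lt continuousAt_const (by simp)
  have hb1 : ∀ᶠ x in 𝓝 z₀, ‖fderiv ℝ A x‖ < ‖fderiv ℝ A z₀‖ + 1 :=
    Filter.Tendsto.eventually_lt_const (lt_add_one _)
      ((continuous_norm (E := E →L[ℝ] E →L[ℝ] 𝔸)).continuousAt.tendsto.comp hA1.continuousAt)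
  obtain ⟨r, hr, hball⟩ := Metric.eventually_nhds_iff_ball.1
    ((hb0.and hb1).and ((Filter.eventually_mem_set.2 hs).and
      (Filter.eventually_mem_set.2 (hU.mem_nhds hz₀))))
  have hmem (x : E) (hx : x ∈ ball (0 : E) r) : x + z₀ ∈ ball z₀ r := by
    simpa [mem_ball, dist_eq_norm] using hx
  set K : ℝ := ‖A z₀‖ + 1 + (‖fderiv ℝ A z₀‖ + 1) + K₀
  have hK : 0 < K := by positivity
  obtain ⟨ρ, hρ, G, hG0, hG⟩ := exists_parallel_of_flat_of_lipschitz (𝔸 := 𝔸)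
    (A := fun x ↦ A (x + z₀)) (A' := fun x ↦ fderiv ℝ A (x + z₀)) hr hK
    (fun x hx ↦ by
      have h1 : HasFDerivAt A (fderiv ℝ A (x + z₀)) (x + z₀) :=
        ((hA.contDiffAt (hU.mem_nhds (hball _ (hmem x hx)).2.2)).differentiableAt
          (by simp)).hasFDerivAt
      simpa [Function.comp_def] using! h1.comp x ((hasFDerivAt_id x).add_const z₀))
    (fun x hx ↦ by
      have h1 := (hball _ (hmem x hx)).1.1
      have h2 : 0 ≤ ‖fderiv ℝ A z₀‖ := norm_nonneg (fderiv ℝ A z₀)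
      have h3 : (0 : ℝ) ≤ K₀ := K₀.2
      simp only [K]; linarith)
    (fun x hx ↦ by
      have h1 := (hball _ (hmem x hx)).1.2
      have h2 : 0 ≤ ‖A z₀‖ := norm_nonneg _
      have h3 : (0 : ℝ) ≤ K₀ := K₀.2
      simp only [K]; linarith)
    (fun x hx y hy ↦ by
      have h1 := hlip.dist_le_mul _ (hball _ (hmem x hx)).2.1 _ (hball _ (hmem y hy)).2.1
      rw [dist_eq_norm (fderiv ℝ A (x + z₀)) (fderiv ℝ A (y + z₀)), dist_eq_norm,
        add_sub_add_right_eq_sub] at h1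
      refine h1.trans ?_
      gcongr
      simp only [K]
      have h2 : 0 ≤ ‖A z₀‖ := norm_nonneg _
      have h3 : 0 ≤ ‖fderiv ℝ A z₀‖ := norm_nonneg (fderiv ℝ A z₀)
      linarith)
    (fun x hx ↦ hflat _ (hball _ (hmem x hx)).2.2)
  have hsub : ball z₀ (min r ρ) ⊆ U := fun x hx ↦
    (hball x (ball_subset_ball (min_le_left _ _) hx)).2.2
  have hG' : ∀ x ∈ ball z₀ (min r ρ), HasFDerivAt (fun x ↦ G (x - z₀))
      ((ContinuousLinearMap.mul ℝ 𝔸 (G (x - z₀))) ∘L A x) x := by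
    intro x hx
    have h1 := hG (x - z₀) (by
      have := ball_subset_ball (min_le_right r ρ) hx
      simpa [mem_ball, dist_eq_norm] using this)
    rw [sub_add_cancel] at h1
    simpa [Function.comp_def] using! h1.comp x ((hasFDerivAt_id x).sub_const z₀)
  exact ⟨min r ρ, lt_min hr hρ, hsub, fun x ↦ G (x - z₀), by simpa using hG0,
    contDiffOn_of_hasFDerivAt_mul isOpen_ball (hA.mono hsub) hG', hG'⟩

/-- A smooth closed one-form on a ball has a smooth primitive. -/
theorem exists_primitive_of_closed {F : Type*} [NormedAddCommGroup F] [NormedSpace ℝ F]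
    [CompleteSpace F] {η : E → E →L[ℝ] F} {z₀ : E} {ρ : ℝ} (hη : ContDiffOn ℝ ∞ η (ball z₀ ρ))
    (hcl : ∀ x ∈ ball z₀ ρ, ∀ u v, fderiv ℝ η x u v = fderiv ℝ η x v u) :
    ∃ f : E → F, ContDiffOn ℝ ∞ f (ball z₀ ρ) ∧ ∀ x ∈ ball z₀ ρ, HasFDerivAt f (η x) x := by
  obtain ⟨f, hf⟩ := (convex_ball z₀ ρ).exists_forall_hasFDerivAt_of_fderiv_symmetric isOpen_ball
    (hη.differentiableOn (by simp)) hcl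
  refine ⟨f, ?_, hf⟩
  rw [contDiffOn_infty_iff_fderiv_of_isOpen isOpen_ball]
  exact ⟨fun x hx ↦ (hf x hx).differentiableAt.differentiableWithinAt,
    hη.congr fun x hx ↦ (hf x hx).fderiv⟩

/-- Flat torsion-free Christoffel symbols `Γ` have affine coordinates `χ`, and an endomorphism
field `T` with symmetric covariant derivative has a potential `φ` with respect to them. -/
theorem exists_affine_coordinates [CompleteSpace E] {Γ : E → E →L[ℝ] E →L[ℝ] E}
    {T : E → E →L[ℝ] E} {U : Set E} (hU : IsOpen U) {z₀ : E} (hz₀ : z₀ ∈ U)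
    (hΓ : ContDiffOn ℝ ∞ Γ U) (hT : ContDiffOn ℝ ∞ T U)
    (hsymm : ∀ x ∈ U, ∀ u v, Γ x u v = Γ x v u)
    (hflat : ∀ x ∈ U, ∀ u v w,
      fderiv ℝ Γ x u v w + Γ x u (Γ x v w) = fderiv ℝ Γ x v u w + Γ x v (Γ x u w))
    (hTsymm : ∀ x ∈ U, ∀ u v,
      fderiv ℝ T x u v + Γ x u (T x v) = fderiv ℝ T x v u + Γ x v (T x u)) :
    ∃ ρ > 0, ball z₀ ρ ⊆ U ∧ ∃ (G : E → E →L[ℝ] E) (χ φ : E → E),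
      ContDiffOn ℝ ∞ G (ball z₀ ρ) ∧ ContDiffOn ℝ ∞ χ (ball z₀ ρ) ∧ ContDiffOn ℝ ∞ φ (ball z₀ ρ) ∧
      (∀ x ∈ ball z₀ ρ, IsUnit (G x)) ∧
      (∀ x ∈ ball z₀ ρ, ∀ u, fderiv ℝ G x u = G x ∘L Γ x u) ∧
      (∀ x ∈ ball z₀ ρ, HasFDerivAt χ (G x) x) ∧
      ∀ x ∈ ball z₀ ρ, HasFDerivAt φ (G x ∘L T x) x := by
  obtain ⟨ρ₁, hρ₁, hsub₁, G, hG0, hGs, hG⟩ := exists_parallel_of_flat (𝔸 := E →L[ℝ] E) hU hz₀ hΓ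
    (fun x hx u v ↦ by ext w; simpa using hflat x hx u v w)
  have hz : z₀ ∈ ball z₀ ρ₁ := mem_ball_self hρ₁
  have hunit : ∀ᶠ x in 𝓝 z₀, IsUnit (G x) := by
    have h1 : ContinuousAt G z₀ := hGs.continuousOn.continuousAt (isOpen_ball.mem_nhds hz)
    exact h1.eventually (Units.isOpen.mem_nhds (by rw [hG0]; exact isUnit_one))
  obtain ⟨ρ₂, hρ₂, hball⟩ := Metric.eventually_nhds_iff_ball.1 hunit
  have hs1 : ball z₀ (min ρ₁ ρ₂) ⊆ ball z₀ ρ₁ := ball_subset_ball (min_le_left _ _)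
  have hs2 : ball z₀ (min ρ₁ ρ₂) ⊆ ball z₀ ρ₂ := ball_subset_ball (min_le_right _ _)
  have hsU := hs1.trans hsub₁
  have hGd : ∀ x ∈ ball z₀ (min ρ₁ ρ₂), ∀ u, fderiv ℝ G x u = G x ∘L Γ x u := by
    intro x hx u
    rw [(hG x (hs1 hx)).fderiv]
    rfl
  obtain ⟨χ, hχs, hχ⟩ := exists_primitive_of_closed (hGs.mono hs1) (fun x hx u v ↦ by
    rw [hGd x hx, hGd x hx, ContinuousLinearMap.comp_apply, ContinuousLinearMap.comp_apply,
      hsymm x (hsU hx)])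
  have hGT : ContDiffOn ℝ ∞ (fun x ↦ G x ∘L T x) (ball z₀ (min ρ₁ ρ₂)) :=
    (hGs.mono hs1).clm_comp (hT.mono hsU)
  obtain ⟨φ, hφs, hφ⟩ := exists_primitive_of_closed hGT (fun x hx u v ↦ by
    have hx' := isOpen_ball.mem_nhds hx
    have h1 : HasFDerivAt G (fderiv ℝ G x) x :=
      (((hGs.mono hs1).contDiffAt hx').differentiableAt (by simp)).hasFDerivAt
    have h2 : HasFDerivAt T (fderiv ℝ T x) x :=
      (((hT.mono hsU).contDiffAt hx').differentiableAt (by simp)).hasFDerivAt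
    rw [(h1.clm_comp h2).fderiv]
    have h3 := congrArg (G x) (hTsymm x (hsU hx) u v)
    simp [hGd x hx] at h3 ⊢
    exact h3)
  exact ⟨min ρ₁ ρ₂, lt_min hρ₁ hρ₂, hsU, G, χ, φ, hGs.mono hs1, hχs, hφs,
    fun x hx ↦ hball x (hs2 hx), hGd, hχ, hφ⟩

end Frobenius

section Coordinates

open Set

variable {E : Type*} [NormedAddCommGroup E] [NormedSpace ℝ E]
  {H : Type*} [TopologicalSpace H] {I : ModelWithCorners ℝ E H} [I.Boundaryless]
  {X : Type*} [TopologicalSpace X] [ChartedSpace H X]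

/-- The differential of the coordinate map of a chart is invertible. -/
theorem isInvertible_mfderiv_extend {φ : OpenPartialHomeomorph X H}
    (hφ : φ ∈ IsManifold.maximalAtlas I ∞ X) {x : X} (hx : x ∈ φ.source) :
    (mvfderiv I (φ.extend I) x).IsInvertible := by
  have hT : I '' φ.target ∈ 𝓝 (φ.extend I x) := by
    have : IsOpen (I '' φ.target) := I.toHomeomorph.isOpenMap _ φ.open_target
    exact this.mem_nhds ⟨φ x, φ.map_source hx, rfl⟩
  have hinv : (φ.extend I).symm (φ.extend I x) = x := φ.extend_left_inv hx
  have h1 : MDifferentiableAt I 𝓘(ℝ, E) (φ.extend I) x :=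
    (φ.contMDiffAt_extend hφ hx).mdifferentiableAt (by simp)
  have h2 : MDifferentiableAt 𝓘(ℝ, E) I (φ.extend I).symm (φ.extend I x) :=
    ((contMDiffOn_extend_symm hφ).contMDiffAt hT).mdifferentiableAt (by simp)
  have e1 : (φ.extend I).symm ∘ (φ.extend I) =ᶠ[𝓝 x] id := by
    filter_upwards [φ.open_source.mem_nhds hx] with y hy
    exact φ.extend_left_inv hy
  have e2 : (φ.extend I) ∘ (φ.extend I).symm =ᶠ[𝓝 (φ.extend I x)] id := by
    filter_upwards [hT] with y hy
    obtain ⟨z, hz, rfl⟩ := hy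
    simp [hz]
  have h1' : MDifferentiableAt I 𝓘(ℝ, E) (φ.extend I) ((φ.extend I).symm (φ.extend I x)) := by
    rw [hinv]; exact h1
  have c1 := mfderiv_comp x h2 h1
  have c2 := mfderiv_comp (φ.extend I x) h1' h2
  rw [e1.mfderiv_eq, mfderiv_id] at c1
  rw [e2.mfderiv_eq, mfderiv_id] at c2
  refine ContinuousLinearMap.IsInvertible.of_inverse
    (g := (mfderiv 𝓘(ℝ, E) I (φ.extend I).symm (φ.extend I x) : E →L[ℝ] E))
    (f := (mfderiv I 𝓘(ℝ, E) (φ.extend I) x : E →L[ℝ] E)) ?_ ?_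
  · rw [hinv] at c2
    exact c2.symm
  · exact c1.symm

variable [CompleteSpace E] [IsManifold I ∞ X]

/-- The inverse function theorem as an open partial homeomorphism that is smooth in both
directions. -/
theorem exists_openPartialHomeomorph_contDiffOn {f : E → E} {W : Set E} (hW : IsOpen W) {z₀ : E}
    (hz₀ : z₀ ∈ W) (hf : ContDiffOn ℝ ∞ f W) (hinv : (fderiv ℝ f z₀).IsInvertible) :
    ∃ e : OpenPartialHomeomorph E E, z₀ ∈ e.source ∧ e.source ⊆ W ∧ (∀ z, e z = f z) ∧
      ContDiffOn ℝ ∞ e.symm e.target := by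
  have hf0 : ContDiffAt ℝ ∞ f z₀ := hf.contDiffAt (hW.mem_nhds hz₀)
  obtain ⟨f', hf'⟩ := hinv
  have hd : HasFDerivAt f (f' : E →L[ℝ] E) z₀ := by
    rw [hf']; exact (hf0.differentiableAt (by simp)).hasFDerivAt
  let e₀ := hf0.toOpenPartialHomeomorph f hd (by simp)
  have hcont : ContinuousOn (fderiv ℝ f) W := hf.continuousOn_fderiv_of_isOpen hW (by simp)
  let W' : Set E := W ∩ fderiv ℝ f ⁻¹' range ((↑) : (E ≃L[ℝ] E) → E →L[ℝ] E)
  have hW' : IsOpen W' := hcont.isOpen_inter_preimage hW ContinuousLinearEquiv.isOpen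
  let e := e₀.restrOpen W' hW'
  have hes : e.source = e₀.source ∩ W' := e₀.restrOpen_source W' hW'
  have hcoe : ∀ z, e z = f z := fun z ↦ rfl
  refine ⟨e, ?_, ?_, hcoe, fun y hy ↦ ?_⟩
  · rw [hes]
    exact ⟨hf0.mem_toOpenPartialHomeomorph_source hd (by simp), hz₀, f', hf'⟩
  · rw [hes]
    exact inter_subset_right.trans inter_subset_left
  · have hy' : e.symm y ∈ e.source := e.map_target hy
    rw [hes] at hy'
    obtain ⟨g, hg⟩ := hy'.2.2
    have h1 : ContDiffAt ℝ ∞ e (e.symm y) := hf.contDiffAt (hW.mem_nhds hy'.2.1)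
    have h2 : HasFDerivAt e (g : E →L[ℝ] E) (e.symm y) := by
      rw [hg]; exact (h1.differentiableAt (by simp)).hasFDerivAt
    exact (e.contDiffAt_symm hy h2 h1).contDiffWithinAt

/-- A smooth map to the model space with invertible differential at a point is the coordinate
map of a chart near that point. -/
theorem exists_chart_of_isInvertible_mfderiv {F : X → E} {U : Set X} (hU : IsOpen U) {x₀ : X}
    (hx₀ : x₀ ∈ U) (hF : ContMDiffOn I 𝓘(ℝ, E) ∞ F U) (hinv : (mvfderiv I F x₀).IsInvertible) :
    ∃ φ ∈ IsManifold.maximalAtlas I ∞ X, x₀ ∈ φ.source ∧ φ.source ⊆ U ∧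
      ∀ x ∈ φ.source, φ.extend I x = F x := by
  let c := chartAt H x₀
  let κ := extChartAt I x₀
  have hsymm : ContMDiffOn 𝓘(ℝ, E) I ∞ κ.symm κ.target := contMDiffOn_extChartAt_symm x₀
  have htar : IsOpen κ.target := isOpen_extChartAt_target x₀
  let W : Set E := κ.target ∩ κ.symm ⁻¹' U
  have hW : IsOpen W := hsymm.continuousOn.isOpen_inter_preimage htar hU
  have hfW : ContDiffOn ℝ ∞ (F ∘ κ.symm) W := by
    rw [← contMDiffOn_iff_contDiffOn]
    exact hF.comp (hsymm.mono inter_subset_left) fun z hz ↦ hz.2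
  have hz₀ : κ x₀ ∈ W := ⟨mem_extChartAt_target x₀, by simpa [κ] using hx₀⟩
  have hfd : (fderiv ℝ (F ∘ κ.symm) (κ x₀)).IsInvertible := by
    have h1 : MDifferentiableAt 𝓘(ℝ, E) I κ.symm (κ x₀) :=
      ((hsymm (κ x₀) hz₀.1).contMDiffAt (htar.mem_nhds hz₀.1)).mdifferentiableAt (by simp)
    have e0 : κ.symm (κ x₀) = x₀ := extChartAt_to_inv x₀
    have h2 : MDifferentiableAt I 𝓘(ℝ, E) F (κ.symm (κ x₀)) := by
      rw [e0]
      exact ((hF x₀ hx₀).contMDiffAt (hU.mem_nhds hx₀)).mdifferentiableAt (by simp)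
    have h3 := mfderiv_comp (κ x₀) h2 h1
    rw [mfderiv_eq_fderiv] at h3
    rw [h3]
    refine ContinuousLinearMap.IsInvertible.comp ?_ ?_
    · rw [e0]; exact hinv
    · have := isInvertible_mfderivWithin_extChartAt_symm (I := I) (x := x₀) hz₀.1
      rwa [I.range_eq_univ, mfderivWithin_univ] at this
  obtain ⟨e, he₀, heW, hecoe, hes⟩ := exists_openPartialHomeomorph_contDiffOn hW hz₀ hfW hfd
  let iH : OpenPartialHomeomorph H E := I.toHomeomorph.toOpenPartialHomeomorph
  let φ : OpenPartialHomeomorph X H := (c.trans iH).trans (e.trans iH.symm)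
  have hφsrc : ∀ x ∈ φ.source, x ∈ c.source ∧ κ x ∈ e.source := by
    intro x hx
    simp [φ, iH] at hx
    exact ⟨hx.1, hx.2⟩
  have hφU : ∀ x ∈ φ.source, x ∈ U := by
    intro x hx
    obtain ⟨h1, h2⟩ := hφsrc x hx
    have h3 := (heW h2).2
    rwa [mem_preimage, κ.left_inv (by simpa [κ] using h1)] at h3
  have hφF : ∀ x ∈ φ.source, φ.extend I x = F x := by
    intro x hx
    obtain ⟨h1, h2⟩ := hφsrc x hx
    have h4 : φ.extend I x = I (I.symm (e (κ x))) := rfl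
    rw [h4, I.right_inv (by simp [I.range_eq_univ]), hecoe, Function.comp_apply,
      κ.left_inv (by simpa [κ] using h1)]
  refine ⟨φ, OpenPartialHomeomorph.mem_maximalAtlas_of_contMDiffOn φ ?_ ?_, ?_, hφU, hφF⟩
  · have h1 : ContMDiffOn I I ∞ (I.symm ∘ F) φ.source := by
      refine ContMDiffOn.comp (t := range I) I.contMDiffOn_symm (hF.mono hφU) ?_
      simp [I.range_eq_univ]
    refine h1.congr fun x hx ↦ ?_
    rw [Function.comp_apply, ← hφF x hx]
    exact (I.left_inv _).symm
  · have h1 : ContMDiffOn I I ∞ (κ.symm ∘ e.symm ∘ I) φ.target := by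
      have h2 : ∀ y ∈ φ.target, I y ∈ e.target ∧ e.symm (I y) ∈ e.source := by
        intro y hy
        simp [φ, iH] at hy
        exact ⟨hy.1, e.map_target hy.1⟩
      refine hsymm.comp (t := κ.target) (ContMDiffOn.comp (t := e.target)
        (contMDiffOn_iff_contDiffOn.2 hes) I.contMDiff.contMDiffOn fun y hy ↦ (h2 y hy).1) ?_
      exact fun y hy ↦ (heW (h2 y hy).2).1
    exact h1
  · simp only [φ, iH, mfld_simps]
    exact ⟨mem_chart_source H x₀, he₀⟩

end Coordinates

section Smoothness

open Set ContinuousLinearMap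

variable {E : Type*} [NormedAddCommGroup E] [NormedSpace ℝ E]
  {H : Type*} [TopologicalSpace H] {I : ModelWithCorners ℝ E H}
  {X : Type*} [TopologicalSpace X] [ChartedSpace H X]
  {V : Type*} [NormedAddCommGroup V] [NormedSpace ℝ V]

/-- Pointwise inverses of a smooth family of linear maps are smooth. -/
theorem ContMDiffAt.clm_inverse [CompleteSpace E] {S : X → E →L[ℝ] V} {x₀ : X}
    (hS : ContMDiffAt I 𝓘(ℝ, E →L[ℝ] V) ∞ S x₀) (h : (S x₀).IsInvertible) :
    ContMDiffAt I 𝓘(ℝ, V →L[ℝ] E) ∞ (fun x ↦ (S x).inverse) x₀ := by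
  obtain ⟨e, he⟩ := h
  have h1 : ContDiffAt ℝ ∞ (inverse : (E →L[ℝ] V) → V →L[ℝ] E) (S x₀) := by
    rw [← he]; exact contDiffAt_map_inverse e
  exact h1.contMDiffAt.comp x₀ hS

variable [IsManifold I ∞ X]

/-- The differential of `F`, read in the trivialization of the tangent bundle at `x₀`. -/
def derivInTriv (I : ModelWithCorners ℝ E H) [IsManifold I ∞ X] (F : X → V) (x₀ x : X) :
    E →L[ℝ] V :=
  mvfderiv I F x ∘L (trivializationAt E (TangentSpace I : X → Type _) x₀).symmL ℝ x

theorem contMDiffAt_derivInTriv {F : X → V} {x₀ : X} (hF : ContMDiffAt I 𝓘(ℝ, V) ∞ F x₀) :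
    ContMDiffAt I 𝓘(ℝ, E →L[ℝ] V) ∞ (derivInTriv I F x₀) x₀ := by
  have h := hF.mfderiv_const (m := ∞) (by simp)
  have e : derivInTriv I F x₀ = inTangentCoordinates I 𝓘(ℝ, V) id F (mfderiv I 𝓘(ℝ, V) F) x₀ := by
    funext x
    have h7 := TangentBundle.continuousLinearMapAt_model_space (𝕜 := ℝ) (F x₀) (F x)
    simp only [inTangentCoordinates, inCoordinates, h7]
    rfl
  rw [e]
  exact h

theorem eventually_mem_baseSet (x₀ : X) : ∀ᶠ x in 𝓝 x₀,
    x ∈ (trivializationAt E (TangentSpace I : X → Type _) x₀).baseSet :=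
  (trivializationAt E (TangentSpace I : X → Type _) x₀).open_baseSet.mem_nhds
    (FiberBundle.mem_baseSet_trivializationAt' _)

theorem isInvertible_derivInTriv {F : X → V} {x₀ x : X} (h : (mvfderiv I F x).IsInvertible)
    (hx : x ∈ (trivializationAt E (TangentSpace I : X → Type _) x₀).baseSet) :
    (derivInTriv I F x₀ x).IsInvertible := by
  let t := trivializationAt E (TangentSpace I : X → Type _) x₀
  have h2 : (t.symmL ℝ x).IsInvertible := ⟨(t.continuousLinearEquivAt ℝ x hx).symm, by
    ext u; simp [t, Trivialization.symmL_apply _ hx]⟩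
  exact h.comp h2

/-- The derivative of a smooth function along a smooth vector field is smooth. -/
theorem contMDiffAt_mvfderiv_apply {F : X → V} {Y : Π x : X, TangentSpace I x} {x₀ : X}
    (hF : ContMDiffAt I 𝓘(ℝ, V) ∞ F x₀)
    (hY : ContMDiffAt I I.tangent ∞ (fun x ↦ (⟨x, Y x⟩ : TangentBundle I X)) x₀) :
    ContMDiffAt I 𝓘(ℝ, V) ∞ (fun x ↦ mvfderiv I F x (Y x)) x₀ := by
  have h1 := (contMDiffAt_section x₀).1 hY
  refine ((contMDiffAt_derivInTriv hF).clm_apply h1).congr_of_eventuallyEq ?_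
  filter_upwards [eventually_mem_baseSet (I := I) x₀] with x hx
  have h3 : ((trivializationAt E (TangentSpace I : X → Type _) x₀).symmL ℝ x)
      ((trivializationAt E (TangentSpace I : X → Type _) x₀) ⟨x, Y x⟩).2 = Y x := by
    rw [Trivialization.symmL_apply _ hx]
    exact Trivialization.symm_apply_apply_mk _ hx _
  rw [derivInTriv, comp_apply, h3]

/-- A vector field is smooth if it is smooth in smooth coordinates. -/
theorem contMDiffAt_of_mvfderiv_apply [CompleteSpace E] {F : X → V}
    {Y : Π x : X, TangentSpace I x} {x₀ : X}
    (hF : ContMDiffAt I 𝓘(ℝ, V) ∞ F x₀) (hinv : ∀ᶠ x in 𝓝 x₀, (mvfderiv I F x).IsInvertible)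
    (hY : ContMDiffAt I 𝓘(ℝ, V) ∞ (fun x ↦ mvfderiv I F x (Y x)) x₀) :
    ContMDiffAt I I.tangent ∞ (fun x ↦ (⟨x, Y x⟩ : TangentBundle I X)) x₀ := by
  refine (contMDiffAt_section x₀).2 ?_
  have hS := contMDiffAt_derivInTriv hF
  have h1 := (hS.clm_inverse (isInvertible_derivInTriv hinv.self_of_nhds
    (eventually_mem_baseSet (I := I) x₀).self_of_nhds)).clm_apply hY
  refine h1.congr_of_eventuallyEq ?_
  filter_upwards [eventually_mem_baseSet (I := I) x₀, hinv] with x hx hx'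
  obtain ⟨e, he⟩ := isInvertible_derivInTriv hx' hx
  have h3 : ((trivializationAt E (TangentSpace I : X → Type _) x₀).symmL ℝ x)
      ((trivializationAt E (TangentSpace I : X → Type _) x₀) ⟨x, Y x⟩).2 = Y x := by
    rw [Trivialization.symmL_apply _ hx]
    exact Trivialization.symm_apply_apply_mk _ hx _
  have h4 : mvfderiv I F x (Y x) = derivInTriv I F x₀ x
      ((trivializationAt E (TangentSpace I : X → Type _) x₀) ⟨x, Y x⟩).2 := by
    rw [derivInTriv, comp_apply, h3]
  rw [h4, ← he]
  simp

/-- An endomorphism field is smooth if it is constant in smooth coordinates. -/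
theorem contMDiffAt_endField_of_mvfderiv [CompleteSpace E] {F : X → V} {A : EndField I X} {x₀ : X}
    (hF : ContMDiffAt I 𝓘(ℝ, V) ∞ F x₀) (hinv : ∀ᶠ x in 𝓝 x₀, (mvfderiv I F x).IsInvertible)
    (c : V →L[ℝ] V)
    (hA : ∀ᶠ x in 𝓝 x₀, ∀ v : TangentSpace I x, mvfderiv I F x (A x v) = c (mvfderiv I F x v)) :
    ContMDiffAt I (I.prod 𝓘(ℝ, E →L[ℝ] E)) ∞
    (fun x ↦ TotalSpace.mk' (E →L[ℝ] E)
      (E := fun x : X ↦ TangentSpace I x →L[ℝ] TangentSpace I x) x (A x)) x₀ := by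
  rw [contMDiffAt_hom_bundle]
  refine ⟨contMDiffAt_id, ?_⟩
  have hS := contMDiffAt_derivInTriv hF
  have h1 := (hS.clm_inverse (isInvertible_derivInTriv hinv.self_of_nhds
    (eventually_mem_baseSet (I := I) x₀).self_of_nhds)).clm_comp
    ((contMDiffAt_const (c := c)).clm_comp hS)
  refine h1.congr_of_eventuallyEq ?_
  filter_upwards [eventually_mem_baseSet (I := I) x₀, hinv, hA] with x hx hx' hAx
  obtain ⟨e, he⟩ := isInvertible_derivInTriv hx' hx
  have h4 : derivInTriv I F x₀ x ∘L inCoordinates E (TangentSpace I : X → Type _) E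
      (TangentSpace I : X → Type _) x₀ x x₀ x (A x) = c ∘L derivInTriv I F x₀ x := by
    ext u
    simp only [derivInTriv, inCoordinates, comp_apply]
    rw [← hAx, Trivialization.symmL_continuousLinearMapAt _ hx]
  rw [← h4, ← he]
  ext u
  simp

set_option synthInstance.maxHeartbeats 200000 in
theorem contDiff_flip {E F : Type*} [NormedAddCommGroup E] [NormedSpace ℝ E]
    [NormedAddCommGroup F] [NormedSpace ℝ F] :
    ContDiff ℝ ∞ (fun f : E →L[ℝ] F →L[ℝ] ℝ ↦ f.flip) := by
  have h : IsBoundedLinearMap ℝ (fun f : E →L[ℝ] F →L[ℝ] ℝ ↦ f.flip) :=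
    ⟨⟨fun _ _ ↦ rfl, fun _ _ ↦ rfl⟩, 1, one_pos, fun f ↦ by rw [opNorm_flip, one_mul]⟩
  exact h.contDiff

/-- A field of bilinear forms is smooth if it is constant in smooth coordinates. -/
theorem contMDiffAt_bilinField_of_mvfderiv {F : X → V} {b : BilinField I X} {x₀ : X}
    (hF : ContMDiffAt I 𝓘(ℝ, V) ∞ F x₀) (c : V →L[ℝ] V →L[ℝ] ℝ)
    (hb : ∀ᶠ x in 𝓝 x₀, ∀ v w : TangentSpace I x,
      b x v w = c (mvfderiv I F x v) (mvfderiv I F x w)) :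
    ContMDiffAt I (I.prod 𝓘(ℝ, E →L[ℝ] E →L[ℝ] ℝ)) ∞
    (fun x ↦ TotalSpace.mk' (E →L[ℝ] E →L[ℝ] ℝ)
      (E := fun x : X ↦ TangentSpace I x →L[ℝ] TangentSpace I x →L[ℝ] ℝ) x (b x)) x₀ := by
  refine (contMDiffAt_hom_bundle (E₂ := fun x : X ↦ TangentSpace I x →L[ℝ] Bundle.Trivial X ℝ x)
    (F₂ := E →L[ℝ] ℝ) _).2 ⟨contMDiffAt_id, ?_⟩
  have hS := contMDiffAt_derivInTriv hF
  have hcS : ContMDiffAt I 𝓘(ℝ, E →L[ℝ] V →L[ℝ] ℝ) ∞ (fun x ↦ c ∘L derivInTriv I F x₀ x) x₀ :=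
    (contMDiffAt_const (c := c)).clm_comp hS
  have hflip : ContMDiffAt I 𝓘(ℝ, V →L[ℝ] E →L[ℝ] ℝ) ∞
      (fun x ↦ (c ∘L derivInTriv I F x₀ x).flip) x₀ :=
    have hfl : ContDiff ℝ ∞ (fun f : E →L[ℝ] V →L[ℝ] ℝ ↦ f.flip) := contDiff_flip
    hfl.contMDiff.contMDiffAt.comp x₀ hcS
  have h1 : ContMDiffAt I 𝓘(ℝ, E →L[ℝ] E →L[ℝ] ℝ) ∞
      (fun x ↦ ((c ∘L derivInTriv I F x₀ x).flip ∘L derivInTriv I F x₀ x).flip) x₀ :=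
    have hfl : ContDiff ℝ ∞ (fun f : E →L[ℝ] E →L[ℝ] ℝ ↦ f.flip) := contDiff_flip
    hfl.contMDiff.contMDiffAt.comp x₀ (hflip.clm_comp hS)
  refine h1.congr_of_eventuallyEq ?_
  filter_upwards [eventually_mem_baseSet (I := I) x₀, hb] with x hx hbx
  ext u v
  have := inCoordinates_apply_eq₂ (𝕜 := ℝ) (F₁ := E) (F₂ := E) (F₃ := ℝ)
    (E₁ := (TangentSpace I : X → Type _)) (E₂ := (TangentSpace I : X → Type _))
    (E₃ := Bundle.Trivial X ℝ) (x₀ := x₀) (x := x) (ϕ := b x) (v := u) (w := v) hx hx (by simp)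
  refine this.trans ?_
  simp [derivInTriv, hbx, Trivialization.symmL_apply _ hx]

/-- Composing a smooth field of bilinear forms with a smooth endomorphism field. -/
theorem IsSmoothBilinField.comp_endField {b : BilinField I X} {A : EndField I X}
    (hb : IsSmoothBilinField I b) (hA : IsSmoothEndField I A) :
    IsSmoothBilinField I (fun x ↦ b x ∘L A x) := by
  intro x₀
  have hA' := ((contMDiffAt_hom_bundle _).1 (hA x₀)).2
  have hb' := ((contMDiffAt_hom_bundle
    (E₂ := fun x : X ↦ TangentSpace I x →L[ℝ] Bundle.Trivial X ℝ x)
    (F₂ := E →L[ℝ] ℝ) _).1 (hb x₀)).2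
  refine (contMDiffAt_hom_bundle (E₂ := fun x : X ↦ TangentSpace I x →L[ℝ] Bundle.Trivial X ℝ x)
    (F₂ := E →L[ℝ] ℝ) _).2 ⟨contMDiffAt_id, ?_⟩
  refine (hb'.clm_comp hA').congr_of_eventuallyEq ?_
  filter_upwards [eventually_mem_baseSet (I := I) x₀] with x hx
  ext u
  simp only [inCoordinates, comp_apply]
  rw [Trivialization.symmL_continuousLinearMapAt _ hx]

/-- The bracket formula `dF [U, W] = U (dF W) - W (dF U)`. -/
theorem mvfderiv_mlieBracket [CompleteSpace E] [I.Boundaryless] {F : X → V} {x : X}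
    {Y Z : Π x : X, TangentSpace I x} (hF : ContMDiffAt I 𝓘(ℝ, V) ∞ F x)
    (hY : ContMDiffAt I I.tangent ∞ (fun x ↦ (⟨x, Y x⟩ : TangentBundle I X)) x)
    (hZ : ContMDiffAt I I.tangent ∞ (fun x ↦ (⟨x, Z x⟩ : TangentBundle I X)) x) :
    mvfderiv I F x (VectorField.mlieBracket I Y Z x) =
      mvfderiv I (fun y ↦ mvfderiv I F y (Z y)) x (Y x)
        - mvfderiv I (fun y ↦ mvfderiv I F y (Y y)) x (Z x) := by
  let κ := extChartAt I x
  have hx : x ∈ κ.source := mem_extChartAt_source x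
  have hκx : κ x ∈ κ.target := mem_extChartAt_target x
  have htar : IsOpen κ.target := isOpen_extChartAt_target x
  have hsymm : ContMDiffOn 𝓘(ℝ, E) I ∞ κ.symm κ.target := contMDiffOn_extChartAt_symm x
  have e0 : κ.symm (κ x) = x := extChartAt_to_inv x
  have h2 : (2 : WithTop ℕ∞) ≤ ∞ := WithTop.coe_le_coe.2 le_top
  have hd : MDifferentiableAt 𝓘(ℝ, E) I κ.symm (κ x) :=
    ((hsymm _ hκx).contMDiffAt (htar.mem_nhds hκx)).mdifferentiableAt (by simp)
  have hdκ : MDifferentiableAt I 𝓘(ℝ, E) κ x := mdifferentiableAt_extChartAt (mem_chart_source H x)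
  let F' : E → V := F ∘ κ.symm
  let pull (Y : Π x : X, TangentSpace I x) : E → E :=
    VectorField.mpullback 𝓘(ℝ, E) I κ.symm Y
  have hF' : ContDiffAt ℝ 2 F' (κ x) := by
    rw [← contMDiffAt_iff_contDiffAt]
    have : ContMDiffAt I 𝓘(ℝ, V) 2 F (κ.symm (κ x)) := by
      rw [e0]; exact hF.of_le h2
    exact this.comp (κ x) (((hsymm _ hκx).contMDiffAt (htar.mem_nhds hκx)).of_le
      h2)
  have hwithin (Y : Π x : X, TangentSpace I x) :
      VectorField.mpullbackWithin 𝓘(ℝ, E) I κ.symm Y (range I) = pull Y := by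
    rw [I.range_eq_univ]
    exact VectorField.mpullbackWithin_univ
  have hpull (Y : Π x : X, TangentSpace I x)
      (hY : ContMDiffAt I I.tangent ∞ (fun x ↦ (⟨x, Y x⟩ : TangentBundle I X)) x) :
      DifferentiableAt ℝ (pull Y) (κ x) := by
    have := (hY.mdifferentiableAt (by simp)).mdifferentiableWithinAt
      (s := univ) |>.differentiableWithinAt_mpullbackWithin_vectorField
    have hcongr : ∀ s : Set E, s = univ → ∀ f : E → E, f = pull Y →
        DifferentiableWithinAt ℝ f s (κ x) → DifferentiableAt ℝ (pull Y) (κ x) := by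
      rintro _ rfl _ rfl h
      exact differentiableWithinAt_univ.1 h
    exact hcongr _ (by simp [I.range_eq_univ]) _ (hwithin Y) this
  have hinv (z : E) (hz : z ∈ κ.target) : (mfderiv 𝓘(ℝ, E) I κ.symm z).IsInvertible := by
    have := isInvertible_mfderivWithin_extChartAt_symm (I := I) (x := x) hz
    rwa [I.range_eq_univ, mfderivWithin_univ] at this
  have hP (Y : Π x : X, TangentSpace I x) (z : E) (hz : z ∈ κ.target)
      (hFz : MDifferentiableAt I 𝓘(ℝ, V) F (κ.symm z)) :
      fderiv ℝ F' z (pull Y z) = mvfderiv I F (κ.symm z) (Y (κ.symm z)) := by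
    have h1 := mfderiv_comp z hFz
      (((hsymm _ hz).contMDiffAt (htar.mem_nhds hz)).mdifferentiableAt (by simp))
    rw [mfderiv_eq_fderiv] at h1
    have h3 : fderiv ℝ F' z (pull Y z) = mfderiv I 𝓘(ℝ, V) F (κ.symm z)
        (mfderiv 𝓘(ℝ, E) I κ.symm z (pull Y z)) := congr($h1 (pull Y z))
    rw [h3]
    exact congrArg _ ((hinv z hz).self_apply_inverse _)
  have hval (Y : Π x : X, TangentSpace I x) :
      mfderiv I 𝓘(ℝ, E) κ x (Y x) = pull Y (κ x) := by
    have h1 := mfderiv_extChartAt_comp_mfderivWithin_extChartAt_symm (I := I) (x := x) hκx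
    rw [I.range_eq_univ, mfderivWithin_univ] at h1
    have h3 : pull Y (κ x) = (fun y ↦ (mfderiv I 𝓘(ℝ, E) κ y (Y y) : E)) (κ.symm (κ x)) := by
      have h4 := congr($h1 (pull Y (κ x)))
      refine h4.symm.trans ?_
      exact congrArg (mfderiv I 𝓘(ℝ, E) κ (κ.symm (κ x)))
        ((hinv (κ x) hκx).self_apply_inverse (Y (κ.symm (κ x))))
    rw [h3, e0]
  have hPx (Y : Π x : X, TangentSpace I x) :
      fderiv ℝ F' (κ x) (pull Y (κ x)) = mvfderiv I F x (Y x) := by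
    have h1 := hP Y (κ x) hκx (by rw [e0]; exact hF.mdifferentiableAt (by simp))
    rw [h1]
    exact congrArg (fun y ↦ mvfderiv I F y (Y y)) e0
  have hbr : mvfderiv I F x (VectorField.mlieBracket I Y Z x) =
      fderiv ℝ F' (κ x) (VectorField.lieBracket ℝ (pull Y) (pull Z) (κ x)) := by
    set b : E := VectorField.lieBracket ℝ (pull Y) (pull Z) (κ x)
    have hcongr : ∀ s : Set E, s = univ → ∀ f g : E → E, f = pull Y → g = pull Z →
        VectorField.lieBracketWithin ℝ f g s (κ x) = b := by
      rintro _ rfl _ _ rfl rfl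
      rw [VectorField.lieBracketWithin_univ]
    have h1 : VectorField.mlieBracket I Y Z x = (mfderiv I 𝓘(ℝ, E) κ x).inverse b := by
      rw [← VectorField.mlieBracketWithin_univ, VectorField.mlieBracketWithin_apply]
      exact congrArg _ (hcongr _ (by simp [I.range_eq_univ]) _ _ (hwithin Y) (hwithin Z))
    rw [h1]
    have h3 := hPx (fun _ ↦ ((mfderiv I 𝓘(ℝ, E) κ x).inverse b : E))
    have h4 := hval (fun _ ↦ ((mfderiv I 𝓘(ℝ, E) κ x).inverse b : E))
    refine h3.symm.trans (congrArg (fderiv ℝ F' (κ x)) (h4.symm.trans ?_))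
    exact (isInvertible_mfderiv_extChartAt hx).self_apply_inverse _
  have hfun (Y : Π x : X, TangentSpace I x) : (fun y ↦ mvfderiv I F y (Y y)) =ᶠ[𝓝 x]
      (fun z ↦ fderiv ℝ F' z (pull Y z)) ∘ κ := by
    have h1 : ∀ᶠ y in 𝓝 x, ContMDiffAt I 𝓘(ℝ, V) 2 F y :=
      (contMDiffAt_iff_contMDiffAt_nhds (by simp)).1 (hF.of_le h2)
    filter_upwards [h1, extChartAt_source_mem_nhds (I := I) x] with y hy hys
    have h3 : κ.symm (κ y) = y := κ.left_inv hys
    have h4 := hP Y (κ y) (κ.map_source hys) (by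
      rw [h3]; exact hy.mdifferentiableAt (by simp))
    refine Eq.symm (h4.trans ?_)
    exact congrArg (fun y ↦ mvfderiv I F y (Y y)) h3
  have hder (Y Z : Π x : X, TangentSpace I x)
      (hZ : ContMDiffAt I I.tangent ∞ (fun x ↦ (⟨x, Z x⟩ : TangentBundle I X)) x) :
      mvfderiv I (fun y ↦ mvfderiv I F y (Z y)) x (Y x) =
        fderiv ℝ (fderiv ℝ F') (κ x) (pull Y (κ x)) (pull Z (κ x)) +
          fderiv ℝ F' (κ x) (fderiv ℝ (pull Z) (κ x) (pull Y (κ x))) := by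
    have h1 : HasFDerivAt (fderiv ℝ F') (fderiv ℝ (fderiv ℝ F') (κ x)) (κ x) :=
      ((hF'.fderiv_right (m := 1) (by norm_num)).differentiableAt (by simp)).hasFDerivAt
    have h3 := h1.clm_apply (hpull Z hZ).hasFDerivAt
    have h4 := mfderiv_comp (I := I) (I' := 𝓘(ℝ, E)) (I'' := 𝓘(ℝ, V)) x
      h3.differentiableAt.mdifferentiableAt hdκ
    rw [mfderiv_eq_fderiv, h3.fderiv] at h4
    have h5 : mvfderiv I (fun y ↦ mvfderiv I F y (Z y)) x (Y x) =
        mfderiv I 𝓘(ℝ, V) ((fun z ↦ fderiv ℝ F' z (pull Z z)) ∘ κ) x (Y x) := by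
      have := (hfun Z).mfderiv_eq (I := I) (I' := 𝓘(ℝ, V))
      exact congr($this (Y x))
    rw [h5]
    refine (congr($h4 (Y x))).trans ?_
    let D : E →L[ℝ] V := fderiv ℝ F' (κ x) ∘L fderiv ℝ (pull Z) (κ x)
      + (fderiv ℝ (fderiv ℝ F') (κ x)).flip (pull Z (κ x))
    refine (congrArg D (hval Y)).trans ?_
    simp [D, add_comm]
  rw [hbr, hder Y Z hZ, hder Z Y hY, VectorField.lieBracket_eq]
  have hs := hF'.isSymmSndFDerivAt (by simp)
  rw [hs.eq (pull Y (κ x))]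
  simp

end Smoothness

section ConstantCoordinates

open Set ContinuousLinearMap

variable {E : Type*} [NormedAddCommGroup E] [NormedSpace ℝ E]
  {H : Type*} [TopologicalSpace H] {I : ModelWithCorners ℝ E H}
  {X : Type*} [TopologicalSpace X] [ChartedSpace H X]
  {V : Type*} [NormedAddCommGroup V] [NormedSpace ℝ V]
  {W : Type*} [NormedAddCommGroup W] [NormedSpace ℝ W]
  {Z : Type*} [NormedAddCommGroup Z] [NormedSpace ℝ Z]

theorem mvfderiv_clm_comp {f : X → V} {x : X} (hf : MDifferentiableAt I 𝓘(ℝ, V) f x)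
    (L : V →L[ℝ] W) (u : TangentSpace I x) :
    mvfderiv I (fun y ↦ L (f y)) x u = L (mvfderiv I f x u) := by
  have h := (L.hasFDerivAt (x := f x)).hasMFDerivAt.comp x hf.hasMFDerivAt
  exact congr($h.mfderiv u)

theorem hasMFDerivAt_prodMk_space {f : X → V} {h : X → W} {x : X}
    (hf : MDifferentiableAt I 𝓘(ℝ, V) f x) (hh : MDifferentiableAt I 𝓘(ℝ, W) h x) :
    HasMFDerivAt I 𝓘(ℝ, V × W) (fun y ↦ (f y, h y)) x
      ((mvfderiv I f x).prod (mvfderiv I h x)) :=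
  ⟨hf.hasMFDerivAt.1.prodMk hh.hasMFDerivAt.1, hf.hasMFDerivAt.2.prodMk hh.hasMFDerivAt.2⟩

theorem mvfderiv_prodMk {f : X → V} {h : X → W} {x : X} (hf : MDifferentiableAt I 𝓘(ℝ, V) f x)
    (hh : MDifferentiableAt I 𝓘(ℝ, W) h x) (u : TangentSpace I x) :
    mvfderiv I (fun y ↦ (f y, h y)) x u = (mvfderiv I f x u, mvfderiv I h x u) :=
  congr($((hasMFDerivAt_prodMk_space hf hh).mfderiv) u)

theorem mvfderiv_bilin {f : X → V} {h : X → W} {x : X} (hf : MDifferentiableAt I 𝓘(ℝ, V) f x)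
    (hh : MDifferentiableAt I 𝓘(ℝ, W) h x) (c : V →L[ℝ] W →L[ℝ] Z) (u : TangentSpace I x) :
    mvfderiv I (fun y ↦ c (f y) (h y)) x u =
      c (mvfderiv I f x u) (h x) + c (f x) (mvfderiv I h x u) := by
  have h1 := HasMFDerivAt.comp (f := fun y ↦ (f y, h y)) x
    (c.isBoundedBilinearMap.hasFDerivAt (f x, h x)).hasMFDerivAt
    (hasMFDerivAt_prodMk_space hf hh)
  refine (congr($h1.mfderiv u)).trans ?_
  exact add_comm _ _

theorem mvfderiv_eq_zero_of_eventuallyEq_const {f : X → V} {x : X} {e : V}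
    (hf : ∀ᶠ y in 𝓝 x, f y = e) (u : TangentSpace I x) :
    mvfderiv I f x u = 0 := by
  have h1 : f =ᶠ[𝓝 x] fun _ ↦ e := hf
  have h2 : mvfderiv I f x u = mvfderiv I (fun _ ↦ e) x u := congr($(h1.mfderiv_eq) u)
  rw [h2, mvfderiv_const]
  rfl

variable (I) in
/-- `F` is a system of smooth coordinates on the open set `U`. -/
structure IsCoordinateOn (F : X → E) (U : Set X) : Prop where
  isOpen : IsOpen U
  contMDiffOn : ContMDiffOn I 𝓘(ℝ, E) ∞ F U
  isInvertible : ∀ x ∈ U, (mvfderiv I F x).IsInvertible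

/-- An endomorphism field that is given by a constant endomorphism `c` of the model space in smooth
coordinates `F` on `U`. -/
structure IsConstantIn (A : EndField I X) (U : Set X) (F : X → E) (c : E →L[ℝ] E) : Prop
    extends IsCoordinateOn I F U where
  mvfderiv_apply : ∀ x ∈ U, ∀ v : TangentSpace I x,
    mvfderiv I F x (A x v) = c (mvfderiv I F x v)

namespace IsConstantIn

variable {A : EndField I X} {U : Set X} {F : X → E} {c : E →L[ℝ] E}

theorem eventually_isInvertible (h : IsConstantIn A U F c) {x₀ : X} (hx₀ : x₀ ∈ U) :
    ∀ᶠ x in 𝓝 x₀, (mvfderiv I F x).IsInvertible := by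
  filter_upwards [h.isOpen.mem_nhds hx₀] using h.isInvertible

variable [IsManifold I ∞ X]

theorem contMDiffAt [CompleteSpace E] (h : IsConstantIn A U F c) {x₀ : X} (hx₀ : x₀ ∈ U) :
    ContMDiffAt I (I.prod 𝓘(ℝ, E →L[ℝ] E)) ∞
      (fun x ↦ TotalSpace.mk' (E →L[ℝ] E)
        (E := fun x : X ↦ TangentSpace I x →L[ℝ] TangentSpace I x) x (A x)) x₀ := by
  refine contMDiffAt_endField_of_mvfderiv (h.contMDiffOn.contMDiffAt (h.isOpen.mem_nhds hx₀))
    (h.eventually_isInvertible hx₀) c ?_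
  filter_upwards [h.isOpen.mem_nhds hx₀] using h.mvfderiv_apply

variable [I.Boundaryless]

/-- Constant coordinates are the coordinates of a chart. -/
theorem exists_chart [CompleteSpace E] (h : IsConstantIn A U F c) {x₀ : X} (hx₀ : x₀ ∈ U) :
    ∃ φ ∈ IsManifold.maximalAtlas I ∞ X, x₀ ∈ φ.source ∧ φ.source ⊆ U ∧
      ∀ x ∈ φ.source, mfderiv I 𝓘(ℝ, E) (φ.extend I) x = mvfderiv I F x := by
  obtain ⟨φ, hφ, hx, hU, hF⟩ :=
    exists_chart_of_isInvertible_mfderiv h.isOpen hx₀ h.contMDiffOn (h.isInvertible x₀ hx₀)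
  refine ⟨φ, hφ, hx, hU, fun x hx ↦ ?_⟩
  have : (φ.extend I : X → E) =ᶠ[𝓝 x] F := by
    filter_upwards [φ.open_source.mem_nhds hx] using hF
  exact this.mfderiv_eq

theorem exists_chart_apply [CompleteSpace E] (h : IsConstantIn A U F c) {x₀ : X} (hx₀ : x₀ ∈ U) :
    ∃ φ ∈ IsManifold.maximalAtlas I ∞ X, x₀ ∈ φ.source ∧ ∀ x ∈ φ.source, ∀ v : TangentSpace I x,
      mfderiv I 𝓘(ℝ, E) (φ.extend I) x (A x v) = c (mfderiv I 𝓘(ℝ, E) (φ.extend I) x v) := by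
  obtain ⟨φ, hφ, hx, hU, hF⟩ := h.exists_chart hx₀
  refine ⟨φ, hφ, hx, fun x hx v ↦ ?_⟩
  rw [hF x hx]
  exact h.mvfderiv_apply x (hU hx) v

end IsConstantIn

variable [IsManifold I ∞ X] [I.Boundaryless]

theorem isIntegrableDistribution_eigenPlus [CompleteSpace E] {A : EndField I X}
    (hA : ∀ x₀ : X, ∃ U F c, x₀ ∈ U ∧ IsConstantIn A U F c) :
    IsIntegrableDistribution I (eigenPlus I A) := by
  intro x₀
  obtain ⟨U, F, c, hx₀, h⟩ := hA x₀
  obtain ⟨φ, hφ, hx, hU, hF⟩ := h.exists_chart hx₀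
  refine ⟨φ, hφ, hx, LinearMap.ker (ContinuousLinearMap.id ℝ E - c).toLinearMap, fun x hx v ↦ ?_⟩
  rw [hF x hx]
  have h1 : (ContinuousLinearMap.id ℝ E - c) (mvfderiv I F x v) = mvfderiv I F x (v - A x v) := by
    rw [map_sub, h.mvfderiv_apply x (hU hx)]
    rfl
  refine ⟨fun hv ↦ ?_, fun hv ↦ ?_⟩
  · exact h1.trans ((congrArg (mvfderiv I F x) hv).trans (map_zero _))
  · exact (h.isInvertible x (hU hx)).injective ((h1.symm.trans hv).trans (map_zero _).symm)

theorem isIntegrableDistribution_eigenMinus [CompleteSpace E] {A : EndField I X}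
    (hA : ∀ x₀ : X, ∃ U F c, x₀ ∈ U ∧ IsConstantIn A U F c) :
    IsIntegrableDistribution I (eigenMinus I A) := by
  intro x₀
  obtain ⟨U, F, c, hx₀, h⟩ := hA x₀
  obtain ⟨φ, hφ, hx, hU, hF⟩ := h.exists_chart hx₀
  refine ⟨φ, hφ, hx, LinearMap.ker (ContinuousLinearMap.id ℝ E + c).toLinearMap, fun x hx v ↦ ?_⟩
  rw [hF x hx]
  have h1 : (ContinuousLinearMap.id ℝ E + c) (mvfderiv I F x v) = mvfderiv I F x (v + A x v) := by
    rw [map_add, h.mvfderiv_apply x (hU hx)]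
    rfl
  refine ⟨fun hv ↦ ?_, fun hv ↦ ?_⟩
  · exact h1.trans ((congrArg (mvfderiv I F x) hv).trans (map_zero _))
  · exact (h.isInvertible x (hU hx)).injective ((h1.symm.trans hv).trans (map_zero _).symm)

/-- A two-form that is constant in smooth coordinates is closed. -/
theorem isClosedTwoForm_of_mvfderiv [CompleteSpace E] {b : BilinField I X}
    (hb : ∀ x₀ : X, ∃ (F : X → V) (c : V →L[ℝ] V →L[ℝ] ℝ), ContMDiffAt I 𝓘(ℝ, V) ∞ F x₀ ∧
      (∀ u v, c u v = -c v u) ∧ ∀ᶠ x in 𝓝 x₀, ∀ v w : TangentSpace I x,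
        b x v w = c (mvfderiv I F x v) (mvfderiv I F x w)) :
    IsClosedTwoForm I b := by
  intro Y₁ Y₂ Y₃ h₁ h₂ h₃ x
  obtain ⟨F, c, hF, hc, hbc⟩ := hb x
  have hd (Y Z : Π x : X, TangentSpace I x) (hY : IsSmoothVectorField I Y)
      (hZ : IsSmoothVectorField I Z) (u : TangentSpace I x) :
      mvfderiv I (fun y ↦ b y (Y y) (Z y)) x u =
        c (mvfderiv I (fun y ↦ mvfderiv I F y (Y y)) x u) (mvfderiv I F x (Z x)) +
          c (mvfderiv I F x (Y x)) (mvfderiv I (fun y ↦ mvfderiv I F y (Z y)) x u) := by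
    rw [← mvfderiv_bilin ((contMDiffAt_mvfderiv_apply hF (hY x)).mdifferentiableAt (by simp))
      ((contMDiffAt_mvfderiv_apply hF (hZ x)).mdifferentiableAt (by simp)) c u]
    have : (fun y ↦ b y (Y y) (Z y)) =ᶠ[𝓝 x]
        fun y ↦ c (mvfderiv I F y (Y y)) (mvfderiv I F y (Z y)) := by
      filter_upwards [hbc] with y hy using hy _ _
    exact congr($(this.mfderiv_eq) u)
  rw [hd Y₂ Y₃ h₂ h₃, hd Y₁ Y₃ h₁ h₃, hd Y₁ Y₂ h₁ h₂]
  simp only [hbc.self_of_nhds, mvfderiv_mlieBracket hF (h₁ x) (h₂ x),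
    mvfderiv_mlieBracket hF (h₁ x) (h₃ x), mvfderiv_mlieBracket hF (h₂ x) (h₃ x), map_sub,
    sub_apply]
  rw [hc (mvfderiv I F x (Y₁ x)) (mvfderiv I (fun y ↦ mvfderiv I F y (Y₂ y)) x (Y₃ x)),
    hc (mvfderiv I F x (Y₁ x)) (mvfderiv I (fun y ↦ mvfderiv I F y (Y₃ y)) x (Y₂ x)),
    hc (mvfderiv I F x (Y₂ x)) (mvfderiv I (fun y ↦ mvfderiv I F y (Y₃ y)) x (Y₁ x))]
  ring

end ConstantCoordinates

section LocalConnection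

open Set ContinuousLinearMap

variable {E : Type*} [NormedAddCommGroup E] [NormedSpace ℝ E]
  {H : Type*} [TopologicalSpace H] {I : ModelWithCorners ℝ E H}
  {X : Type*} [TopologicalSpace X] [ChartedSpace H X] [IsManifold I ∞ X]

variable (I) in
/-- `Y` is a smooth vector field on `U`. -/
def IsSmoothVectorFieldOn (Y : Π x : X, TangentSpace I x) (U : Set X) : Prop :=
  ContMDiffOn I I.tangent ∞ (fun x ↦ (⟨x, Y x⟩ : TangentBundle I X)) U

namespace IsSmoothVectorFieldOn

variable {Y Z : Π x : X, TangentSpace I x} {U : Set X} {x : X}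

theorem contMDiffAt (h : IsSmoothVectorFieldOn I Y U) (hU : IsOpen U) (hx : x ∈ U) :
    ContMDiffAt I I.tangent ∞ (fun x ↦ (⟨x, Y x⟩ : TangentBundle I X)) x :=
  ContMDiffOn.contMDiffAt h (hU.mem_nhds hx)

theorem mdifferentiableAt (h : IsSmoothVectorFieldOn I Y U) (hU : IsOpen U) (hx : x ∈ U) :
    MDifferentiableAt I I.tangent (fun x ↦ (⟨x, Y x⟩ : TangentBundle I X)) x :=
  (h.contMDiffAt hU hx).mdifferentiableAt (by simp)

theorem endField_apply {A : EndField I X} (h : IsSmoothVectorFieldOn I Y U)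
    (hA : IsSmoothEndField I A) : IsSmoothVectorFieldOn I (fun x ↦ A x (Y x)) U :=
  ContMDiffOn.clm_bundle_apply (F₁ := E) (F₂ := E) (E₁ := fun x : X ↦ TangentSpace I x)
    (E₂ := fun x : X ↦ TangentSpace I x) (b := fun x ↦ x) (hA.contMDiffOn (s := U)) h

theorem bilinField_apply {b : BilinField I X} (hY : IsSmoothVectorFieldOn I Y U)
    (hZ : IsSmoothVectorFieldOn I Z U) (hb : IsSmoothBilinField I b) :
    ContMDiffOn I 𝓘(ℝ, ℝ) ∞ (fun x ↦ b x (Y x) (Z x)) U := by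
  have h := ContMDiffOn.clm_bundle_apply₂ (F₁ := E) (F₂ := E) (F₃ := ℝ)
    (E₁ := fun x : X ↦ TangentSpace I x) (E₂ := fun x : X ↦ TangentSpace I x)
    (E₃ := Bundle.Trivial X ℝ) (b := fun x ↦ x) (hb.contMDiffOn (s := U)) hY hZ
  intro x hx
  exact ((contMDiffWithinAt_totalSpace).1 (h x hx)).2

/-- A locally defined smooth vector field agrees near a given point with a global one. -/
theorem exists_extension [FiniteDimensional ℝ E] [T2Space X] (h : IsSmoothVectorFieldOn I Y U)
    (hU : IsOpen U) (hx : x ∈ U) :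
    ∃ Y' : Π x : X, TangentSpace I x, IsSmoothVectorField I Y' ∧ ∀ᶠ y in 𝓝 x, Y' y = Y y := by
  obtain ⟨f, -, hf⟩ := (SmoothBumpFunction.nhds_basis_tsupport (I := I) x).mem_iff.1
    (hU.mem_nhds hx)
  refine ⟨fun y ↦ f y • Y y, ContMDiffOn.smul_section_of_tsupport f.contMDiff.contMDiffOn hU hf h,
    ?_⟩
  filter_upwards [f.eventuallyEq_one] with y hy
  rw [hy]
  exact one_smul _ _

end IsSmoothVectorFieldOn

variable {cov : CovariantDerivative I E (TangentSpace I : X → Type _)}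
  {Y₁ Y₂ Y₃ : Π x : X, TangentSpace I x} {U : Set X} {x : X}

theorem IsSmoothVectorFieldOn.cov_congr {Y Y' : Π x : X, TangentSpace I x}
    (hY : IsSmoothVectorFieldOn I Y U) (hU : IsOpen U) (hx : x ∈ U)
    (hY' : IsSmoothVectorField I Y') (h : ∀ᶠ y in 𝓝 x, Y' y = Y y) :
    ∀ᶠ y in 𝓝 x, cov Y' y = cov Y y := by
  filter_upwards [h.eventually_nhds, hU.mem_nhds hx] with y hy hyU
  exact cov.isCovariantDerivativeOn.congr_of_eventuallyEq
    ((hY' y).mdifferentiableAt (by simp)) (hY.mdifferentiableAt hU hyU) Filter.univ_mem hy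

variable [FiniteDimensional ℝ E] [T2Space X]

/-- `∇_Z Y` is smooth where `Y` and `Z` are. -/
theorem IsSmoothVectorFieldOn.cov_apply
    (hcov : CovariantDerivative.ContMDiffCovariantDerivative cov ∞)
    {Y Z : Π x : X, TangentSpace I x} (hU : IsOpen U)
    (hY : IsSmoothVectorFieldOn I Y U) (hZ : IsSmoothVectorFieldOn I Z U) :
    IsSmoothVectorFieldOn I (fun x ↦ cov Y x (Z x)) U := by
  intro x hx
  obtain ⟨Y', hY', hYY'⟩ := hY.exists_extension hU hx
  have h1 := (hcov.contMDiff.contMDiff (σ := Y') hY'.contMDiffOn).contMDiffAt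
    (x := x) Filter.univ_mem
  have h2 := ContMDiffAt.clm_bundle_apply (F₁ := E) (F₂ := E) (E₁ := fun x : X ↦ TangentSpace I x)
    (E₂ := fun x : X ↦ TangentSpace I x) (b := fun x ↦ x) h1 (hZ.contMDiffAt hU hx)
  refine (h2.congr_of_eventuallyEq ?_).contMDiffWithinAt
  filter_upwards [hY.cov_congr (cov := cov) hU hx hY' hYY'] with y hy
  change (⟨y, cov Y y (Z y)⟩ : TangentBundle I X) = ⟨y, cov Y' y (Z y)⟩
  rw [hy]

theorem IsFlatConnection.apply_of_smoothOn (hflat : IsFlatConnection cov)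
    (hcov : CovariantDerivative.ContMDiffCovariantDerivative cov ∞) (hU : IsOpen U)
    (h₁ : IsSmoothVectorFieldOn I Y₁ U) (h₂ : IsSmoothVectorFieldOn I Y₂ U)
    (h₃ : IsSmoothVectorFieldOn I Y₃ U) (hx : x ∈ U) :
    cov (fun y ↦ cov Y₃ y (Y₂ y)) x (Y₁ x) - cov (fun y ↦ cov Y₃ y (Y₁ y)) x (Y₂ x)
      - cov Y₃ x (VectorField.mlieBracket I Y₁ Y₂ x) = 0 := by
  obtain ⟨Z₁, hZ₁, e₁⟩ := h₁.exists_extension hU hx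
  obtain ⟨Z₂, hZ₂, e₂⟩ := h₂.exists_extension hU hx
  obtain ⟨Z₃, hZ₃, e₃⟩ := h₃.exists_extension hU hx
  have h := hflat Z₁ Z₂ Z₃ hZ₁ hZ₂ hZ₃ x
  have key {Y Z : Π x : X, TangentSpace I x} (hY : IsSmoothVectorFieldOn I Y U)
      (hZ : IsSmoothVectorField I Z) (e : ∀ᶠ y in 𝓝 x, Z y = Y y) :
      cov (fun y ↦ cov Z₃ y (Z y)) x = cov (fun y ↦ cov Y₃ y (Y y)) x := by
    refine cov.isCovariantDerivativeOn.congr_of_eventuallyEq ?_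
      ((h₃.cov_apply hcov hU hY).mdifferentiableAt hU hx) Filter.univ_mem ?_
    · exact (IsSmoothVectorFieldOn.cov_apply hcov isOpen_univ hZ₃.contMDiffOn
        hZ.contMDiffOn).mdifferentiableAt isOpen_univ (mem_univ x)
    · filter_upwards [e, h₃.cov_congr (cov := cov) hU hx hZ₃ e₃] with y h1 h2
      rw [h1, h2]
  rw [key h₂ hZ₂ e₂, key h₁ hZ₁ e₁, (h₃.cov_congr hU hx hZ₃ e₃).self_of_nhds, e₁.self_of_nhds,
    e₂.self_of_nhds, Filter.EventuallyEq.mlieBracket_vectorField_eq e₁ e₂] at h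
  exact h

theorem IsParallelForm.apply_of_smoothOn {b : BilinField I X} (hb : IsParallelForm cov b)
    (hU : IsOpen U) (h₁ : IsSmoothVectorFieldOn I Y₁ U) (h₂ : IsSmoothVectorFieldOn I Y₂ U)
    (h₃ : IsSmoothVectorFieldOn I Y₃ U) (hx : x ∈ U) :
    mvfderiv I (fun y ↦ b y (Y₂ y) (Y₃ y)) x (Y₁ x)
      - b x (cov Y₂ x (Y₁ x)) (Y₃ x) - b x (Y₂ x) (cov Y₃ x (Y₁ x)) = 0 := by
  obtain ⟨Z₁, hZ₁, e₁⟩ := h₁.exists_extension hU hx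
  obtain ⟨Z₂, hZ₂, e₂⟩ := h₂.exists_extension hU hx
  obtain ⟨Z₃, hZ₃, e₃⟩ := h₃.exists_extension hU hx
  have h := hb Z₁ Z₂ Z₃ hZ₁ hZ₂ hZ₃ x
  have h4 : (fun y ↦ b y (Z₂ y) (Z₃ y)) =ᶠ[𝓝 x] fun y ↦ b y (Y₂ y) (Y₃ y) := by
    filter_upwards [e₂, e₃] with y h1 h2
    rw [h1, h2]
  have h5 : mvfderiv I (fun y ↦ b y (Z₂ y) (Z₃ y)) x (Y₁ x) =
    mvfderiv I (fun y ↦ b y (Y₂ y) (Y₃ y)) x (Y₁ x) := congr($(h4.mfderiv_eq) (Y₁ x))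
  rw [(h₃.cov_congr hU hx hZ₃ e₃).self_of_nhds, (h₂.cov_congr hU hx hZ₂ e₂).self_of_nhds,
    e₁.self_of_nhds, e₂.self_of_nhds, e₃.self_of_nhds, h5] at h
  exact h

theorem HasSymmetricDeriv.apply_of_smoothOn {A : EndField I X} (hsymm : HasSymmetricDeriv cov A)
    (hA : IsSmoothEndField I A) (hU : IsOpen U) (h₁ : IsSmoothVectorFieldOn I Y₁ U)
    (h₂ : IsSmoothVectorFieldOn I Y₂ U) (hx : x ∈ U) :
    cov (fun y ↦ A y (Y₂ y)) x (Y₁ x) - A x (cov Y₂ x (Y₁ x)) =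
      cov (fun y ↦ A y (Y₁ y)) x (Y₂ x) - A x (cov Y₁ x (Y₂ x)) := by
  obtain ⟨Z₁, hZ₁, e₁⟩ := h₁.exists_extension hU hx
  obtain ⟨Z₂, hZ₂, e₂⟩ := h₂.exists_extension hU hx
  have h := hsymm Z₁ Z₂ hZ₁ hZ₂ x
  have key {Y Z : Π x : X, TangentSpace I x} (hY : IsSmoothVectorFieldOn I Y U)
      (hZ : IsSmoothVectorField I Z) (e : ∀ᶠ y in 𝓝 x, Z y = Y y) :
      cov (fun y ↦ A y (Z y)) x = cov (fun y ↦ A y (Y y)) x := by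
    refine cov.isCovariantDerivativeOn.congr_of_eventuallyEq ?_
      ((hY.endField_apply hA).mdifferentiableAt hU hx) Filter.univ_mem ?_
    · exact (IsSmoothVectorFieldOn.endField_apply hZ.contMDiffOn hA).mdifferentiableAt
        isOpen_univ (mem_univ x)
    · filter_upwards [e] with y h1
      rw [h1]
  rw [key h₂ hZ₂ e₂, key h₁ hZ₁ e₁, (h₁.cov_congr hU hx hZ₁ e₁).self_of_nhds,
    (h₂.cov_congr hU hx hZ₂ e₂).self_of_nhds, e₁.self_of_nhds, e₂.self_of_nhds] at h
  exact h

end LocalConnection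

section CoordinateFields

open Set ContinuousLinearMap

variable {E : Type*} [NormedAddCommGroup E] [NormedSpace ℝ E]
  {H : Type*} [TopologicalSpace H] {I : ModelWithCorners ℝ E H}
  {X : Type*} [TopologicalSpace X] [ChartedSpace H X]

variable (I) in
/-- The vector field with constant components `e` in the coordinates `F`. -/
def coordField (F : X → E) (e : E) (x : X) : TangentSpace I x := (mvfderiv I F x).inverse e

namespace IsCoordinateOn

variable {F : X → E} {U : Set X} {x : X}

theorem contMDiffAt (h : IsCoordinateOn I F U) (hx : x ∈ U) : ContMDiffAt I 𝓘(ℝ, E) ∞ F x :=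
  h.contMDiffOn.contMDiffAt (h.isOpen.mem_nhds hx)

theorem mvfderiv_coordField (h : IsCoordinateOn I F U) (hx : x ∈ U) (e : E) :
    mvfderiv I F x (coordField I F e x) = e :=
  (h.isInvertible x hx).self_apply_inverse e

theorem coordField_mvfderiv (h : IsCoordinateOn I F U) (hx : x ∈ U) (v : TangentSpace I x) :
    coordField I F (mvfderiv I F x v) x = v :=
  (h.isInvertible x hx).inverse_apply_self v

theorem injective (h : IsCoordinateOn I F U) (hx : x ∈ U) :
    Function.Injective (mvfderiv I F x) :=
  (h.isInvertible x hx).injective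

theorem mono {V : Set X} (h : IsCoordinateOn I F U) (hV : IsOpen V) (hVU : V ⊆ U) :
    IsCoordinateOn I F V :=
  ⟨hV, h.contMDiffOn.mono hVU, fun x hx ↦ h.isInvertible x (hVU hx)⟩

variable [IsManifold I ∞ X]

theorem contMDiffOn_mvfderiv_apply (h : IsCoordinateOn I F U) {Y : Π x : X, TangentSpace I x}
    (hY : IsSmoothVectorFieldOn I Y U) :
    ContMDiffOn I 𝓘(ℝ, E) ∞ (fun y ↦ mvfderiv I F y (Y y)) U := fun _ hx ↦
  (contMDiffAt_mvfderiv_apply (h.contMDiffAt hx) (hY.contMDiffAt h.isOpen hx)).contMDiffWithinAt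

theorem isSmoothVectorFieldOn_coordField [CompleteSpace E] (h : IsCoordinateOn I F U) (e : E) :
    IsSmoothVectorFieldOn I (coordField I F e) U := by
  intro x hx
  refine (contMDiffAt_of_mvfderiv_apply (h.contMDiffAt hx) ?_ ?_).contMDiffWithinAt
  · filter_upwards [h.isOpen.mem_nhds hx] using h.isInvertible
  · refine (contMDiffAt_const (c := e)).congr_of_eventuallyEq ?_
    filter_upwards [h.isOpen.mem_nhds hx] with y hy using h.mvfderiv_coordField hy e

theorem mlieBracket_coordField [CompleteSpace E] [I.Boundaryless] (h : IsCoordinateOn I F U)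
    (hx : x ∈ U) (e f : E) :
    VectorField.mlieBracket I (coordField I F e) (coordField I F f) x = 0 := by
  apply h.injective hx
  have hc (e : E) : ∀ᶠ y in 𝓝 x, mvfderiv I F y (coordField I F e y) = e := by
    filter_upwards [h.isOpen.mem_nhds hx] with y hy using h.mvfderiv_coordField hy e
  rw [mvfderiv_mlieBracket (h.contMDiffAt hx)
    ((h.isSmoothVectorFieldOn_coordField e).contMDiffAt h.isOpen hx)
    ((h.isSmoothVectorFieldOn_coordField f).contMDiffAt h.isOpen hx), map_zero,
    mvfderiv_eq_zero_of_eventuallyEq_const (hc e), mvfderiv_eq_zero_of_eventuallyEq_const (hc f),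
    sub_zero]

end IsCoordinateOn

variable [IsManifold I ∞ X]
  {cov : CovariantDerivative I E (TangentSpace I : X → Type _)} {F : X → E} {U : Set X} {x : X}

theorem cov_sum {ι : Type*} (s : Finset ι) (Y : ι → Π x : X, TangentSpace I x)
    (hY : ∀ i, MDifferentiableAt I I.tangent (fun x ↦ (⟨x, Y i x⟩ : TangentBundle I X)) x) :
    cov (∑ i ∈ s, Y i) x = ∑ i ∈ s, cov (Y i) x ∧
      MDifferentiableAt I I.tangent (fun x ↦ (⟨x, (∑ i ∈ s, Y i) x⟩ : TangentBundle I X)) x := by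
  classical
  induction s using Finset.induction_on with
  | empty =>
    refine ⟨?_, mdifferentiableAt_zeroSection ..⟩
    simp
  | insert i s hi ih =>
    rw [Finset.sum_insert hi, Finset.sum_insert hi, ← ih.1]
    exact ⟨cov.isCovariantDerivativeOn.add (hY i) ih.2, mdifferentiableAt_add_section (hY i) ih.2⟩

variable [FiniteDimensional ℝ E]

/-- The Christoffel symbols `Γ (u) (v)` of the connection in the coordinates `F`: the components of
the derivative in the direction `u` of the coordinate field of `v`. -/
def christoffel (cov : CovariantDerivative I E (TangentSpace I : X → Type _)) (F : X → E) (x : X) :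
    E →L[ℝ] E →L[ℝ] E :=
  (∑ i, (LinearMap.toContinuousLinearMap ((Module.finBasis ℝ E).coord i)).smulRight
    (mvfderiv I F x ∘L cov (coordField I F (Module.finBasis ℝ E i)) x ∘L
      (mvfderiv I F x).inverse : E →L[ℝ] E)).flip

theorem christoffel_apply_eq_sum (u v : E) : christoffel cov F x u v =
    ∑ i, (Module.finBasis ℝ E).repr v i •
      mvfderiv I F x (cov (coordField I F (Module.finBasis ℝ E i)) x (coordField I F u x)) := by
  simp [christoffel, coordField, sum_apply]

/-- The connection in coordinates. -/
theorem IsCoordinateOn.mvfderiv_cov (h : IsCoordinateOn I F U) {Y : Π x : X, TangentSpace I x}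
    (hY : IsSmoothVectorFieldOn I Y U) (hx : x ∈ U) (u : TangentSpace I x) :
    mvfderiv I F x (cov Y x u) = mvfderiv I (fun y ↦ mvfderiv I F y (Y y)) x u +
      christoffel cov F x (mvfderiv I F x u) (mvfderiv I F x (Y x)) := by
  let b := Module.finBasis ℝ E
  let Y' : X → E := fun y ↦ mvfderiv I F y (Y y)
  let c (i) : E →L[ℝ] ℝ := LinearMap.toContinuousLinearMap (b.coord i)
  have hb (v : E) : ∑ i, c i v • b i = v := b.sum_repr v
  have hY' : MDifferentiableAt I 𝓘(ℝ, E) Y' x :=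
    ((h.contMDiffOn_mvfderiv_apply hY).contMDiffAt (h.isOpen.mem_nhds hx)).mdifferentiableAt
      (by simp)
  have hc (i) : MDifferentiableAt I 𝓘(ℝ, ℝ) (fun y ↦ c i (Y' y)) x :=
    (c i).mdifferentiableAt.comp x hY'
  have hX (i) := (h.isSmoothVectorFieldOn_coordField (b i)).mdifferentiableAt h.isOpen hx
  have hs := cov_sum (cov := cov) Finset.univ
    (fun i ↦ (fun y ↦ c i (Y' y)) • coordField I F (b i)) (x := x)
    (fun i ↦ (hc i).smul_section (hX i))
  have h1 : cov Y x = cov (∑ i, (fun y ↦ c i (Y' y)) • coordField I F (b i)) x := by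
    refine cov.isCovariantDerivativeOn.congr_of_eventuallyEq (hY.mdifferentiableAt h.isOpen hx)
      hs.2 Filter.univ_mem ?_
    filter_upwards [h.isOpen.mem_nhds hx] with y hy
    apply h.injective hy
    simp only [Finset.sum_apply, Pi.smul_apply', map_sum, map_smul, h.mvfderiv_coordField hy]
    exact (hb _).symm
  rw [h1, hs.1, sum_apply, map_sum, christoffel_apply_eq_sum, h.coordField_mvfderiv hx]
  have h2 (i) : mvfderiv I F x (cov ((fun y ↦ c i (Y' y)) • coordField I F (b i)) x u) =
      b.repr (Y' x) i • mvfderiv I F x (cov (coordField I F (b i)) x u) +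
        c i (mvfderiv I Y' x u) • b i := by
    rw [cov.isCovariantDerivativeOn.leibniz (hX i) (hc i), ← mvfderiv_clm_comp hY' (c i) u]
    have h3 := h.mvfderiv_coordField hx (b i)
    simp only [add_apply, smul_apply, smulRight_apply, map_add, map_smul, h3]
    rfl
  rw [Finset.sum_congr rfl fun i _ ↦ h2 i, Finset.sum_add_distrib, hb, add_comm]

theorem IsCoordinateOn.christoffel_apply (h : IsCoordinateOn I F U) (hx : x ∈ U) (u v : E) :
    christoffel cov F x u v = mvfderiv I F x (cov (coordField I F v) x (coordField I F u x)) := by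
  have hc (e : E) : ∀ᶠ y in 𝓝 x, mvfderiv I F y (coordField I F e y) = e := by
    filter_upwards [h.isOpen.mem_nhds hx] with y hy using h.mvfderiv_coordField hy e
  rw [h.mvfderiv_cov (h.isSmoothVectorFieldOn_coordField v) hx,
    mvfderiv_eq_zero_of_eventuallyEq_const (hc v), h.mvfderiv_coordField hx,
    h.mvfderiv_coordField hx, zero_add]

theorem IsCoordinateOn.cov_coordField_symm [I.Boundaryless] (h : IsCoordinateOn I F U)
    (htor : cov.torsion = 0) (hx : x ∈ U) (u v : E) :
    cov (coordField I F v) x (coordField I F u x) =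
      cov (coordField I F u) x (coordField I F v x) := by
  have h1 := (cov.torsion_eq_zero_iff).1 htor
    ((h.isSmoothVectorFieldOn_coordField u).mdifferentiableAt h.isOpen hx)
    ((h.isSmoothVectorFieldOn_coordField v).mdifferentiableAt h.isOpen hx)
  rw [h.mlieBracket_coordField hx] at h1
  exact sub_eq_zero.1 h1

end CoordinateFields

section AffineCoordinates

open Set ContinuousLinearMap

variable {E : Type*} [NormedAddCommGroup E] [NormedSpace ℝ E]
  {H : Type*} [TopologicalSpace H] {I : ModelWithCorners ℝ E H}
  {X : Type*} [TopologicalSpace X] [ChartedSpace H X] [IsManifold I ∞ X]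
  {V : Type*} [NormedAddCommGroup V] [NormedSpace ℝ V]

theorem HasFDerivAt.apply_const {E V W : Type*} [NormedAddCommGroup E] [NormedSpace ℝ E]
    [NormedAddCommGroup V] [NormedSpace ℝ V] [NormedAddCommGroup W] [NormedSpace ℝ W]
    {f : E → V →L[ℝ] W} {f' : E →L[ℝ] V →L[ℝ] W} {z : E} (h : HasFDerivAt f f' z) (v : V) :
    HasFDerivAt (fun y ↦ f y v) (f'.flip v) z := by
  simpa using h.clm_apply (hasFDerivAt_const v z)

theorem isCoordinateOn_extChartAt (x₀ : X) :
    IsCoordinateOn I (extChartAt I x₀) (extChartAt I x₀).source :=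
  ⟨isOpen_extChartAt_source x₀, by
    rw [extChartAt_source]; exact contMDiffOn_extChartAt,
    fun _ hx ↦ isInvertible_mfderiv_extChartAt hx⟩

theorem ContMDiffOn.contDiffOn_comp_extChartAt_symm {f : X → V} {x₀ : X}
    (hf : ContMDiffOn I 𝓘(ℝ, V) ∞ f (extChartAt I x₀).source) :
    ContDiffOn ℝ ∞ (f ∘ (extChartAt I x₀).symm) (extChartAt I x₀).target :=
  contMDiffOn_iff_contDiffOn.1
    (hf.comp (contMDiffOn_extChartAt_symm x₀) (extChartAt I x₀).mapsTo_symm)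

theorem mvfderiv_comp_extChartAt {f : E → V} {x₀ x : X} (hx : x ∈ (extChartAt I x₀).source)
    (hf : DifferentiableAt ℝ f (extChartAt I x₀ x)) (u : TangentSpace I x) :
    mvfderiv I (f ∘ extChartAt I x₀) x u =
      fderiv ℝ f (extChartAt I x₀ x) (mvfderiv I (extChartAt I x₀) x u) := by
  have h := hf.hasFDerivAt.hasMFDerivAt.comp x
    (((isCoordinateOn_extChartAt x₀).contMDiffAt hx).mdifferentiableAt (by simp)).hasMFDerivAt
  exact congr($h.mfderiv u)

variable [I.Boundaryless]

theorem fderiv_comp_extChartAt_symm {f : X → V} {x₀ x : X}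
    (hf : ContMDiffOn I 𝓘(ℝ, V) ∞ f (extChartAt I x₀).source) (hx : x ∈ (extChartAt I x₀).source)
    (u : TangentSpace I x) :
    fderiv ℝ (f ∘ (extChartAt I x₀).symm) (extChartAt I x₀ x) (mvfderiv I (extChartAt I x₀) x u) =
      mvfderiv I f x u := by
  have hd : DifferentiableAt ℝ (f ∘ (extChartAt I x₀).symm) (extChartAt I x₀ x) :=
    (hf.contDiffOn_comp_extChartAt_symm.contDiffAt ((isOpen_extChartAt_target x₀).mem_nhds
      ((extChartAt I x₀).map_source hx))).differentiableAt (by simp)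
  rw [← mvfderiv_comp_extChartAt hx hd]
  have : (f ∘ (extChartAt I x₀).symm) ∘ extChartAt I x₀ =ᶠ[𝓝 x] f := by
    filter_upwards [(isOpen_extChartAt_source x₀).mem_nhds hx] with y hy
    exact congrArg f ((extChartAt I x₀).left_inv hy)
  exact congr($(this.mfderiv_eq) u)

variable [FiniteDimensional ℝ E] [T2Space X]
  {cov : CovariantDerivative I E (TangentSpace I : X → Type _)}

/-- A flat torsion-free connection has affine coordinates `χ` around every point; if `∇A` is
symmetric, then `dχ ∘ A` is the differential of a function. -/
theorem exists_affine_coordinates_of_flat {A : EndField I X} (hA : IsSmoothEndField I A)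
    (hcov : CovariantDerivative.ContMDiffCovariantDerivative cov ∞) (htor : cov.torsion = 0)
    (hflat : IsFlatConnection cov) (hsymm : HasSymmetricDeriv cov A) (x₀ : X) :
    ∃ ρ > 0, Metric.ball (extChartAt I x₀ x₀) ρ ⊆ (extChartAt I x₀).target ∧ ∃ χ φ : X → E,
      let U := (extChartAt I x₀).source ∩ extChartAt I x₀ ⁻¹' Metric.ball (extChartAt I x₀ x₀) ρ
      IsCoordinateOn I χ U ∧ ContMDiffOn I 𝓘(ℝ, E) ∞ φ U ∧
        (∀ x ∈ U, ∀ v : TangentSpace I x, mvfderiv I φ x v = mvfderiv I χ x (A x v)) ∧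
        ∀ x ∈ U, ∀ e, cov (coordField I χ e) x = 0 := by
  set κ := extChartAt I x₀ with hκ
  have hK : IsCoordinateOn I κ κ.source := isCoordinateOn_extChartAt x₀
  have htar : IsOpen κ.target := isOpen_extChartAt_target x₀
  have hX (e : E) := hK.isSmoothVectorFieldOn_coordField e
  have hAX (e : E) := (hX e).endField_apply hA
  have hcX (u v : E) := (hX v).cov_apply hcov hK.isOpen (hX u)
  let Γ : E → E →L[ℝ] E →L[ℝ] E := christoffel cov κ ∘ κ.symm
  let S : X → E →L[ℝ] E := fun x ↦ mvfderiv I κ x ∘L A x ∘L (mvfderiv I κ x).inverse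
  let T : E → E →L[ℝ] E := S ∘ κ.symm
  have hΓs (u v : E) :
      ContMDiffOn I 𝓘(ℝ, E) ∞ (fun x ↦ christoffel cov κ x u v) κ.source :=
    (hK.contMDiffOn_mvfderiv_apply (hcX u v)).congr fun x hx ↦ hK.christoffel_apply hx u v
  have hSs (v : E) : ContMDiffOn I 𝓘(ℝ, E) ∞ (fun x ↦ S x v) κ.source :=
    hK.contMDiffOn_mvfderiv_apply (hAX v)
  have hΓ : ContDiffOn ℝ ∞ Γ κ.target := by
    refine contDiffOn_clm_apply.2 fun u ↦ contDiffOn_clm_apply.2 fun v ↦ ?_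
    exact (hΓs u v).contDiffOn_comp_extChartAt_symm
  have hT : ContDiffOn ℝ ∞ T κ.target := contDiffOn_clm_apply.2 fun v ↦
    (hSs v).contDiffOn_comp_extChartAt_symm
  have hΓd (x : X) (hx : x ∈ κ.source) (u v w : E) : fderiv ℝ Γ (κ x) u v w =
      mvfderiv I (fun y ↦ christoffel cov κ y v w) x (coordField I κ u x) := by
    rw [← fderiv_comp_extChartAt_symm (hΓs v w) hx, ← hκ, hK.mvfderiv_coordField hx]
    have h1 := ((hΓ.contDiffAt (htar.mem_nhds (κ.map_source hx))).differentiableAt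
      (by simp)).hasFDerivAt
    have h2 := h1.apply_const v
    have h3 := h2.apply_const w
    exact (congr($(h3.fderiv) u)).symm
  have hTd (x : X) (hx : x ∈ κ.source) (u v : E) : fderiv ℝ T (κ x) u v =
      mvfderiv I (fun y ↦ S y v) x (coordField I κ u x) := by
    rw [← fderiv_comp_extChartAt_symm (hSs v) hx, ← hκ, hK.mvfderiv_coordField hx]
    have h1 := ((hT.contDiffAt (htar.mem_nhds (κ.map_source hx))).differentiableAt
      (by simp)).hasFDerivAt
    have h2 := h1.apply_const v
    exact (congr($(h2.fderiv) u)).symm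
  have hΓx (x : X) (hx : x ∈ κ.source) : Γ (κ x) = christoffel cov κ x := by
    simp only [Γ, Function.comp_apply, κ.left_inv hx]
  have hTx (x : X) (hx : x ∈ κ.source) : T (κ x) = S x := by
    simp only [T, Function.comp_apply, κ.left_inv hx]
  have htor' (x : X) (hx : x ∈ κ.source) (u v : E) :
      cov (coordField I κ v) x (coordField I κ u x) =
        cov (coordField I κ u) x (coordField I κ v x) := hK.cov_coordField_symm htor hx u v
  have key {P : E → Prop} (h : ∀ x ∈ κ.source, P (κ x)) (z : E) (hz : z ∈ κ.target) : P z := by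
    rw [← κ.right_inv hz]
    exact h _ (κ.map_target hz)
  obtain ⟨ρ, hρ, hball, G, χ, φ, hG, hχ, hφ, hGu, hGd, hχd, hφd⟩ := exists_affine_coordinates
    (Γ := Γ) (T := T) htar (κ.map_source (mem_extChartAt_source x₀)) hΓ hT
    (by
      refine key fun x hx u v ↦ ?_
      rw [hΓx x hx, hK.christoffel_apply hx, hK.christoffel_apply hx, htor' x hx])
    (by
      refine key fun x hx u v w ↦ ?_
      have h1 := hflat.apply_of_smoothOn hcov hK.isOpen (hX u) (hX v) (hX w) hx
      rw [hK.mlieBracket_coordField hx, map_zero, sub_zero, sub_eq_zero] at h1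
      have h2 (u v : E) : fderiv ℝ Γ (κ x) u v w + Γ (κ x) u (Γ (κ x) v w) =
          mvfderiv I κ x (cov (fun y ↦ cov (coordField I κ w) y (coordField I κ v y)) x
            (coordField I κ u x)) := by
        have h3 : (fun y ↦ christoffel cov κ y v w) =ᶠ[𝓝 x] fun y ↦
            mvfderiv I κ y (cov (coordField I κ w) y (coordField I κ v y)) := by
          filter_upwards [hK.isOpen.mem_nhds hx] with y hy using hK.christoffel_apply hy v w
        have h4 : mvfderiv I (fun y ↦ christoffel cov κ y v w) x (coordField I κ u x) = _ :=
          congr($(h3.mfderiv_eq) (coordField I κ u x))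
        rw [hK.mvfderiv_cov (hcX v w) hx, hΓd x hx, h4, hΓx x hx, hK.mvfderiv_coordField hx,
          hK.christoffel_apply hx v w]
        rfl
      rw [h2, h2, h1])
    (by
      refine key fun x hx u v ↦ ?_
      have h1 := hsymm.apply_of_smoothOn hA hK.isOpen (hX u) (hX v) hx
      rw [htor' x hx u v, sub_left_inj] at h1
      have h2 (u v : E) : fderiv ℝ T (κ x) u v + Γ (κ x) u (T (κ x) v) =
          mvfderiv I κ x (cov (fun y ↦ A y (coordField I κ v y)) x (coordField I κ u x)) := by
        rw [hK.mvfderiv_cov (hAX v) hx, hTd x hx, hΓx x hx, hTx x hx, hK.mvfderiv_coordField hx]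
        rfl
      rw [h2, h2, h1])
  refine ⟨ρ, hρ, hball, χ ∘ κ, φ ∘ κ, ?_⟩
  intro U
  have hU : IsOpen U := (continuousOn_extChartAt x₀).isOpen_inter_preimage
    (isOpen_extChartAt_source x₀) Metric.isOpen_ball
  have hκs : ContMDiffOn I 𝓘(ℝ, E) ∞ κ U := hK.contMDiffOn.mono inter_subset_left
  have hdχ (x : X) (hx : x ∈ U) (v : TangentSpace I x) :
      mvfderiv I (χ ∘ κ) x v = G (κ x) (mvfderiv I κ x v) := by
    rw [mvfderiv_comp_extChartAt hx.1 (hχd _ hx.2).differentiableAt, (hχd _ hx.2).fderiv]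
  have hχU : IsCoordinateOn I (χ ∘ κ) U := by
    refine ⟨hU, hχ.contMDiffOn.comp hκs fun x hx ↦ hx.2, fun x hx ↦ ?_⟩
    obtain ⟨e, he⟩ := hGu (κ x) hx.2
    have h1 : (G (κ x)).IsInvertible :=
      ⟨ContinuousLinearEquiv.unitsEquiv ℝ E e, by ext; simp [← he]⟩
    have h2 := h1.comp (hK.isInvertible x hx.1)
    have h3 : mvfderiv I (χ ∘ κ) x = G (κ x) ∘L mvfderiv I κ x :=
      ContinuousLinearMap.ext (hdχ x hx)
    rw [h3]
    exact h2
  refine ⟨hχU, hφ.contMDiffOn.comp hκs fun x hx ↦ hx.2, fun x hx v ↦ ?_, fun x hx e ↦ ?_⟩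
  · rw [mvfderiv_comp_extChartAt hx.1 (hφd _ hx.2).differentiableAt, (hφd _ hx.2).fderiv,
      hdχ x hx, comp_apply, hTx x hx.1]
    have := hK.coordField_mvfderiv hx.1 v
    exact congrArg (fun w ↦ G (κ x) (mvfderiv I κ x (A x w))) this
  · ext u
    apply hχU.injective hx
    have hY := hχU.isSmoothVectorFieldOn_coordField e
    have hK' : IsCoordinateOn I κ U := hK.mono hU inter_subset_left
    have hc : ∀ᶠ y in 𝓝 x, mvfderiv I (χ ∘ κ) y (coordField I (χ ∘ κ) e y) = e := by
      filter_upwards [hU.mem_nhds hx] with y hy using hχU.mvfderiv_coordField hy e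
    have h0 := mvfderiv_eq_zero_of_eventuallyEq_const hc u
    have hGd' : DifferentiableAt ℝ G (κ x) :=
      (hG.contDiffAt (Metric.isOpen_ball.mem_nhds hx.2)).differentiableAt (by simp)
    have hYd : MDifferentiableAt I 𝓘(ℝ, E)
        (fun y ↦ mvfderiv I κ y (coordField I (χ ∘ κ) e y)) x :=
      ((hK'.contMDiffOn_mvfderiv_apply hY).contMDiffAt (hU.mem_nhds hx)).mdifferentiableAt
        (by simp)
    have hGκ : MDifferentiableAt I 𝓘(ℝ, E →L[ℝ] E) (G ∘ κ) x :=
      hGd'.mdifferentiableAt.comp x ((hK.contMDiffAt hx.1).mdifferentiableAt (by simp))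
    have h1 := mvfderiv_bilin hGκ hYd (ContinuousLinearMap.id ℝ (E →L[ℝ] E)) u
    have h2 : (fun y ↦ mvfderiv I (χ ∘ κ) y (coordField I (χ ∘ κ) e y)) =ᶠ[𝓝 x]
        fun y ↦ (ContinuousLinearMap.id ℝ (E →L[ℝ] E)) ((G ∘ κ) y)
          (mvfderiv I κ y (coordField I (χ ∘ κ) e y)) := by
      filter_upwards [hU.mem_nhds hx] with y hy using hdχ y hy _
    have h3 : mvfderiv I (fun y ↦ mvfderiv I (χ ∘ κ) y (coordField I (χ ∘ κ) e y)) x u = _ :=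
      congr($(h2.mfderiv_eq) u)
    have h4 := h3.symm.trans h0
    have h5 := h1.symm.trans h4
    rw [mvfderiv_comp_extChartAt hx.1 hGd', hGd _ hx.2] at h5
    rw [hdχ x hx, hK'.mvfderiv_cov hY hx, map_add, ← hΓx x hx.1, add_comm]
    exact h5.trans (map_zero _).symm

end AffineCoordinates

section SpecialCoordinates

open Set ContinuousLinearMap

variable {E : Type*} [NormedAddCommGroup E] [NormedSpace ℝ E]
  {H : Type*} [TopologicalSpace H] {I : ModelWithCorners ℝ E H} [I.Boundaryless]
  {X : Type*} [TopologicalSpace X] [ChartedSpace H X] [IsManifold I ∞ X]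

theorem eq_of_mvfderiv_eq_zero {f : X → ℝ} {x₀ : X} {ρ : ℝ}
    (hρ : Metric.ball (extChartAt I x₀ x₀) ρ ⊆ (extChartAt I x₀).target)
    (hf : ContMDiffOn I 𝓘(ℝ, ℝ) ∞ f
      ((extChartAt I x₀).source ∩ extChartAt I x₀ ⁻¹' Metric.ball (extChartAt I x₀ x₀) ρ))
    (hd : ∀ x ∈ (extChartAt I x₀).source ∩
      extChartAt I x₀ ⁻¹' Metric.ball (extChartAt I x₀ x₀) ρ, mvfderiv I f x = 0)
    {x y : X} (hx : x ∈ (extChartAt I x₀).source ∩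
      extChartAt I x₀ ⁻¹' Metric.ball (extChartAt I x₀ x₀) ρ)
    (hy : y ∈ (extChartAt I x₀).source ∩
      extChartAt I x₀ ⁻¹' Metric.ball (extChartAt I x₀ x₀) ρ) : f x = f y := by
  set κ := extChartAt I x₀ with hκ
  set B := Metric.ball (κ x₀) ρ
  have hU : IsOpen (κ.source ∩ κ ⁻¹' B) := (continuousOn_extChartAt x₀).isOpen_inter_preimage
    (isOpen_extChartAt_source x₀) Metric.isOpen_ball
  have hmaps (z : E) (hz : z ∈ B) : κ.symm z ∈ κ.source ∩ κ ⁻¹' B :=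
    ⟨κ.map_target (hρ hz), by rw [mem_preimage, κ.right_inv (hρ hz)]; exact hz⟩
  have hder (z : E) (hz : z ∈ B) : HasFDerivAt (f ∘ κ.symm) (0 : E →L[ℝ] ℝ) z := by
    have h1 : MDifferentiableAt I 𝓘(ℝ, ℝ) f (κ.symm z) :=
      (hf.contMDiffAt (hU.mem_nhds (hmaps z hz))).mdifferentiableAt (by simp)
    have h2 : MDifferentiableAt 𝓘(ℝ, E) I κ.symm z :=
      ((contMDiffOn_extChartAt_symm (n := ∞) x₀).contMDiffAt
        ((isOpen_extChartAt_target x₀).mem_nhds (hρ hz))).mdifferentiableAt (by simp)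
    have h3 := (h1.hasMFDerivAt.comp z h2.hasMFDerivAt).hasFDerivAt
    have h4 : mfderiv I 𝓘(ℝ, ℝ) f (κ.symm z) = 0 := hd _ (hmaps z hz)
    rw [h4] at h3
    exact h3
  have h := Metric.isOpen_ball.is_const_of_fderiv_eq_zero (𝕜 := ℝ) (f := f ∘ κ.symm)
    (convex_ball (κ x₀) ρ).isPreconnected
    (fun z hz ↦ (hder z hz).differentiableAt.differentiableWithinAt)
    (fun z hz ↦ (hder z hz).fderiv) hx.2 hy.2
  simpa only [Function.comp_apply, κ.left_inv hx.1, κ.left_inv hy.1] using h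

variable [FiniteDimensional ℝ E]
  {cov : CovariantDerivative I E (TangentSpace I : X → Type _)} {J : EndField I X}
  {g : BilinField I X}

/-- Special coordinates on `U`: affine coordinates `χ` in which the form `g (J ·, ·)` is the
constant form `c`, and a second map `φ` with `dφ = dχ ∘ J`. -/
structure IsSpecialCoordinateOn (J : EndField I X) (g : BilinField I X)
    (cov : CovariantDerivative I E (TangentSpace I : X → Type _)) (U : Set X) (χ φ : X → E)
    (c : E →L[ℝ] E →L[ℝ] ℝ) : Prop extends IsCoordinateOn I χ U where
  contMDiffOn_conj : ContMDiffOn I 𝓘(ℝ, E) ∞ φ U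
  mvfderiv_conj : ∀ x ∈ U, ∀ v : TangentSpace I x, mvfderiv I φ x v = mvfderiv I χ x (J x v)
  cov_coordField : ∀ x ∈ U, ∀ e, cov (coordField I χ e) x = 0
  fundForm_eq : ∀ x ∈ U, ∀ v w : TangentSpace I x,
    fundForm I J g x v w = c (mvfderiv I χ x v) (mvfderiv I χ x w)

theorem IsSpecialParaKahler.exists_isSpecialCoordinateOn [T2Space X]
    (h : IsSpecialParaKahler J g cov) (x₀ : X) :
    ∃ U χ φ c, x₀ ∈ U ∧ IsSpecialCoordinateOn J g cov U χ φ c := by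
  have hJ : IsSmoothEndField I J := h.paraKahler.paraComplex.smooth
  have hform : IsSmoothBilinField I (fundForm I J g) := h.paraKahler.metric.smooth.comp_endField hJ
  obtain ⟨ρ, hρ, hball, χ, φ, hχ, hφ, hχφ, hpar⟩ :=
    exists_affine_coordinates_of_flat hJ h.smooth_cov h.torsionFree h.flat h.symmetric x₀
  set U := (extChartAt I x₀).source ∩ extChartAt I x₀ ⁻¹' Metric.ball (extChartAt I x₀ x₀) ρ
  have hx₀ : x₀ ∈ U := ⟨mem_extChartAt_source x₀, Metric.mem_ball_self hρ⟩
  let L : E →L[ℝ] E := (mvfderiv I χ x₀).inverse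
  let b : E →L[ℝ] E →L[ℝ] ℝ := fundForm I J g x₀
  refine ⟨U, χ, φ, ContinuousLinearMap.bilinearComp b L L, hx₀,
    ⟨hχ, hφ, hχφ, hpar, fun x hx v w ↦ ?_⟩⟩
  have hX (e : E) := hχ.isSmoothVectorFieldOn_coordField e
  have h1 := eq_of_mvfderiv_eq_zero hball ((hX (mvfderiv I χ x v)).bilinField_apply
    (hX (mvfderiv I χ x w)) hform) (fun y hy ↦ ?_) hx hx₀
  · rw [hχ.coordField_mvfderiv hx, hχ.coordField_mvfderiv hx] at h1
    exact h1
  · ext u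
    have h2 := h.symplectic.apply_of_smoothOn hχ.isOpen (hX (mvfderiv I χ y u))
      (hX (mvfderiv I χ x v)) (hX (mvfderiv I χ x w)) hy
    rw [hpar y hy, hpar y hy, hχ.coordField_mvfderiv hy] at h2
    simpa using h2

theorem IsSpecialCoordinateOn.exists_isConstantIn {U : Set X} {χ φ : X → E}
    {c : E →L[ℝ] E →L[ℝ] ℝ} (h : IsSpecialCoordinateOn J g cov U χ φ c)
    (hJ : ∀ (x : X) (v : TangentSpace I x), J x (J x v) = v) {x₀ : X} (hx₀ : x₀ ∈ U) :
    ∃ V Ψ J₀, x₀ ∈ V ∧ IsConstantIn J V Ψ J₀ := by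
  let J₀ : E →L[ℝ] E := mvfderiv I χ x₀ ∘L J x₀ ∘L (mvfderiv I χ x₀).inverse
  let Ψ : X → E := fun x ↦ (1 / 2 : ℝ) • (χ x + J₀ (φ x))
  have hΨ : ContMDiffOn I 𝓘(ℝ, E) ∞ Ψ U :=
    ContMDiff.comp_contMDiffOn (f := fun x ↦ (χ x, φ x))
      (ContinuousLinearMap.contMDiff ((1 / 2 : ℝ) •
        (ContinuousLinearMap.fst ℝ E E + J₀ ∘L ContinuousLinearMap.snd ℝ E E)))
      (h.contMDiffOn.prodMk_space h.contMDiffOn_conj)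
  have hd (x : X) (hx : x ∈ U) (v : TangentSpace I x) : mvfderiv I Ψ x v =
      (1 / 2 : ℝ) • (mvfderiv I χ x v + J₀ (mvfderiv I χ x (J x v))) := by
    have h1 := (h.contMDiffOn.contMDiffAt (h.isOpen.mem_nhds hx)).mdifferentiableAt
      (by simp : (∞ : WithTop ℕ∞) ≠ 0)
    have h2 := (h.contMDiffOn_conj.contMDiffAt (h.isOpen.mem_nhds hx)).mdifferentiableAt
      (by simp : (∞ : WithTop ℕ∞) ≠ 0)
    have h3 := mvfderiv_clm_comp (hasMFDerivAt_prodMk_space h1 h2).mdifferentiableAt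
      ((1 / 2 : ℝ) • (ContinuousLinearMap.fst ℝ E E + J₀ ∘L ContinuousLinearMap.snd ℝ E E)) v
    rw [mvfderiv_prodMk h1 h2, h.mvfderiv_conj x hx] at h3
    exact h3
  have h0 : mvfderiv I Ψ x₀ = mvfderiv I χ x₀ := by
    ext v
    rw [hd x₀ hx₀]
    have h1 : J₀ (mvfderiv I χ x₀ (J x₀ v)) = mvfderiv I χ x₀ v :=
      congrArg (mvfderiv I χ x₀)
        ((congrArg (J x₀) (h.toIsCoordinateOn.coordField_mvfderiv hx₀ (J x₀ v))).trans (hJ x₀ v))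
    rw [h1]
    module
  obtain ⟨ψ, hψ, hx, hsub, hψΨ⟩ := exists_chart_of_isInvertible_mfderiv h.isOpen hx₀ hΨ
    (by rw [h0]; exact h.isInvertible x₀ hx₀)
  refine ⟨ψ.source, Ψ, J₀, hx, ⟨⟨ψ.open_source, hΨ.mono hsub, fun x hx ↦ ?_⟩, fun x hx v ↦ ?_⟩⟩
  · have h1 := isInvertible_mfderiv_extend hψ hx
    have h2 : (ψ.extend I : X → E) =ᶠ[𝓝 x] Ψ := by
      filter_upwards [ψ.open_source.mem_nhds hx] using hψΨ
    have h3 : mvfderiv I (ψ.extend I) x = mvfderiv I Ψ x := h2.mfderiv_eq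
    rwa [h3] at h1
  · have hJJ (e : E) : J₀ (J₀ e) = e := by
      have h1 := h.toIsCoordinateOn.coordField_mvfderiv hx₀ (J x₀ (coordField I χ e x₀))
      have h2 : J₀ (J₀ e) = mvfderiv I χ x₀ (J x₀ (J x₀ (coordField I χ e x₀))) :=
        congrArg (fun w ↦ mvfderiv I χ x₀ (J x₀ w)) h1
      rw [h2, hJ, h.mvfderiv_coordField hx₀]
    rw [hd x (hsub hx), hd x (hsub hx), hJ, map_smul, map_add, hJJ, add_comm]

/-- In coordinates in which `J` is constant, `∇_v (J Z) = ∇_{J v} Z` for coordinate fields `Z`. -/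
theorem IsConstantIn.cov_coordField [T2Space X] {U : Set X} {Ψ : X → E} {J₀ : E →L[ℝ] E}
    (h : IsConstantIn J U Ψ J₀) (hJ : IsSmoothEndField I J) (htor : cov.torsion = 0)
    (hsymm : HasSymmetricDeriv cov J) {x : X} (hx : x ∈ U) (e : E) (v : TangentSpace I x) :
    cov (coordField I Ψ (J₀ e)) x v = cov (coordField I Ψ e) x (J x v) := by
  have hX (e : E) := h.isSmoothVectorFieldOn_coordField e
  have hJX (e : E) (y : X) (hy : y ∈ U) : coordField I Ψ (J₀ e) y = J y (coordField I Ψ e y) := by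
    apply h.injective hy
    rw [h.mvfderiv_coordField hy, h.mvfderiv_apply y hy, h.mvfderiv_coordField hy]
  have hcov (e : E) : cov (fun y ↦ J y (coordField I Ψ e y)) x = cov (coordField I Ψ (J₀ e)) x := by
    refine cov.isCovariantDerivativeOn.congr_of_eventuallyEq
      (((hX e).endField_apply hJ).mdifferentiableAt h.isOpen hx)
      ((hX (J₀ e)).mdifferentiableAt h.isOpen hx) Filter.univ_mem ?_
    filter_upwards [h.isOpen.mem_nhds hx] with y hy using (hJX e y hy).symm
  have h1 := hsymm.apply_of_smoothOn hJ h.isOpen (hX (mvfderiv I Ψ x v)) (hX e) hx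
  rw [h.cov_coordField_symm htor hx, sub_left_inj, hcov, hcov,
    h.cov_coordField_symm htor hx e (J₀ (mvfderiv I Ψ x v)), hJX _ x hx,
    h.coordField_mvfderiv hx] at h1
  exact h1

end SpecialCoordinates

section CotangentCoordinates

open Set ContinuousLinearMap

theorem ContinuousLinearMap.isInvertible_of_injective {V : Type*} [NormedAddCommGroup V]
    [NormedSpace ℝ V] [FiniteDimensional ℝ V] {f : V →L[ℝ] V} (hf : Function.Injective f) :
    f.IsInvertible :=
  ⟨(LinearEquiv.ofInjectiveEndo f.toLinearMap hf).toContinuousLinearEquiv, by ext; rfl⟩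

variable {E : Type*} [NormedAddCommGroup E] [NormedSpace ℝ E]
  {H : Type*} [TopologicalSpace H] {I : ModelWithCorners ℝ E H}
  {X : Type*} [TopologicalSpace X] [ChartedSpace H X] [IsManifold I ∞ X]
  {V : Type*} [NormedAddCommGroup V] [NormedSpace ℝ V]
  {F f : X → E} {U : Set X}

theorem mvfderiv_comp_proj {f : X → V} {ξ : CotangentBundle I X}
    (hf : MDifferentiableAt I 𝓘(ℝ, V) f ξ.proj) (w : TangentSpace (cotModel I) ξ) :
    mvfderiv (cotModel I) (fun η : CotangentBundle I X ↦ f η.proj) ξ w =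
      mvfderiv I f ξ.proj (cotProjDeriv ξ w) := by
  have hp : MDifferentiableAt (cotModel I) I (TotalSpace.proj : CotangentBundle I X → X) ξ :=
    mdifferentiableAt_proj _
  exact congr($(mfderiv_comp ξ hf hp) w)

/-- The fibrewise linear function defined by a smooth vector field is smooth. -/
theorem contMDiffAt_cotEval {Y : Π x : X, TangentSpace I x} {ξ : CotangentBundle I X}
    (hY : ContMDiffAt I I.tangent ∞ (fun p ↦ (⟨p, Y p⟩ : TangentBundle I X)) ξ.proj) :
    ContMDiffAt (cotModel I) 𝓘(ℝ, ℝ) ∞ (cotEval Y) ξ := by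
  have h1 : ContMDiffAt (cotModel I) (I.prod 𝓘(ℝ, E →L[ℝ] ℝ)) ∞
      (fun η : CotangentBundle I X ↦ TotalSpace.mk' (E →L[ℝ] ℝ)
        (E := fun p : X ↦ TangentSpace I p →L[ℝ] Bundle.Trivial X ℝ p) η.proj η.snd) ξ :=
    contMDiffAt_id
  have hp : ContMDiffAt (cotModel I) I ∞ (TotalSpace.proj : CotangentBundle I X → X) ξ :=
    contMDiffAt_proj _
  have h2 : ContMDiffAt (cotModel I) (I.prod 𝓘(ℝ, E)) ∞
      (fun η : CotangentBundle I X ↦ TotalSpace.mk' E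
        (E := fun p : X ↦ TangentSpace I p) η.proj (Y η.proj)) ξ :=
    ContMDiffAt.comp ξ hY hp
  have h3 := ContMDiffAt.clm_bundle_apply (F₁ := E) (F₂ := ℝ)
    (E₁ := fun p : X ↦ TangentSpace I p) (E₂ := Bundle.Trivial X ℝ)
    (b := fun η : CotangentBundle I X ↦ η.proj) (ϕ := fun η ↦ η.snd)
    (v := fun η ↦ Y η.proj) h1 h2
  rw [contMDiffAt_totalSpace] at h3
  exact h3.2

variable (I) in
/-- The fibre coordinates of the cotangent bundle dual to the coordinates `F`. -/
def momentum (F : X → E) (ξ : CotangentBundle I X) : E →L[ℝ] ℝ :=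
  ξ.snd ∘L (mvfderiv I F ξ.proj).inverse

theorem contMDiffAt_clm_of_apply [FiniteDimensional ℝ E] {Z H' N : Type*} [NormedAddCommGroup Z]
    [NormedSpace ℝ Z] [TopologicalSpace H'] {I' : ModelWithCorners ℝ Z H'} [TopologicalSpace N]
    [ChartedSpace H' N] {q : N → E →L[ℝ] ℝ} {ξ : N}
    (hq : ∀ e, ContMDiffAt I' 𝓘(ℝ, ℝ) ∞ (fun η ↦ q η e) ξ) :
    ContMDiffAt I' 𝓘(ℝ, E →L[ℝ] ℝ) ∞ q ξ := by
  let b := Module.finBasis ℝ E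
  let T : (Fin (Module.finrank ℝ E) → ℝ) →L[ℝ] (E →L[ℝ] ℝ) :=
    ∑ i, (ContinuousLinearMap.proj i).smulRight (LinearMap.toContinuousLinearMap (b.coord i))
  have h1 : ContMDiffAt I' 𝓘(ℝ, Fin (Module.finrank ℝ E) → ℝ) ∞ (fun η i ↦ q η (b i)) ξ :=
    contMDiffAt_pi_space.2 fun i ↦ hq (b i)
  have h2 := T.contMDiff.contMDiffAt.comp ξ h1
  refine h2.congr_of_eventuallyEq (Filter.Eventually.of_forall fun η ↦ ?_)
  refine ContinuousLinearMap.coe_injective (b.ext fun j ↦ ?_)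
  simp [T, sum_apply, Finsupp.single_apply]

variable [FiniteDimensional ℝ E]

theorem IsCoordinateOn.contMDiffAt_momentum (h : IsCoordinateOn I F U) {ξ : CotangentBundle I X}
    (hξ : ξ.proj ∈ U) : ContMDiffAt (cotModel I) 𝓘(ℝ, E →L[ℝ] ℝ) ∞ (momentum I F) ξ :=
  contMDiffAt_clm_of_apply fun e ↦
    contMDiffAt_cotEval ((h.isSmoothVectorFieldOn_coordField e).contMDiffAt h.isOpen hξ)

theorem IsCoordinateOn.mvfderiv_momentum
    (cov : CovariantDerivative I E (TangentSpace I : X → Type _)) (h : IsCoordinateOn I F U)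
    {ξ : CotangentBundle I X} (hξ : ξ.proj ∈ U) (w : TangentSpace (cotModel I) ξ) (e : E) :
    mvfderiv (cotModel I) (momentum I F) ξ w e = connector cov ξ w (coordField I F e ξ.proj) +
      ξ.snd (cov (coordField I F e) ξ.proj (cotProjDeriv ξ w)) := by
  rw [connector_apply cov ((h.isSmoothVectorFieldOn_coordField e).mdifferentiableAt h.isOpen hξ),
    sub_add_cancel]
  exact (mvfderiv_clm_comp ((h.contMDiffAt_momentum hξ).mdifferentiableAt (by simp))
    (ContinuousLinearMap.apply ℝ ℝ e) w).symm

/-- Coordinates of the cotangent bundle: base coordinates `f` and the fibre coordinates dual to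
coordinates `F`. -/
def cotCoord (f F : X → E) (ξ : CotangentBundle I X) : E × (E →L[ℝ] ℝ) :=
  (f ξ.proj, momentum I F ξ)

theorem IsCoordinateOn.mvfderiv_cotCoord (hf : IsCoordinateOn I f U) (hF : IsCoordinateOn I F U)
    {ξ : CotangentBundle I X} (hξ : ξ.proj ∈ U) (w : TangentSpace (cotModel I) ξ) :
    mvfderiv (cotModel I) (cotCoord f F) ξ w =
      (mvfderiv I f ξ.proj (cotProjDeriv ξ w), mvfderiv (cotModel I) (momentum I F) ξ w) := by
  have h1 : MDifferentiableAt I 𝓘(ℝ, E) f ξ.proj :=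
    (hf.contMDiffAt hξ).mdifferentiableAt (by simp)
  have hp : MDifferentiableAt (cotModel I) I (TotalSpace.proj : CotangentBundle I X → X) ξ :=
    mdifferentiableAt_proj _
  rw [← mvfderiv_comp_proj h1]
  exact mvfderiv_prodMk (h1.comp ξ hp) ((hF.contMDiffAt_momentum hξ).mdifferentiableAt (by simp)) w

theorem IsCoordinateOn.cotCoord (cov : CovariantDerivative I E (TangentSpace I : X → Type _))
    (hf : IsCoordinateOn I f U) (hF : IsCoordinateOn I F U) :
    IsCoordinateOn (cotModel I) (cotCoord f F)
      ((TotalSpace.proj : CotangentBundle I X → X) ⁻¹' U) := by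
  refine ⟨hf.isOpen.preimage (FiberBundle.continuous_proj _ _), fun ξ hξ ↦ ?_, fun ξ hξ ↦ ?_⟩
  · have hp : ContMDiffAt (cotModel I) I ∞ (TotalSpace.proj : CotangentBundle I X → X) ξ :=
      contMDiffAt_proj _
    exact (((hf.contMDiffAt hξ).comp ξ hp).prodMk_space
      (hF.contMDiffAt_momentum hξ)).contMDiffWithinAt
  · refine isInvertible_of_injective (V := E × (E →L[ℝ] ℝ)) ?_
    refine (injective_iff_map_eq_zero
      (mvfderiv (cotModel I) (_root_.cotCoord f F) ξ)).2 fun w hw ↦ ?_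
    rw [hf.mvfderiv_cotCoord hF hξ] at hw
    have h1 : cotProjDeriv ξ w = 0 :=
      hf.injective hξ ((congrArg Prod.fst hw).trans (map_zero _).symm)
    refine eq_zero_of_connector cov h1 (ContinuousLinearMap.ext fun v ↦ ?_)
    have h2 := hF.mvfderiv_momentum cov hξ w (mvfderiv I F ξ.proj v)
    have h3 : mvfderiv (cotModel I) (momentum I F) ξ w = 0 := congrArg Prod.snd hw
    rw [h1, map_zero, map_zero, add_zero, hF.coordField_mvfderiv hξ, h3] at h2
    exact h2.symm

end CotangentCoordinates

section Anticommuting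

open Set ContinuousLinearMap

variable {E : Type*} [NormedAddCommGroup E] [NormedSpace ℝ E]
  {H : Type*} [TopologicalSpace H] {I : ModelWithCorners ℝ E H}
  {X : Type*} [TopologicalSpace X] [ChartedSpace H X]

/-- An involution exchanges the eigenspaces of an endomorphism with which it anticommutes. -/
theorem finrank_eigenPlus_eq_of_anticomm {A B : EndField I X} {x : X}
    (hB : ∀ v : TangentSpace I x, B x (B x v) = v)
    (hAB : ∀ v : TangentSpace I x, A x (B x v) = -B x (A x v)) :
    Module.finrank ℝ (eigenPlus I A x) = Module.finrank ℝ (eigenMinus I A x) := by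
  let e : TangentSpace I x ≃ₗ[ℝ] TangentSpace I x := LinearEquiv.ofInvolutive (B x).toLinearMap hB
  have hp (v : TangentSpace I x) : v ∈ eigenPlus I A x ↔ v - A x v = 0 := Iff.rfl
  have hm (v : TangentSpace I x) : v ∈ eigenMinus I A x ↔ v + A x v = 0 := Iff.rfl
  have h : (eigenPlus I A x).map e.toLinearMap = eigenMinus I A x := by
    ext v
    rw [hm]
    refine ⟨?_, fun hv ↦ ⟨B x v, ?_, hB v⟩⟩
    · rintro ⟨u, hu, rfl⟩
      have hu' := (hp u).1 hu
      change B x u + A x (B x u) = 0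
      rw [hAB, ← sub_eq_add_neg, ← map_sub, hu', map_zero]
    · refine (hp _).2 ?_
      rw [hAB, sub_neg_eq_add, ← map_add, hv, map_zero]
  rw [← h]
  exact (LinearEquiv.finrank_map_eq e _).symm

theorem isAlmostParaComplex_of_anticomm [IsManifold I ∞ X] {A B : EndField I X}
    (hAs : IsSmoothEndField I A) (hA : ∀ (x : X) (v : TangentSpace I x), A x (A x v) = v)
    (hB : ∀ (x : X) (v : TangentSpace I x), B x (B x v) = v)
    (hAB : ∀ (x : X) (v : TangentSpace I x), A x (B x v) = -B x (A x v))
    (hne : ∃ (x : X) (v : TangentSpace I x), v ≠ 0) : IsAlmostParaComplex I A where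
  smooth := hAs
  ne_id := by
    rintro rfl
    obtain ⟨x, v, hv⟩ := hne
    refine hv ?_
    have h1 (u : TangentSpace I x) : B x u = 0 := by
      have h2 : B x u + B x u = 0 := eq_neg_iff_add_eq_zero.1 (hAB x u)
      rw [← one_smul ℝ (B x u), ← add_halves (1 : ℝ), add_smul, ← smul_add, h2, smul_zero]
    rw [← hB x v, h1]
  involution := hA
  rank_eq _ := finrank_eigenPlus_eq_of_anticomm (hB _) (hAB _)

/-- An endomorphism field is skew for a symmetric form if its fundamental form is antisymmetric. -/
theorem isSkewFor_of_fundForm_antisymm {A : EndField I X} {g : BilinField I X}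
    (hg : ∀ (x : X) (v w : TangentSpace I x), g x v w = g x w v)
    (hA : ∀ (x : X) (v w : TangentSpace I x), fundForm I A g x v w = -fundForm I A g x w v) :
    IsSkewFor I A g := fun x v w ↦
  (hA x v w).trans (congrArg Neg.neg (hg x (A x w) v))

end Anticommuting

section FibreAlgebra

open Set ContinuousLinearMap

theorem ContinuousLinearMap.isInvertible_of_nondegenerate {V : Type*} [NormedAddCommGroup V]
    [NormedSpace ℝ V] [FiniteDimensional ℝ V] {b : V →L[ℝ] V →L[ℝ] ℝ}
    (hb : ∀ v, (∀ w, b v w = 0) → v = 0) : b.IsInvertible := by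
  have hfin : Module.finrank ℝ V = Module.finrank ℝ (V →L[ℝ] ℝ) := by
    rw [← (LinearMap.toContinuousLinearMap : (V →ₗ[ℝ] ℝ) ≃ₗ[ℝ] (V →L[ℝ] ℝ)).finrank_eq]
    exact (Subspace.dual_finrank_eq (K := ℝ) (V := V)).symm
  have hinj : Function.Injective b.toLinearMap := by
    refine (injective_iff_map_eq_zero b.toLinearMap).2 fun v hv ↦ hb v fun w ↦ ?_
    have : b v = 0 := hv
    rw [this, zero_apply]
  exact ⟨(LinearEquiv.ofInjectiveOfFinrankEq b.toLinearMap hinj hfin).toContinuousLinearEquiv, by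
    ext; rfl⟩

variable {E : Type*} [NormedAddCommGroup E] [NormedSpace ℝ E]
  {H : Type*} [TopologicalSpace H] {I : ModelWithCorners ℝ E H}
  {X : Type*} [TopologicalSpace X] [ChartedSpace H X] [IsManifold I ∞ X]
  {J : EndField I X} {g : BilinField I X}

theorem IsPseudoRiemannian.isInvertible [FiniteDimensional ℝ E]
    (hg : IsPseudoRiemannian I g) (x : X) :
    (g x).IsInvertible :=
  isInvertible_of_nondegenerate (V := E) (b := g x) (hg.nondegenerate x)

namespace IsParaKahler

variable {x : X}

theorem sq_apply (h : IsParaKahler I J g) (v : TangentSpace I x) : J x (J x v) = v :=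
  h.paraComplex.involution x v

theorem fundForm_nondegenerate (h : IsParaKahler I J g) (v : TangentSpace I x)
    (hv : ∀ w, fundForm I J g x v w = 0) : v = 0 := by
  rw [← h.sq_apply v, h.metric.nondegenerate x (J x v) hv, map_zero]

theorem fundForm_antisymm (h : IsParaKahler I J g) (v w : TangentSpace I x) :
    fundForm I J g x v w = -fundForm I J g x w v := by
  have := h.skew x v w
  rw [h.metric.symm x v] at this
  exact this

theorem fundForm_apply_right (h : IsParaKahler I J g) (v w : TangentSpace I x) :
    fundForm I J g x v (J x w) = -fundForm I J g x (J x v) w :=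
  neg_eq_iff_eq_neg.1 (h.skew x (J x v) w).symm

variable [FiniteDimensional ℝ E]

theorem isInvertible_fundForm (h : IsParaKahler I J g) (x : X) : (fundForm I J g x).IsInvertible :=
  isInvertible_of_nondegenerate (V := E) (b := fundForm I J g x)
    (h.fundForm_nondegenerate (x := x))

theorem fundForm_inverse_apply (h : IsParaKahler I J g)
    (a : TangentSpace I x →L[ℝ] ℝ) (w : TangentSpace I x) :
    fundForm I J g x ((fundForm I J g x).inverse a) w = a w :=
  congr($((h.isInvertible_fundForm x).self_apply_inverse a) w)

theorem metric_inverse_apply (h : IsParaKahler I J g)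
    (a : TangentSpace I x →L[ℝ] ℝ) (w : TangentSpace I x) :
    g x ((g x).inverse a) w = a w :=
  congr($((h.metric.isInvertible x).self_apply_inverse a) w)

theorem metric_inverse_eq (h : IsParaKahler I J g)
    {a : TangentSpace I x →L[ℝ] ℝ} {v : TangentSpace I x}
    (hv : ∀ w, g x v w = a w) : (g x).inverse a = v := by
  rw [← (h.metric.isInvertible x).inverse_apply_self v]
  exact congrArg _ (ContinuousLinearMap.ext hv).symm

theorem fundForm_inverse_eq (h : IsParaKahler I J g)
    {a : TangentSpace I x →L[ℝ] ℝ} {v : TangentSpace I x}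
    (hv : ∀ w, fundForm I J g x v w = a w) : (fundForm I J g x).inverse a = v := by
  rw [← (h.isInvertible_fundForm x).inverse_apply_self v]
  exact congrArg _ (ContinuousLinearMap.ext hv).symm

theorem metric_inverse (h : IsParaKahler I J g) (a : TangentSpace I x →L[ℝ] ℝ) :
    (g x).inverse a = J x ((fundForm I J g x).inverse a) :=
  h.metric_inverse_eq fun w ↦ h.fundForm_inverse_apply a w

theorem fundForm_inverse_comp (h : IsParaKahler I J g) (a : TangentSpace I x →L[ℝ] ℝ) :
    (fundForm I J g x).inverse (a ∘L J x) = -J x ((fundForm I J g x).inverse a) := by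
  refine h.fundForm_inverse_eq fun w ↦ ?_
  rw [map_neg, neg_apply, ← h.fundForm_apply_right, h.fundForm_inverse_apply, comp_apply]

theorem metric_inverse_comp (h : IsParaKahler I J g) (a : TangentSpace I x →L[ℝ] ℝ) :
    (g x).inverse (a ∘L J x) = -(fundForm I J g x).inverse a := by
  rw [h.metric_inverse, h.fundForm_inverse_comp, map_neg, h.sq_apply]

theorem metric_inverse_fundForm (h : IsParaKahler I J g) (v : TangentSpace I x) :
    (g x).inverse (fundForm I J g x v) = J x v :=
  h.metric_inverse_eq fun _ ↦ rfl

end IsParaKahler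

variable [FiniteDimensional ℝ E]
  {cov : CovariantDerivative I E (TangentSpace I : X → Type _)} {ξ : CotangentBundle I X}

theorem splitting_cotJNabla (w : TangentSpace (cotModel I) ξ) :
    splitting cov ξ (cotJNabla cov J ξ w) =
      (J ξ.proj (cotProjDeriv ξ w), connector cov ξ w ∘L J ξ.proj) :=
  (splitting cov ξ).apply_symm_apply _

theorem splitting_cotJOmega {b : BilinField I X} (w : TangentSpace (cotModel I) ξ) :
    splitting cov ξ (cotJOmega cov b ξ w) =
      ((b ξ.proj).inverse (connector cov ξ w), b ξ.proj (cotProjDeriv ξ w)) :=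
  (splitting cov ξ).apply_symm_apply _

theorem cotProjDeriv_cotJNabla (w : TangentSpace (cotModel I) ξ) :
    cotProjDeriv ξ (cotJNabla cov J ξ w) = J ξ.proj (cotProjDeriv ξ w) :=
  congrArg Prod.fst (splitting_cotJNabla w)

theorem connector_cotJNabla (w : TangentSpace (cotModel I) ξ) :
    connector cov ξ (cotJNabla cov J ξ w) = connector cov ξ w ∘L J ξ.proj :=
  congrArg Prod.snd (splitting_cotJNabla w)

theorem cotProjDeriv_cotJOmega {b : BilinField I X} (w : TangentSpace (cotModel I) ξ) :
    cotProjDeriv ξ (cotJOmega cov b ξ w) = (b ξ.proj).inverse (connector cov ξ w) :=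
  congrArg Prod.fst (splitting_cotJOmega w)

theorem connector_cotJOmega {b : BilinField I X} (w : TangentSpace (cotModel I) ξ) :
    connector cov ξ (cotJOmega cov b ξ w) = b ξ.proj (cotProjDeriv ξ w) :=
  congrArg Prod.snd (splitting_cotJOmega w)

theorem cotMetric_apply (w w' : TangentSpace (cotModel I) ξ) : cotMetric cov g ξ w w' =
    g ξ.proj (cotProjDeriv ξ w) (cotProjDeriv ξ w') +
      connector cov ξ w' ((g ξ.proj).inverse (connector cov ξ w)) := rfl

theorem eq_of_cotProjDeriv_of_connector {w w' : TangentSpace (cotModel I) ξ}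
    (h₁ : cotProjDeriv ξ w = cotProjDeriv ξ w') (h₂ : connector cov ξ w = connector cov ξ w') :
    w = w' :=
  (splitting cov ξ).injective (Prod.ext h₁ h₂)

theorem exists_cotProjDeriv_connector (cov : CovariantDerivative I E (TangentSpace I : X → Type _))
    (v : TangentSpace I ξ.proj) (a : TangentSpace I ξ.proj →L[ℝ] ℝ) :
    ∃ w : TangentSpace (cotModel I) ξ, cotProjDeriv ξ w = v ∧ connector cov ξ w = a := by
  have h := (splitting cov ξ).apply_symm_apply (v, a)
  exact ⟨_, congrArg Prod.fst h, congrArg Prod.snd h⟩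

/-- The product of the two para-complex structures of the cotangent bundle. -/
def cotJProd (cov : CovariantDerivative I E (TangentSpace I : X → Type _)) (J : EndField I X)
    (g : BilinField I X) : EndField (cotModel I) (CotangentBundle I X) := fun ξ ↦
  cotJNabla cov J ξ ∘L cotJOmega cov (fundForm I J g) ξ

theorem cotProjDeriv_cotJProd (w : TangentSpace (cotModel I) ξ) :
    cotProjDeriv ξ (cotJProd cov J g ξ w) =
      J ξ.proj ((fundForm I J g ξ.proj).inverse (connector cov ξ w)) := by
  rw [cotJProd, comp_apply, cotProjDeriv_cotJNabla, cotProjDeriv_cotJOmega]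

theorem connector_cotJProd (w : TangentSpace (cotModel I) ξ) :
    connector cov ξ (cotJProd cov J g ξ w) =
      fundForm I J g ξ.proj (cotProjDeriv ξ w) ∘L J ξ.proj := by
  rw [cotJProd, comp_apply, connector_cotJNabla, connector_cotJOmega]

namespace IsParaKahler

theorem cotJNabla_sq (h : IsParaKahler I J g) (w : TangentSpace (cotModel I) ξ) :
    cotJNabla cov J ξ (cotJNabla cov J ξ w) = w := by
  refine eq_of_cotProjDeriv_of_connector (cov := cov) ?_ (ContinuousLinearMap.ext fun v ↦ ?_)
  · rw [cotProjDeriv_cotJNabla, cotProjDeriv_cotJNabla, h.sq_apply]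
  · rw [connector_cotJNabla, connector_cotJNabla, comp_apply, comp_apply, h.sq_apply]

theorem cotJOmega_sq (h : IsParaKahler I J g) (w : TangentSpace (cotModel I) ξ) :
    cotJOmega cov (fundForm I J g) ξ (cotJOmega cov (fundForm I J g) ξ w) = w := by
  refine eq_of_cotProjDeriv_of_connector (cov := cov) ?_ (ContinuousLinearMap.ext fun v ↦ ?_)
  · rw [cotProjDeriv_cotJOmega, connector_cotJOmega]
    exact h.fundForm_inverse_eq fun _ ↦ rfl
  · rw [connector_cotJOmega, cotProjDeriv_cotJOmega, h.fundForm_inverse_apply]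

theorem cotJNabla_cotJOmega (h : IsParaKahler I J g) (w : TangentSpace (cotModel I) ξ) :
    cotJNabla cov J ξ (cotJOmega cov (fundForm I J g) ξ w) =
      -cotJOmega cov (fundForm I J g) ξ (cotJNabla cov J ξ w) := by
  refine eq_of_cotProjDeriv_of_connector (cov := cov) ?_ (ContinuousLinearMap.ext fun v ↦ ?_)
  · rw [(cotProjDeriv ξ).map_neg, cotProjDeriv_cotJNabla, cotProjDeriv_cotJOmega,
      cotProjDeriv_cotJOmega, connector_cotJNabla, h.fundForm_inverse_comp, neg_neg]
  · rw [(connector cov ξ).map_neg, connector_cotJNabla, connector_cotJOmega, connector_cotJOmega,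
      cotProjDeriv_cotJNabla, comp_apply]
    exact h.fundForm_apply_right _ _

theorem fundForm_cotJNabla (h : IsParaKahler I J g) (w w' : TangentSpace (cotModel I) ξ) :
    fundForm (cotModel I) (cotJNabla cov J) (cotMetric cov g) ξ w w' =
      fundForm I J g ξ.proj (cotProjDeriv ξ w) (cotProjDeriv ξ w') -
        connector cov ξ w' ((fundForm I J g ξ.proj).inverse (connector cov ξ w)) := by
  change cotMetric cov g ξ (cotJNabla cov J ξ w) w' = _
  rw [cotMetric_apply, cotProjDeriv_cotJNabla, connector_cotJNabla, h.metric_inverse_comp, map_neg,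
    ← sub_eq_add_neg]
  rfl

theorem fundForm_cotJOmega (h : IsParaKahler I J g) (w w' : TangentSpace (cotModel I) ξ) :
    fundForm (cotModel I) (cotJOmega cov (fundForm I J g)) (cotMetric cov g) ξ w w' =
      connector cov ξ w' (J ξ.proj (cotProjDeriv ξ w)) -
        connector cov ξ w (J ξ.proj (cotProjDeriv ξ w')) := by
  change cotMetric cov g ξ (cotJOmega cov (fundForm I J g) ξ w) w' = _
  rw [cotMetric_apply, cotProjDeriv_cotJOmega, connector_cotJOmega, h.metric_inverse_fundForm,
    sub_eq_add_neg, add_comm]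
  congr 1
  have h1 := h.metric_inverse_apply (connector cov ξ w) (J ξ.proj (cotProjDeriv ξ w'))
  rw [h.metric_inverse, h.skew, h.sq_apply] at h1
  rw [← h1, neg_neg]

theorem fundForm_cotJProd (h : IsParaKahler I J g) (w w' : TangentSpace (cotModel I) ξ) :
    fundForm (cotModel I) (cotJProd cov J g) (cotMetric cov g) ξ w w' =
      connector cov ξ w (cotProjDeriv ξ w') - connector cov ξ w' (cotProjDeriv ξ w) := by
  change cotMetric cov g ξ (cotJProd cov J g ξ w) w' = _
  rw [cotMetric_apply, cotProjDeriv_cotJProd, connector_cotJProd, ← h.metric_inverse,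
    h.metric_inverse_apply, h.metric_inverse_comp, map_neg, ← sub_eq_add_neg]
  congr 2
  exact h.fundForm_inverse_eq fun _ ↦ rfl

theorem cotMetric_symm (h : IsParaKahler I J g) (w w' : TangentSpace (cotModel I) ξ) :
    cotMetric cov g ξ w w' = cotMetric cov g ξ w' w := by
  rw [cotMetric_apply, cotMetric_apply, h.metric.symm _ (cotProjDeriv ξ w),
    ← h.metric_inverse_apply (connector cov ξ w), h.metric.symm _ _ ((g ξ.proj).inverse _),
    h.metric_inverse_apply]

theorem cotMetric_nondegenerate (h : IsParaKahler I J g) (w : TangentSpace (cotModel I) ξ)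
    (hw : ∀ w', cotMetric cov g ξ w w' = 0) : w = 0 := by
  refine eq_zero_of_connector cov (h.metric.nondegenerate _ _ fun v ↦ ?_) ?_
  · obtain ⟨w', h₁, h₂⟩ := exists_cotProjDeriv_connector cov (ξ := ξ) v 0
    simpa [cotMetric_apply, h₁, h₂] using hw w'
  · ext v
    obtain ⟨w', h₁, h₂⟩ := exists_cotProjDeriv_connector cov (ξ := ξ) 0 (g ξ.proj v)
    have h3 := hw w'
    rw [cotMetric_apply, h₁, h₂, map_zero, zero_add, h.metric.symm, h.metric_inverse_apply] at h3
    exact h3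

end IsParaKahler

end FibreAlgebra

section CotangentConstant

open Set ContinuousLinearMap

variable {E : Type*} [NormedAddCommGroup E] [NormedSpace ℝ E]
  {H : Type*} [TopologicalSpace H] {I : ModelWithCorners ℝ E H}
  {X : Type*} [TopologicalSpace X] [ChartedSpace H X] [IsManifold I ∞ X]
  {J : EndField I X} {g : BilinField I X}
  {cov : CovariantDerivative I E (TangentSpace I : X → Type _)}
  {U : Set X} {χ φ : X → E} {c : E →L[ℝ] E →L[ℝ] ℝ}

namespace IsSpecialCoordinateOn

theorem form_mvfderiv (h : IsSpecialCoordinateOn J g cov U χ φ c) {x : X} (hx : x ∈ U)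
    (v : TangentSpace I x) (e : E) :
    c (mvfderiv I χ x v) e = fundForm I J g x v (coordField I χ e x) := by
  rw [h.fundForm_eq x hx, h.mvfderiv_coordField hx]

theorem form_antisymm (h : IsSpecialCoordinateOn J g cov U χ φ c) (hJ : IsParaKahler I J g)
    {x : X} (hx : x ∈ U) (a b : E) : c a b = -c b a := by
  have h1 := hJ.fundForm_antisymm (coordField I χ a x) (coordField I χ b x)
  rwa [h.fundForm_eq x hx, h.fundForm_eq x hx, h.mvfderiv_coordField hx,
    h.mvfderiv_coordField hx] at h1

end IsSpecialCoordinateOn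

variable [FiniteDimensional ℝ E]

/-- The endomorphism `(a, β) ↦ (A a, β ∘ A)`. -/
def prodDual (A : E →L[ℝ] E) : E × (E →L[ℝ] ℝ) →L[ℝ] E × (E →L[ℝ] ℝ) :=
  LinearMap.toContinuousLinearMap
    { toFun := fun q ↦ (A q.1, q.2 ∘L A)
      map_add' := fun q r ↦ by ext <;> simp
      map_smul' := fun t q ↦ by ext <;> simp }

/-- The endomorphism `(a, β) ↦ (c⁻¹ β, s c a)`. -/
def swapDual (c : E →L[ℝ] E →L[ℝ] ℝ) (s : ℝ) : E × (E →L[ℝ] ℝ) →L[ℝ] E × (E →L[ℝ] ℝ) :=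
  LinearMap.toContinuousLinearMap
    { toFun := fun q ↦ (c.inverse q.2, s • c q.1)
      map_add' := fun q r ↦ by ext <;> simp
      map_smul' := fun t q ↦ by ext <;> simp [mul_left_comm] }

/-- A bilinear form on a finite-dimensional space as a continuous bilinear form. -/
def bilinOfFinite {V : Type*} [NormedAddCommGroup V] [NormedSpace ℝ V] [FiniteDimensional ℝ V]
    (B : V →ₗ[ℝ] V →ₗ[ℝ] ℝ) : V →L[ℝ] V →L[ℝ] ℝ :=
  LinearMap.toContinuousLinearMap (LinearMap.toContinuousLinearMap.toLinearMap ∘ₗ B)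

/-- The form `c a a' - β' (c⁻¹ β)`. -/
def sumForm (c : E →L[ℝ] E →L[ℝ] ℝ) :
    E × (E →L[ℝ] ℝ) →L[ℝ] E × (E →L[ℝ] ℝ) →L[ℝ] ℝ :=
  bilinOfFinite
    (LinearMap.mk₂ ℝ (fun q q' : E × (E →L[ℝ] ℝ) ↦ c q.1 q'.1 - q'.2 (c.inverse q.2))
      (fun q q' r ↦ by simp; ring) (fun t q r ↦ by simp; ring)
      (fun q r r' ↦ by simp; ring) (fun t q r ↦ by simp; ring))

/-- The form `s (β a' - β' a)`. -/
def pairForm (s : ℝ) : E × (E →L[ℝ] ℝ) →L[ℝ] E × (E →L[ℝ] ℝ) →L[ℝ] ℝ :=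
  bilinOfFinite
    (LinearMap.mk₂ ℝ (fun q q' : E × (E →L[ℝ] ℝ) ↦ s * (q.2 q'.1 - q'.2 q.1))
      (fun q q' r ↦ by simp; ring) (fun t q r ↦ by simp; ring)
      (fun q r r' ↦ by simp; ring) (fun t q r ↦ by simp; ring))

theorem prodDual_apply (A : E →L[ℝ] E) (q : E × (E →L[ℝ] ℝ)) :
    prodDual A q = (A q.1, q.2 ∘L A) := rfl

theorem swapDual_apply (c : E →L[ℝ] E →L[ℝ] ℝ) (s : ℝ) (q : E × (E →L[ℝ] ℝ)) :
    swapDual c s q = (c.inverse q.2, s • c q.1) := rfl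

theorem swapDual_neg_one_sq {c : E →L[ℝ] E →L[ℝ] ℝ} (hc : c.IsInvertible)
    (q : E × (E →L[ℝ] ℝ)) : swapDual c (-1) (swapDual c (-1) q) = -q := by
  rw [swapDual_apply, swapDual_apply, map_smul, hc.inverse_apply_self, hc.self_apply_inverse]
  ext <;> simp

theorem sumForm_apply (c : E →L[ℝ] E →L[ℝ] ℝ) (q q' : E × (E →L[ℝ] ℝ)) :
    sumForm c q q' = c q.1 q'.1 - q'.2 (c.inverse q.2) := rfl

theorem sumForm_antisymm {c : E →L[ℝ] E →L[ℝ] ℝ} (hc : c.IsInvertible)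
    (h : ∀ a b, c a b = -c b a) (q q' : E × (E →L[ℝ] ℝ)) : sumForm c q q' = -sumForm c q' q := by
  have h1 : q'.2 (c.inverse q.2) = c (c.inverse q'.2) (c.inverse q.2) := by
    rw [hc.self_apply_inverse]
  have h2 : q.2 (c.inverse q'.2) = c (c.inverse q.2) (c.inverse q'.2) := by
    rw [hc.self_apply_inverse]
  rw [sumForm_apply, sumForm_apply, h1, h2, h q.1, h (c.inverse q.2)]
  ring

theorem pairForm_apply (s : ℝ) (q q' : E × (E →L[ℝ] ℝ)) :
    pairForm s q q' = s * (q.2 q'.1 - q'.2 q.1) := rfl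

theorem pairForm_antisymm (s : ℝ) (q q' : E × (E →L[ℝ] ℝ)) :
    pairForm s q q' = -pairForm s q' q := by
  rw [pairForm_apply, pairForm_apply]
  ring

variable {ξ : CotangentBundle I X}

theorem IsConstantIn.cotJNabla [I.Boundaryless] [T2Space X] {Ψ : X → E} {J₀ : E →L[ℝ] E}
    (h : IsConstantIn J U Ψ J₀) (hJ : IsSmoothEndField I J) (htor : cov.torsion = 0)
    (hsymm : HasSymmetricDeriv cov J) :
    IsConstantIn (cotJNabla cov J) ((TotalSpace.proj : CotangentBundle I X → X) ⁻¹' U)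
      (cotCoord Ψ Ψ) (prodDual J₀) := by
  have hΨ := h.toIsCoordinateOn
  refine ⟨hΨ.cotCoord cov hΨ, fun ξ hξ w ↦ ?_⟩
  rw [hΨ.mvfderiv_cotCoord hΨ hξ, hΨ.mvfderiv_cotCoord hΨ hξ, prodDual_apply]
  refine Prod.ext ?_ (ContinuousLinearMap.ext fun e ↦ ?_)
  · rw [cotProjDeriv_cotJNabla]
    exact h.mvfderiv_apply _ hξ _
  · have h1 := hΨ.mvfderiv_momentum cov hξ (_root_.cotJNabla cov J ξ w) e
    have h2 := hΨ.mvfderiv_momentum cov hξ w (J₀ e)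
    refine h1.trans (Eq.trans ?_ h2.symm)
    rw [connector_cotJNabla, cotProjDeriv_cotJNabla, ← h.cov_coordField hJ htor hsymm hξ]
    refine congrArg (· + _) (congrArg (connector cov ξ w) (h.injective hξ ?_))
    refine (h.mvfderiv_apply _ hξ _).trans ?_
    rw [h.mvfderiv_coordField hξ, h.mvfderiv_coordField hξ]

namespace IsSpecialCoordinateOn

theorem mvfderiv_momentum_apply (h : IsSpecialCoordinateOn J g cov U χ φ c) (hξ : ξ.proj ∈ U)
    (w : TangentSpace (cotModel I) ξ) (e : E) :
    mvfderiv (cotModel I) (momentum I χ) ξ w e =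
      connector cov ξ w (coordField I χ e ξ.proj) := by
  rw [h.mvfderiv_momentum cov hξ, h.cov_coordField _ hξ, zero_apply, map_zero, add_zero]

theorem mvfderiv_momentum_mvfderiv (h : IsSpecialCoordinateOn J g cov U χ φ c) (hξ : ξ.proj ∈ U)
    (w : TangentSpace (cotModel I) ξ) (v : TangentSpace I ξ.proj) :
    mvfderiv (cotModel I) (momentum I χ) ξ w (mvfderiv I χ ξ.proj v) = connector cov ξ w v := by
  rw [h.mvfderiv_momentum_apply hξ, h.coordField_mvfderiv hξ]

theorem isCoordinateOn_conj (h : IsSpecialCoordinateOn J g cov U χ φ c)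
    (hJ : IsParaKahler I J g) : IsCoordinateOn I φ U := by
  refine ⟨h.isOpen, h.contMDiffOn_conj, fun x hx ↦ ?_⟩
  refine isInvertible_of_injective (V := E) ?_
  refine (injective_iff_map_eq_zero (mvfderiv I φ x)).2 fun v hv ↦ ?_
  rw [h.mvfderiv_conj x hx] at hv
  rw [← hJ.sq_apply v, h.injective hx (hv.trans (map_zero _).symm), map_zero]

theorem isInvertible_form (h : IsSpecialCoordinateOn J g cov U χ φ c) (hJ : IsParaKahler I J g)
    {x : X} (hx : x ∈ U) : c.IsInvertible := by
  refine isInvertible_of_nondegenerate fun a ha ↦ ?_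
  rw [← h.mvfderiv_coordField hx a, hJ.fundForm_nondegenerate (coordField I χ a x) fun w ↦ ?_,
    map_zero]
  rw [h.fundForm_eq x hx, h.mvfderiv_coordField hx, ha]

theorem form_inverse_mvfderiv (h : IsSpecialCoordinateOn J g cov U χ φ c)
    (hJ : IsParaKahler I J g) (hξ : ξ.proj ∈ U) (w : TangentSpace (cotModel I) ξ) :
    c.inverse (mvfderiv (cotModel I) (momentum I χ) ξ w) =
      mvfderiv I χ ξ.proj ((fundForm I J g ξ.proj).inverse (connector cov ξ w)) := by
  have hc := h.isInvertible_form hJ hξ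
  refine Eq.trans ?_ (hc.inverse_apply_self _)
  congr 1
  ext e
  rw [h.form_mvfderiv hξ, hJ.fundForm_inverse_apply]
  exact h.mvfderiv_momentum_apply hξ w e

theorem isConstantIn_cotJOmega (h : IsSpecialCoordinateOn J g cov U χ φ c)
    (hJ : IsParaKahler I J g) :
    IsConstantIn (cotJOmega cov (fundForm I J g))
      ((TotalSpace.proj : CotangentBundle I X → X) ⁻¹' U) (cotCoord χ χ) (swapDual c 1) := by
  have hχ := h.toIsCoordinateOn
  refine ⟨hχ.cotCoord cov hχ, fun ξ hξ w ↦ ?_⟩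
  rw [hχ.mvfderiv_cotCoord hχ hξ, hχ.mvfderiv_cotCoord hχ hξ, swapDual_apply]
  refine Prod.ext ?_ (ContinuousLinearMap.ext fun e ↦ ?_)
  · rw [cotProjDeriv_cotJOmega]
    exact (h.form_inverse_mvfderiv hJ hξ w).symm
  · refine (h.mvfderiv_momentum_apply hξ _ e).trans ?_
    rw [connector_cotJOmega, one_smul, h.form_mvfderiv hξ]

theorem isConstantIn_cotJProd (h : IsSpecialCoordinateOn J g cov U χ φ c)
    (hJ : IsParaKahler I J g) :
    IsConstantIn (cotJProd cov J g)
      ((TotalSpace.proj : CotangentBundle I X → X) ⁻¹' U) (cotCoord φ χ) (swapDual c (-1)) := by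
  have hχ := h.toIsCoordinateOn
  have hφ := h.isCoordinateOn_conj hJ
  refine ⟨hφ.cotCoord cov hχ, fun ξ hξ w ↦ ?_⟩
  rw [hφ.mvfderiv_cotCoord hχ hξ, hφ.mvfderiv_cotCoord hχ hξ, swapDual_apply]
  refine Prod.ext ?_ (ContinuousLinearMap.ext fun e ↦ ?_)
  · rw [cotProjDeriv_cotJProd, h.mvfderiv_conj _ hξ, hJ.sq_apply]
    exact (h.form_inverse_mvfderiv hJ hξ w).symm
  · refine (h.mvfderiv_momentum_apply hξ _ e).trans ?_
    rw [connector_cotJProd, comp_apply, hJ.fundForm_apply_right, h.mvfderiv_conj _ hξ, smul_apply,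
      h.form_mvfderiv hξ, smul_eq_mul, neg_one_mul]

theorem fundForm_cotJNabla (h : IsSpecialCoordinateOn J g cov U χ φ c)
    (hJ : IsParaKahler I J g) (hξ : ξ.proj ∈ U) (w w' : TangentSpace (cotModel I) ξ) :
    fundForm (cotModel I) (cotJNabla cov J) (cotMetric cov g) ξ w w' =
      sumForm c (mvfderiv (cotModel I) (cotCoord χ χ) ξ w)
        (mvfderiv (cotModel I) (cotCoord χ χ) ξ w') := by
  have hχ := h.toIsCoordinateOn
  rw [hχ.mvfderiv_cotCoord hχ hξ, hχ.mvfderiv_cotCoord hχ hξ, sumForm_apply,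
    hJ.fundForm_cotJNabla, h.fundForm_eq _ hξ, h.form_inverse_mvfderiv hJ hξ,
    h.mvfderiv_momentum_mvfderiv hξ]

theorem fundForm_cotJOmega (h : IsSpecialCoordinateOn J g cov U χ φ c)
    (hJ : IsParaKahler I J g) (hξ : ξ.proj ∈ U) (w w' : TangentSpace (cotModel I) ξ) :
    fundForm (cotModel I) (cotJOmega cov (fundForm I J g)) (cotMetric cov g) ξ w w' =
      pairForm (-1) (mvfderiv (cotModel I) (cotCoord φ χ) ξ w)
        (mvfderiv (cotModel I) (cotCoord φ χ) ξ w') := by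
  have hχ := h.toIsCoordinateOn
  have hφ := h.isCoordinateOn_conj hJ
  rw [hφ.mvfderiv_cotCoord hχ hξ, hφ.mvfderiv_cotCoord hχ hξ, pairForm_apply,
    hJ.fundForm_cotJOmega, h.mvfderiv_conj _ hξ, h.mvfderiv_conj _ hξ,
    h.mvfderiv_momentum_mvfderiv hξ, h.mvfderiv_momentum_mvfderiv hξ]
  ring

theorem fundForm_cotJProd (h : IsSpecialCoordinateOn J g cov U χ φ c)
    (hJ : IsParaKahler I J g) (hξ : ξ.proj ∈ U) (w w' : TangentSpace (cotModel I) ξ) :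
    fundForm (cotModel I) (cotJProd cov J g) (cotMetric cov g) ξ w w' =
      pairForm 1 (mvfderiv (cotModel I) (cotCoord χ χ) ξ w)
        (mvfderiv (cotModel I) (cotCoord χ χ) ξ w') := by
  have hχ := h.toIsCoordinateOn
  rw [hχ.mvfderiv_cotCoord hχ hξ, hχ.mvfderiv_cotCoord hχ hξ, pairForm_apply,
    hJ.fundForm_cotJProd, h.mvfderiv_momentum_mvfderiv hξ, h.mvfderiv_momentum_mvfderiv hξ,
    one_mul]

end IsSpecialCoordinateOn

end CotangentConstant

section TotalSpaceTopology

variable {B F : Type*} {V : B → Type*} [TopologicalSpace B] [TopologicalSpace F]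
  [∀ b, TopologicalSpace (V b)] [TopologicalSpace (TotalSpace F V)] [FiberBundle F V]

theorem FiberBundle.t2Space_totalSpace [T2Space B] [T2Space F] : T2Space (TotalSpace F V) := by
  refine ⟨fun x y hxy ↦ ?_⟩
  by_cases h : x.proj = y.proj
  · let e := trivializationAt F V x.proj
    have hx : x ∈ e.source := FiberBundle.mem_trivializationAt_proj_source
    have hy : y ∈ e.source := by
      rw [e.mem_source, ← h]
      exact FiberBundle.mem_baseSet_trivializationAt' _
    obtain ⟨u, v, hu, hv, hxu, hyv, huv⟩ := t2_separation (e.injOn.ne hx hy hxy)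
    refine ⟨_, _, e.continuousOn_toFun.isOpen_inter_preimage e.open_source hu,
      e.continuousOn_toFun.isOpen_inter_preimage e.open_source hv, ⟨hx, hxu⟩, ⟨hy, hyv⟩, ?_⟩
    exact (huv.preimage e).mono Set.inter_subset_right Set.inter_subset_right
  · exact separated_by_continuous (FiberBundle.continuous_proj F V) h

theorem FiberBundle.secondCountableTopology_totalSpace [SecondCountableTopology B]
    [SecondCountableTopology F] : SecondCountableTopology (TotalSpace F V) := by
  obtain ⟨s, hs, hcover⟩ := TopologicalSpace.countable_cover_nhds
    fun b : B ↦ (trivializationAt F V b).open_baseSet.mem_nhds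
      (FiberBundle.mem_baseSet_trivializationAt' b)
  have : Countable s := hs
  have hsc (b : s) : SecondCountableTopology (trivializationAt F V (b : B)).source :=
    (trivializationAt F V
      (b : B)).toOpenPartialHomeomorph.toHomeomorphSourceTarget.isInducing.secondCountableTopology
  refine TopologicalSpace.secondCountableTopology_of_countable_cover
    (U := fun b : s ↦ (trivializationAt F V (b : B)).source)
    (fun b ↦ (trivializationAt F V (b : B)).open_source) ?_
  refine Set.eq_univ_of_forall fun x ↦ ?_
  obtain ⟨b, hb, hx⟩ := Set.mem_iUnion₂.1 (hcover.symm ▸ Set.mem_univ x.proj)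
  exact Set.mem_iUnion.2 ⟨⟨b, hb⟩, (Trivialization.mem_source _).2 hx⟩

end TotalSpaceTopology

section ParaHyperKahler

variable {E : Type*} [NormedAddCommGroup E] [NormedSpace ℝ E] [FiniteDimensional ℝ E]
  {H : Type*} [TopologicalSpace H] {I : ModelWithCorners ℝ E H}
  {X : Type*} [TopologicalSpace X] [ChartedSpace H X] [IsManifold I ∞ X]
  {J : EndField I X} {g : BilinField I X}
  {cov : CovariantDerivative I E (TangentSpace I : X → Type _)}

namespace IsSpecialParaKahler

theorem exists_tangent_ne_zero (h : IsSpecialParaKahler J g cov) :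
    ∃ (ξ : CotangentBundle I X) (w : TangentSpace (cotModel I) ξ), w ≠ 0 := by
  by_contra! hw
  refine h.paraKahler.paraComplex.ne_id (funext fun x ↦ ContinuousLinearMap.ext fun v ↦ ?_)
  have h0 (v : TangentSpace I x) : v = 0 := by
    obtain ⟨w, h1, -⟩ := exists_cotProjDeriv_connector cov (ξ := ⟨x, 0⟩) v 0
    rw [← h1, hw _ w, (cotProjDeriv _).map_zero]
  rw [h0 (J x v), h0 (ContinuousLinearMap.id ℝ _ v)]

variable [I.Boundaryless] [T2Space X]

theorem exists_isConstantIn_cotJNabla (h : IsSpecialParaKahler J g cov)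
    (ξ : CotangentBundle I X) : ∃ U F c, ξ ∈ U ∧ IsConstantIn (cotJNabla cov J) U F c := by
  obtain ⟨U, χ, φ, c, hξ, hχ⟩ := h.exists_isSpecialCoordinateOn ξ.proj
  obtain ⟨V, Ψ, J₀, hξ', hΨ⟩ :=
    hχ.exists_isConstantIn (fun _ v ↦ h.paraKahler.sq_apply v) hξ
  exact ⟨_, _, _, hξ', hΨ.cotJNabla h.paraKahler.paraComplex.smooth h.torsionFree h.symmetric⟩

theorem exists_isConstantIn_cotJOmega (h : IsSpecialParaKahler J g cov)
    (ξ : CotangentBundle I X) :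
    ∃ U F c, ξ ∈ U ∧ IsConstantIn (cotJOmega cov (fundForm I J g)) U F c := by
  obtain ⟨U, χ, φ, c, hξ, hχ⟩ := h.exists_isSpecialCoordinateOn ξ.proj
  exact ⟨_, _, _, hξ, hχ.isConstantIn_cotJOmega h.paraKahler⟩

theorem isParaComplex_cotJNabla (h : IsSpecialParaKahler J g cov) :
    IsParaComplex (cotModel I) (cotJNabla cov J) where
  toIsAlmostParaComplex := isAlmostParaComplex_of_anticomm
    (B := cotJOmega cov (fundForm I J g))
    (fun ξ ↦ by
      obtain ⟨U, F, c, hξ, hc⟩ := h.exists_isConstantIn_cotJNabla ξ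
      exact hc.contMDiffAt hξ)
    (fun _ ↦ h.paraKahler.cotJNabla_sq) (fun _ ↦ h.paraKahler.cotJOmega_sq)
    (fun _ ↦ h.paraKahler.cotJNabla_cotJOmega) h.exists_tangent_ne_zero
  integrable_plus := isIntegrableDistribution_eigenPlus h.exists_isConstantIn_cotJNabla
  integrable_minus := isIntegrableDistribution_eigenMinus h.exists_isConstantIn_cotJNabla

theorem isParaComplex_cotJOmega (h : IsSpecialParaKahler J g cov) :
    IsParaComplex (cotModel I) (cotJOmega cov (fundForm I J g)) where
  toIsAlmostParaComplex := isAlmostParaComplex_of_anticomm (B := cotJNabla cov J)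
    (fun ξ ↦ by
      obtain ⟨U, F, c, hξ, hc⟩ := h.exists_isConstantIn_cotJOmega ξ
      exact hc.contMDiffAt hξ)
    (fun _ ↦ h.paraKahler.cotJOmega_sq) (fun _ ↦ h.paraKahler.cotJNabla_sq)
    (fun _ w ↦ neg_eq_iff_eq_neg.1 (h.paraKahler.cotJNabla_cotJOmega w).symm)
    h.exists_tangent_ne_zero
  integrable_plus := isIntegrableDistribution_eigenPlus h.exists_isConstantIn_cotJOmega
  integrable_minus := isIntegrableDistribution_eigenMinus h.exists_isConstantIn_cotJOmega

theorem isComplexStructure_cotJProd (h : IsSpecialParaKahler J g cov) :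
    IsComplexStructure (cotModel I) (cotJProd cov J g) where
  smooth ξ := by
    obtain ⟨U, χ, φ, c, hξ, hχ⟩ := h.exists_isSpecialCoordinateOn ξ.proj
    exact (hχ.isConstantIn_cotJProd h.paraKahler).contMDiffAt hξ
  sq_eq_neg ξ w := by
    change cotJNabla cov J ξ (cotJOmega cov _ ξ (cotJNabla cov J ξ (cotJOmega cov _ ξ w))) = -w
    rw [h.paraKahler.cotJNabla_cotJOmega w, ContinuousLinearMap.map_neg,
      ContinuousLinearMap.map_neg, h.paraKahler.cotJOmega_sq, h.paraKahler.cotJNabla_sq]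
  integrable ξ := by
    obtain ⟨U, χ, φ, c, hξ, hχ⟩ := h.exists_isSpecialCoordinateOn ξ.proj
    obtain ⟨ψ, hψ, hξψ, hd⟩ := (hχ.isConstantIn_cotJProd h.paraKahler).exists_chart_apply hξ
    exact ⟨ψ, hψ, hξψ, swapDual c (-1),
      swapDual_neg_one_sq (hχ.isInvertible_form h.paraKahler hξ), hd⟩

theorem isSmoothBilinField_cotMetric (h : IsSpecialParaKahler J g cov) :
    IsSmoothBilinField (cotModel I) (cotMetric cov g) := by
  have h1 : IsSmoothBilinField (cotModel I)
      (fundForm (cotModel I) (cotJNabla cov J) (cotMetric cov g)) := by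
    intro ξ
    obtain ⟨U, χ, φ, c, hξ, hχ⟩ := h.exists_isSpecialCoordinateOn ξ.proj
    have hcot := hχ.toIsCoordinateOn.cotCoord cov hχ.toIsCoordinateOn
    refine contMDiffAt_bilinField_of_mvfderiv (hcot.contMDiffAt hξ) (sumForm c) ?_
    filter_upwards [hcot.isOpen.mem_nhds hξ] with η hη
    exact hχ.fundForm_cotJNabla h.paraKahler hη
  have h2 := h1.comp_endField h.isParaComplex_cotJNabla.smooth
  convert h2 using 2 with ξ
  ext w w'
  change _ = cotMetric cov g ξ (cotJNabla cov J ξ (cotJNabla cov J ξ w)) w'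
  rw [h.paraKahler.cotJNabla_sq]

theorem isPseudoRiemannian_cotMetric (h : IsSpecialParaKahler J g cov) :
    IsPseudoRiemannian (cotModel I) (cotMetric cov g) where
  smooth := h.isSmoothBilinField_cotMetric
  symm _ := h.paraKahler.cotMetric_symm
  nondegenerate _ := h.paraKahler.cotMetric_nondegenerate

theorem isClosedTwoForm_cotJNabla (h : IsSpecialParaKahler J g cov) :
    IsClosedTwoForm (cotModel I) (fundForm (cotModel I) (cotJNabla cov J) (cotMetric cov g)) := by
  refine isClosedTwoForm_of_mvfderiv (V := E × (E →L[ℝ] ℝ)) fun ξ ↦ ?_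
  obtain ⟨U, χ, φ, c, hξ, hχ⟩ := h.exists_isSpecialCoordinateOn ξ.proj
  have hcot := hχ.toIsCoordinateOn.cotCoord cov hχ.toIsCoordinateOn
  refine ⟨_, sumForm c, hcot.contMDiffAt hξ, sumForm_antisymm (hχ.isInvertible_form h.paraKahler hξ)
    (hχ.form_antisymm h.paraKahler hξ), ?_⟩
  filter_upwards [hcot.isOpen.mem_nhds hξ] with η hη
  exact hχ.fundForm_cotJNabla h.paraKahler hη

theorem isClosedTwoForm_cotJOmega (h : IsSpecialParaKahler J g cov) :
    IsClosedTwoForm (cotModel I)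
      (fundForm (cotModel I) (cotJOmega cov (fundForm I J g)) (cotMetric cov g)) := by
  refine isClosedTwoForm_of_mvfderiv (V := E × (E →L[ℝ] ℝ)) fun ξ ↦ ?_
  obtain ⟨U, χ, φ, c, hξ, hχ⟩ := h.exists_isSpecialCoordinateOn ξ.proj
  have hcot := (hχ.isCoordinateOn_conj h.paraKahler).cotCoord cov hχ.toIsCoordinateOn
  refine ⟨_, pairForm (-1), hcot.contMDiffAt hξ, pairForm_antisymm (-1), ?_⟩
  filter_upwards [hcot.isOpen.mem_nhds hξ] with η hη
  exact hχ.fundForm_cotJOmega h.paraKahler hη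

theorem isClosedTwoForm_cotJProd (h : IsSpecialParaKahler J g cov) :
    IsClosedTwoForm (cotModel I) (fundForm (cotModel I) (cotJProd cov J g) (cotMetric cov g)) := by
  refine isClosedTwoForm_of_mvfderiv (V := E × (E →L[ℝ] ℝ)) fun ξ ↦ ?_
  obtain ⟨U, χ, φ, c, hξ, hχ⟩ := h.exists_isSpecialCoordinateOn ξ.proj
  have hcot := hχ.toIsCoordinateOn.cotCoord cov hχ.toIsCoordinateOn
  refine ⟨_, pairForm 1, hcot.contMDiffAt hξ, pairForm_antisymm 1, ?_⟩
  filter_upwards [hcot.isOpen.mem_nhds hξ] with η hη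
  exact hχ.fundForm_cotJProd h.paraKahler hη

theorem isParaHypercomplex (h : IsSpecialParaKahler J g cov) :
    IsParaHypercomplex (cotModel I) (cotJNabla cov J) (cotJOmega cov (fundForm I J g))
      (cotJProd cov J g) where
  eq_comp _ _ := rfl
  anticomm₁₂ _ := h.paraKahler.cotJNabla_cotJOmega
  anticomm₁₃ ξ w := by
    change cotJNabla cov J ξ (cotJNabla cov J ξ (cotJOmega cov _ ξ w)) =
      -cotJNabla cov J ξ (cotJOmega cov _ ξ (cotJNabla cov J ξ w))
    rw [h.paraKahler.cotJNabla_cotJOmega w, ContinuousLinearMap.map_neg]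
  anticomm₂₃ ξ w := by
    change cotJOmega cov _ ξ (cotJNabla cov J ξ (cotJOmega cov _ ξ w)) =
      -cotJNabla cov J ξ (cotJOmega cov _ ξ (cotJOmega cov _ ξ w))
    rw [h.paraKahler.cotJNabla_cotJOmega (cotJOmega cov _ ξ w), neg_neg]
  types := Or.inl ⟨h.isParaComplex_cotJNabla, h.isParaComplex_cotJOmega,
    h.isComplexStructure_cotJProd⟩

theorem isParaHyperKahler (h : IsSpecialParaKahler J g cov) :
    IsParaHyperKahler (cotModel I) (cotJNabla cov J) (cotJOmega cov (fundForm I J g))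
      (cotJProd cov J g) (cotMetric cov g) where
  hypercomplex := h.isParaHypercomplex
  metric := h.isPseudoRiemannian_cotMetric
  skew₁ := isSkewFor_of_fundForm_antisymm (fun _ ↦ h.paraKahler.cotMetric_symm) fun ξ w w' ↦ by
    obtain ⟨U, χ, φ, c, hξ, hχ⟩ := h.exists_isSpecialCoordinateOn ξ.proj
    rw [hχ.fundForm_cotJNabla h.paraKahler hξ, hχ.fundForm_cotJNabla h.paraKahler hξ]
    exact sumForm_antisymm (hχ.isInvertible_form h.paraKahler hξ)
      (hχ.form_antisymm h.paraKahler hξ) _ _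
  skew₂ := isSkewFor_of_fundForm_antisymm (fun _ ↦ h.paraKahler.cotMetric_symm) fun ξ w w' ↦ by
    rw [h.paraKahler.fundForm_cotJOmega, h.paraKahler.fundForm_cotJOmega, neg_sub]
  skew₃ := isSkewFor_of_fundForm_antisymm (fun _ ↦ h.paraKahler.cotMetric_symm) fun ξ w w' ↦ by
    rw [h.paraKahler.fundForm_cotJProd, h.paraKahler.fundForm_cotJProd, neg_sub]
  closed₁ := h.isClosedTwoForm_cotJNabla
  closed₂ := h.isClosedTwoForm_cotJOmega
  closed₃ := h.isClosedTwoForm_cotJProd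

end IsSpecialParaKahler

end ParaHyperKahler

end

theorem theorem2 {E : Type*} [NormedAddCommGroup E] [NormedSpace ℝ E] [FiniteDimensional ℝ E]
    {M : Type*} [TopologicalSpace M] [T2Space M] [SecondCountableTopology M]
    [ChartedSpace E M] [IsManifold 𝓘(ℝ, E) ∞ M]
    (J : EndField 𝓘(ℝ, E) M) (g : BilinField 𝓘(ℝ, E) M)
    (cov : CovariantDerivative 𝓘(ℝ, E) E (TangentSpace 𝓘(ℝ, E) : M → Type _))
    (hM : IsSpecialParaKahler J g cov)
    (J₁ J₂ J₃ : EndField (cotModel 𝓘(ℝ, E)) (CotangentBundle 𝓘(ℝ, E) M))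
    (gN : BilinField (cotModel 𝓘(ℝ, E)) (CotangentBundle 𝓘(ℝ, E) M))
    (hJ₁ : J₁ = cotJNabla cov J)
    (hJ₂ : J₂ = cotJOmega cov (fundForm 𝓘(ℝ, E) J g))
    (hJ₃ : J₃ = fun ξ ↦ J₁ ξ ∘L J₂ ξ)
    (hgN : gN = cotMetric cov g) :
    T2Space (CotangentBundle 𝓘(ℝ, E) M) ∧
    SecondCountableTopology (CotangentBundle 𝓘(ℝ, E) M) ∧
    IsParaHyperKahler (cotModel 𝓘(ℝ, E)) J₁ J₂ J₃ gN ∧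
    IsParaComplex (cotModel 𝓘(ℝ, E)) J₁ ∧
    IsParaComplex (cotModel 𝓘(ℝ, E)) J₂ ∧
    IsComplexStructure (cotModel 𝓘(ℝ, E)) J₃ := by
  subst hJ₁ hJ₂ hJ₃ hgN
  exact ⟨FiberBundle.t2Space_totalSpace, FiberBundle.secondCountableTopology_totalSpace,
    hM.isParaHyperKahler, hM.isParaComplex_cotJNabla, hM.isParaComplex_cotJOmega,
    hM.isComplexStructure_cotJProd⟩
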